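/- Let $\Omega\subset\mathbb{R}^2$ be a bounded domain (nonempty, open, connected), and let $\psi$ be the stream function of a steady flow in $\Omega$ with vorticity $\omega=\Delta\psi$, that is, $\{\psi,\omega\}=\partial_1\psi\,\partial_2\omega-\partial_2\psi\,\partial_1\omega=0$ a.e. in $\Omega$ and $\psi$ is constant on $\partial\Omega$, in the sense that $\psi-b\in H_0^1(\Omega)$ for some $b\in\mathbb{R}$. Assume that the flow satisfies Arnold's stability criterion: $\psi\in W^{3,1}(\Omega)$, there is $C>0$ with $$C^{-1}|\nabla\psi|\le|\nabla\Delta\psi|\le C|\nabla\psi|\quad\text{a.e. in }\Omega,$$ and one of the following holds: (1) $\nabla\psi\cdot\nabla\Delta\psi=|\nabla\psi|\,|\nabla\Delta\psi|$ a.e. in $\Omega$; (2) $-\nabla\psi\cdot\nabla\Delta\psi=|\nabla\psi|\,|\nabla\Delta\psi|$ a.e. in $\Omega$, and there is a nonincreasing Lipschitz function $f:\mathbb{R}\to\mathbb{R}$ with $\omega=f(\psi)$ a.e. in $\Omega$ and $$\operatorname*{ess\,inf}_{s\in[\inf\psi,\,\sup\psi]}f'(s)>-\lambda_1(-\Delta,\Omega),$$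 where $\inf\psi,\sup\psi$ are the essential infimum and supremum of $\psi$ over $\Omega$ and $\lambda_1(-\Delta,\Omega)$ is the first eigenvalue of $-\Delta$ on $\Omega$ with Dirichlet boundary condition. Then $\omega\ge0$ a.e. in $\Omega$ or $\omega\le0$ a.e. in $\Omega$. -/

import Mathlib

open MeasureTheory Filter Topology TopologicalSpace
open scoped ENNReal NNReal Distributions

/-- The plane with its Euclidean norm and inner product. -/
abbrev Plane : Type := EuclideanSpace ℝ (Fin 2)

noncomputable section

/-- The classical partial derivative `∂ᵢφ`. -/
def partialD (i : Fin 2) (φ : Plane → ℝ) (x : Plane) : ℝ :=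
  fderiv ℝ φ x (EuclideanSpace.single i 1)

/-- `g` is the weak partial derivative `∂ᵢu` on the open set `Ω`. -/
def HasWeakPartial (Ω : Opens Plane) (i : Fin 2) (u g : Plane → ℝ) : Prop :=
  LocallyIntegrableOn u Ω ∧ LocallyIntegrableOn g Ω ∧
    ∀ φ : 𝓓(Ω, ℝ), ∫ x in Ω, u x * partialD i φ x = -∫ x in Ω, g x * φ x

/-- `G` is the weak gradient `∇u` on the open set `Ω`. -/
def HasWeakGradient (Ω : Opens Plane) (u : Plane → ℝ) (G : Plane → Plane) : Prop :=
  ∀ i, HasWeakPartial Ω i u (fun x => G x i)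

/-- `w` is the distributional Laplacian `Δu` on the open set `Ω`. -/
def HasWeakLaplacian (Ω : Opens Plane) (u w : Plane → ℝ) : Prop :=
  LocallyIntegrableOn u Ω ∧ LocallyIntegrableOn w Ω ∧
    ∀ φ : 𝓓(Ω, ℝ), ∫ x in Ω, u x * ∑ i, partialD i (partialD i φ) x = ∫ x in Ω, w x * φ x

/-- Membership in the Sobolev space `W^{k,p}(Ω)`. -/
def MemSobolev (Ω : Opens Plane) (p : ℝ≥0∞) : ℕ → (Plane → ℝ) → Prop
  | 0, u => MemLp u p (volume.restrict Ω)
  | k + 1, u => MemLp u p (volume.restrict Ω) ∧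
      ∀ i, ∃ g, HasWeakPartial Ω i u g ∧ MemSobolev Ω p k g

/-- Membership in `H₀¹(Ω)`, the closure of the test functions in `W^{1,2}(Ω)`. -/
def MemH10 (Ω : Opens Plane) (u : Plane → ℝ) : Prop :=
  MemLp u 2 (volume.restrict Ω) ∧
    ∃ G : Plane → Plane, HasWeakGradient Ω u G ∧
      (∀ i, MemLp (fun x => G x i) 2 (volume.restrict Ω)) ∧
      ∃ φ : ℕ → 𝓓(Ω, ℝ),
        Tendsto (fun n => eLpNorm (fun x => φ n x - u x) 2 (volume.restrict Ω)) atTop (𝓝 0) ∧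
        ∀ i, Tendsto (fun n => eLpNorm (fun x => partialD i (φ n) x - G x i) 2
          (volume.restrict Ω)) atTop (𝓝 0)

/-- `μ` is an eigenvalue of `-Δ` on `Ω` with Dirichlet boundary condition: `-Δu = μu` in the sense
of distributions for some nonzero `u ∈ H₀¹(Ω)`. -/
def IsDirichletEigenvalue (Ω : Opens Plane) (μ : ℝ) : Prop :=
  ∃ u : Plane → ℝ, MemH10 Ω u ∧ ¬ (∀ᵐ x ∂(volume.restrict (Ω : Set Plane)), u x = 0) ∧
    HasWeakLaplacian Ω u (fun x => -μ * u x)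

/-- The first Dirichlet eigenvalue `λ₁(-Δ, Ω)`. -/
def firstDirichletEigenvalue (Ω : Opens Plane) : ℝ :=
  sInf {μ : ℝ | IsDirichletEigenvalue Ω μ}

/-- `ψ` is the stream function, and `ω` the vorticity, of a steady flow in `Ω`: `ω = Δψ`,
`{ψ, ω} = ∂₁ψ ∂₂ω - ∂₂ψ ∂₁ω = 0`, and `ψ` is constant on the boundary. -/
structure IsSteadyFlow (Ω : Opens Plane) (ψ ω : Plane → ℝ) : Prop where
  vorticity : HasWeakLaplacian Ω ψ ω
  boundary : ∃ b : ℝ, MemH10 Ω (fun x => ψ x - b)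
  steady : ∃ Gψ Gω : Plane → Plane, HasWeakGradient Ω ψ Gψ ∧ HasWeakGradient Ω ω Gω ∧
    ∀ᵐ x ∂(volume.restrict (Ω : Set Plane)), Gψ x 0 * Gω x 1 - Gψ x 1 * Gω x 0 = 0

/-- The interval `[inf ψ, sup ψ] ⊆ ℝ`, with the essential infimum and supremum over `Ω` taken in
the extended reals. -/
def essRangeInterval (Ω : Opens Plane) (ψ : Plane → ℝ) : Set ℝ :=
  {s : ℝ | essInf (fun x => (ψ x : EReal)) (volume.restrict (Ω : Set Plane)) ≤ (s : EReal) ∧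
    (s : EReal) ≤ essSup (fun x => (ψ x : EReal)) (volume.restrict (Ω : Set Plane))}

/-- Arnold's stability criterion for the stream function `ψ` with vorticity `ω = Δψ`. The derivative
of the Lipschitz function `f` exists almost everywhere, and its infimum is the essential one. -/
def ArnoldStable (Ω : Opens Plane) (ψ ω : Plane → ℝ) : Prop :=
  MemSobolev Ω 1 3 ψ ∧
  ∃ Gψ Gω : Plane → Plane, HasWeakGradient Ω ψ Gψ ∧ HasWeakGradient Ω ω Gω ∧
    (∃ C : ℝ, 0 < C ∧ ∀ᵐ x ∂(volume.restrict (Ω : Set Plane)),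
      C⁻¹ * ‖Gψ x‖ ≤ ‖Gω x‖ ∧ ‖Gω x‖ ≤ C * ‖Gψ x‖) ∧
    ((∀ᵐ x ∂(volume.restrict (Ω : Set Plane)), inner ℝ (Gψ x) (Gω x) = ‖Gψ x‖ * ‖Gω x‖) ∨
     ((∀ᵐ x ∂(volume.restrict (Ω : Set Plane)), -inner ℝ (Gψ x) (Gω x) = ‖Gψ x‖ * ‖Gω x‖) ∧
      ∃ f : ℝ → ℝ, Antitone f ∧ (∃ K : ℝ≥0, LipschitzWith K f) ∧
        (∀ᵐ x ∂(volume.restrict (Ω : Set Plane)), ω x = f (ψ x)) ∧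
        ((-firstDirichletEigenvalue Ω : ℝ) : EReal) <
          essInf (fun s => ((deriv f s : ℝ) : EReal)) (volume.restrict (essRangeInterval Ω ψ))))

end

/-!
Let `b` be the boundary value of `ψ` and `u = ψ - b ∈ H₀¹(Ω)`, so that `Δu = ω`.

If `∇ψ` and `∇ω` are parallel, then `∇u · ∇ω ≥ 0`, and `∇u` vanishes where `∇ω` does. Testing
`Δu = ω` with `T(ω) T(u)` for a smooth step `T` shows `ω ≤ 0` on `{u > 0}`, and testing it with
`T(-n ω) η` shows that `u⁺` is superharmonic. By the strong minimum principle, proved with weighted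
means over discs, either `u⁺ = 0`, or `u > 0` and hence `ω ≤ 0`. Applied to `u` and to `-u`, this
dichotomy leaves only `u = 0`, in which case `ω = 0`.

If `ω = f(ψ)`, then `b` lies between the infimum and the supremum of `ψ`, since a nonzero constant
is not in `H₀¹`. A lower bound `m > -λ₁` for `f'` gives `ω - f(b) ≥ m u` on `{u > 0}`. If
`f(b) ≥ 0`, testing with `u⁺` gives `λ₁ ‖u⁺‖² ≤ ‖∇u⁺‖² ≤ -m ‖u⁺‖²`, so that `ψ ≤ b` and
`ω = f(ψ) ≥ f(b) ≥ 0` by monotonicity; if `f(b) ≤ 0`, the same argument for `-u` gives `ω ≤ 0`.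
Here `λ₁`, the infimum of the eigenvalues, bounds the Rayleigh quotient from below because, by
Rellich compactness, the infimum of the quotient is attained and hence is an eigenvalue.
-/

section TestFunctions

variable {Ω : Opens Plane}

/-- The test function on `Ω` given by a smooth function whose support lies in that of a test
function. -/
def testOfSupport (φ : 𝓓(Ω, ℝ)) (g : Plane → ℝ) (hg : ContDiff ℝ (⊤ : ℕ∞) g)
    (h : Function.support g ⊆ tsupport φ) : 𝓓(Ω, ℝ) :=
  ⟨g, hg, φ.hasCompactSupport.mono' h,
    (closure_minimal h (isClosed_tsupport _)).trans φ.tsupport_subset⟩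

theorem contDiff_partialD {φ : Plane → ℝ} (hφ : ContDiff ℝ (⊤ : ℕ∞) φ) (i : Fin 2) :
    ContDiff ℝ (⊤ : ℕ∞) (partialD i φ) :=
  (hφ.fderiv_right (m := (⊤ : ℕ∞)) (by simp)).clm_apply contDiff_const

theorem support_partialD_subset (φ : Plane → ℝ) (i : Fin 2) :
    Function.support (partialD i φ) ⊆ tsupport φ := fun _ hx =>
  support_fderiv_subset ℝ fun h => hx (by simp [partialD, h])

/-- The partial derivative of a test function, as a test function. -/
noncomputable def testPartialD (i : Fin 2) (φ : 𝓓(Ω, ℝ)) : 𝓓(Ω, ℝ) :=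
  testOfSupport φ (partialD i φ) (contDiff_partialD φ.contDiff i) (support_partialD_subset _ _)

@[simp] theorem coe_testPartialD (i : Fin 2) (φ : 𝓓(Ω, ℝ)) :
    ⇑(testPartialD i φ) = partialD i φ := rfl

/-- The product of a test function and a smooth function, as a test function. -/
noncomputable def testMul (φ : 𝓓(Ω, ℝ)) (g : Plane → ℝ) (hg : ContDiff ℝ (⊤ : ℕ∞) g) :
    𝓓(Ω, ℝ) :=
  testOfSupport φ (fun x => φ x * g x) (φ.contDiff.mul hg) fun _ hx =>
    subset_tsupport _ fun h => hx (by simp [h])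

@[simp] theorem coe_testMul (φ : 𝓓(Ω, ℝ)) (g : Plane → ℝ) (hg : ContDiff ℝ (⊤ : ℕ∞) g) :
    ⇑(testMul φ g hg) = fun x => φ x * g x := rfl

/-- The composition of a smooth function vanishing at `0` with a test function, as a test
function. -/
noncomputable def testComp (φ : 𝓓(Ω, ℝ)) (h : ℝ → ℝ) (hh : ContDiff ℝ (⊤ : ℕ∞) h)
    (h0 : h 0 = 0) : 𝓓(Ω, ℝ) :=
  testOfSupport φ (fun x => h (φ x)) (hh.comp φ.contDiff) fun _ hx =>
    subset_tsupport _ fun h' => hx (by simp [h', h0])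

@[simp] theorem coe_testComp (φ : 𝓓(Ω, ℝ)) (h : ℝ → ℝ) (hh : ContDiff ℝ (⊤ : ℕ∞) h)
    (h0 : h 0 = 0) : ⇑(testComp φ h hh h0) = fun x => h (φ x) := rfl

theorem differentiable_testFunction (φ : 𝓓(Ω, ℝ)) : Differentiable ℝ φ :=
  φ.contDiff.differentiable (by simp)

theorem partialD_mul {f g : Plane → ℝ} {x : Plane} (hf : DifferentiableAt ℝ f x)
    (hg : DifferentiableAt ℝ g x) (i : Fin 2) :
    partialD i (fun y => f y * g y) x = partialD i f x * g x + f x * partialD i g x := by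
  simp only [partialD, fderiv_fun_mul hf hg, add_apply, smul_apply, smul_eq_mul]
  ring

theorem partialD_comp {h : ℝ → ℝ} {g : Plane → ℝ} {x : Plane} (hh : DifferentiableAt ℝ h (g x))
    (hg : DifferentiableAt ℝ g x) (i : Fin 2) :
    partialD i (fun y => h (g y)) x = deriv h (g x) * partialD i g x := by
  have hcomp : HasFDerivAt (fun y => h (g y)) (deriv h (g x) • fderiv ℝ g x) x :=
    hh.hasDerivAt.comp_hasFDerivAt x hg.hasFDerivAt
  simp only [partialD, hcomp.fderiv, smul_apply, smul_eq_mul]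

theorem partialD_add {f g : Plane → ℝ} {x : Plane} (hf : DifferentiableAt ℝ f x)
    (hg : DifferentiableAt ℝ g x) (i : Fin 2) :
    partialD i (fun y => f y + g y) x = partialD i f x + partialD i g x := by
  simp only [partialD, fderiv_fun_add hf hg, add_apply]

theorem partialD_const_mul {f : Plane → ℝ} {x : Plane} (hf : DifferentiableAt ℝ f x)
    (c : ℝ) (i : Fin 2) :
    partialD i (fun y => c * f y) x = c * partialD i f x := by
  simp only [partialD, fderiv_const_mul hf, smul_apply, smul_eq_mul]

theorem memLp_testFunction (φ : 𝓓(Ω, ℝ)) (p : ℝ≥0∞) (μ : Measure Plane)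
    [IsFiniteMeasureOnCompacts μ] : MemLp φ p μ :=
  φ.continuous.memLp_of_hasCompactSupport φ.hasCompactSupport

theorem integrable_mul_testFunction {u : Plane → ℝ} (hu : LocallyIntegrableOn u Ω)
    (φ : 𝓓(Ω, ℝ)) : Integrable (fun x => u x * φ x) (volume.restrict (Ω : Set Plane)) := by
  have h : IntegrableOn (fun x => u x * φ x) (tsupport φ) :=
    (hu.integrableOn_compact_subset φ.tsupport_subset φ.hasCompactSupport).mul_continuousOn
      φ.continuous.continuousOn φ.hasCompactSupport
  refine h.of_forall_sdiff_eq_zero Ω.isOpen.measurableSet fun x hx => ?_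
  simp [image_eq_zero_of_notMem_tsupport hx.2]

theorem integral_sub_mul_testFunction {u v : Plane → ℝ} (hu : LocallyIntegrableOn u Ω)
    (hv : LocallyIntegrableOn v Ω) (φ : 𝓓(Ω, ℝ)) :
    ∫ x in Ω, (u x - v x) * φ x = (∫ x in Ω, u x * φ x) - ∫ x in Ω, v x * φ x := by
  simp only [sub_mul]
  exact integral_sub (integrable_mul_testFunction hu φ) (integrable_mul_testFunction hv φ)

theorem locallyIntegrableOn_of_memLp {u : Plane → ℝ} {p : ℝ≥0∞} (hp : 1 ≤ p)
    (hu : MemLp u p (volume.restrict (Ω : Set Plane))) : LocallyIntegrableOn u Ω := by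
  rw [locallyIntegrableOn_iff Ω.isOpen.isLocallyClosed]
  intro K hK hKc
  have : IsFiniteMeasure (volume.restrict K) := ⟨by simpa using hKc.measure_lt_top⟩
  exact (hu.mono_measure (Measure.restrict_mono hK le_rfl)).integrable hp

theorem HasWeakLaplacian.integral_gradient {u w : Plane → ℝ} {G : Plane → Plane}
    (hw : HasWeakLaplacian Ω u w) (hG : HasWeakGradient Ω u G) (φ : 𝓓(Ω, ℝ)) :
    ∫ x in Ω, ∑ i, G x i * partialD i φ x = -∫ x in Ω, w x * φ x := by
  have hGφ : ∀ i, Integrable (fun x => G x i * partialD i φ x) (volume.restrict (Ω : Set Plane)) :=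
    fun i => integrable_mul_testFunction (hG i).2.1 (testPartialD i φ)
  have huφ : ∀ i, Integrable (fun x => u x * partialD i (partialD i φ) x)
      (volume.restrict (Ω : Set Plane)) :=
    fun i => integrable_mul_testFunction hw.1 (testPartialD i (testPartialD i φ))
  rw [← hw.2.2 φ]
  simp only [Finset.mul_sum]
  rw [integral_finsetSum _ fun i _ => hGφ i, integral_finsetSum _ fun i _ => huφ i,
    ← Finset.sum_neg_distrib]
  exact Finset.sum_congr rfl fun i _ =>
    neg_eq_iff_eq_neg.1 ((hG i).2.2 (testPartialD i φ)).symm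

theorem ae_eq_zero_of_integral_mul_testFunction {f : Plane → ℝ} (hf : LocallyIntegrableOn f Ω)
    (h : ∀ φ : 𝓓(Ω, ℝ), ∫ x in Ω, f x * φ x = 0) :
    ∀ᵐ x ∂(volume.restrict (Ω : Set Plane)), f x = 0 := by
  rw [ae_restrict_iff' Ω.isOpen.measurableSet]
  refine Ω.isOpen.ae_eq_zero_of_integral_contDiff_smul_eq_zero hf fun g hg hgc hgs => ?_
  calc ∫ x, g x • f x = ∫ x in Ω, g x • f x := by
        refine (setIntegral_eq_integral_of_forall_compl_eq_zero fun x hx => ?_).symm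
        rw [image_eq_zero_of_notMem_tsupport fun h' => hx (hgs h'), zero_smul]
    _ = ∫ x in Ω, f x * (⟨g, hg, hgc, hgs⟩ : 𝓓(Ω, ℝ)) x := by
        simp only [smul_eq_mul, mul_comm, TestFunction.coe_mk]
    _ = 0 := h _

theorem HasWeakPartial.ae_unique {u g g' : Plane → ℝ} {i : Fin 2} (h : HasWeakPartial Ω i u g)
    (h' : HasWeakPartial Ω i u g') : ∀ᵐ x ∂(volume.restrict (Ω : Set Plane)), g x = g' x := by
  have hsub : ∀ᵐ x ∂(volume.restrict (Ω : Set Plane)), g x - g' x = 0 := by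
    refine ae_eq_zero_of_integral_mul_testFunction (h.2.1.sub h'.2.1) fun φ => ?_
    rw [integral_sub_mul_testFunction h.2.1 h'.2.1]
    linarith [h.2.2 φ, h'.2.2 φ]
  filter_upwards [hsub] with x hx using sub_eq_zero.1 hx

theorem HasWeakGradient.ae_unique {u : Plane → ℝ} {G G' : Plane → Plane}
    (h : HasWeakGradient Ω u G) (h' : HasWeakGradient Ω u G') :
    ∀ᵐ x ∂(volume.restrict (Ω : Set Plane)), G x = G' x := by
  filter_upwards [ae_all_iff.2 fun i => (h i).ae_unique (h' i)] with x hx using PiLp.ext hx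

end TestFunctions

section Mollification

open scoped Convolution
open ContinuousLinearMap

variable {E : Type*} [NormedAddCommGroup E] [NormedSpace ℝ E] [FiniteDimensional ℝ E]
  [MeasurableSpace E] [BorelSpace E] {μ : Measure E} [μ.IsAddHaarMeasure]

theorem enorm_integral_rpow_le_lintegral {α F : Type*} [MeasurableSpace α] [NormedAddCommGroup F]
    [NormedSpace ℝ F] {ν : Measure α} [IsProbabilityMeasure ν] {f : α → F} {p : ℝ} (hp : 1 ≤ p)
    (hf : AEStronglyMeasurable f ν) : ‖∫ x, f x ∂ν‖ₑ ^ p ≤ ∫⁻ x, ‖f x‖ₑ ^ p ∂ν := by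
  have p0 : 0 < p := by linarith
  have h := eLpNorm_le_eLpNorm_of_exponent_le (p := 1) (q := ENNReal.ofReal p) (by simpa using hp)
    hf
  rw [eLpNorm_one_eq_lintegral_enorm, eLpNorm_eq_lintegral_rpow_enorm_toReal (by simpa using p0)
    ENNReal.ofReal_ne_top, ENNReal.toReal_ofReal p0.le, one_div] at h
  calc ‖∫ x, f x ∂ν‖ₑ ^ p ≤ ((∫⁻ x, ‖f x‖ₑ ^ p ∂ν) ^ p⁻¹) ^ p :=
        ENNReal.rpow_le_rpow ((enorm_integral_le_lintegral_enorm f).trans h) p0.le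
    _ = ∫⁻ x, ‖f x‖ₑ ^ p ∂ν := ENNReal.rpow_inv_rpow p0.ne' _

theorem tendsto_eLpNorm_translate_sub {F : Type*} [NormedAddCommGroup F] {p : ℝ≥0∞} (hp : 1 ≤ p)
    (hp' : p ≠ ⊤) {g : E → F} (hg : MemLp g p μ) :
    Tendsto (fun t => eLpNorm (fun x => g (x - t) - g x) p μ) (𝓝 0) (𝓝 0) := by
  have : Fact (1 ≤ p) := ⟨hp⟩
  have : Fact (p ≠ ⊤) := ⟨hp'⟩
  have hcont : Continuous fun t : E => edist (DomAddAct.mk (-t) +ᵥ hg.toLp g) (hg.toLp g) := by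
    fun_prop
  have h := hcont.tendsto 0
  simp only [neg_zero, DomAddAct.mk_zero, zero_vadd, edist_self] at h
  refine h.congr fun t => ?_
  rw [DomAddAct.mk_vadd_toLp, Lp.edist_toLp_toLp]
  refine eLpNorm_congr_ae (Eventually.of_forall fun x => ?_)
  simp [sub_eq_neg_add]

theorem lintegral_normed_bump (b : ContDiffBump (0 : E)) :
    ∫⁻ t, ENNReal.ofReal (b.normed μ t) ∂μ = 1 := by
  rw [← ofReal_integral_eq_lintegral_ofReal b.integrable_normed
    (Eventually.of_forall b.nonneg_normed), b.integral_normed, ENNReal.ofReal_one]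

variable (μ) in
/-- The probability measure with density a normalized bump function: mollification by the bump is
averaging of the translates with respect to this measure. -/
noncomputable def bumpMeasure (b : ContDiffBump (0 : E)) : Measure E :=
  μ.withDensity fun t => ENNReal.ofReal (b.normed μ t)

instance (b : ContDiffBump (0 : E)) : IsProbabilityMeasure (bumpMeasure μ b) :=
  ⟨by rw [bumpMeasure, withDensity_apply _ MeasurableSet.univ, Measure.restrict_univ,
    lintegral_normed_bump]⟩

omit [BorelSpace E] [μ.IsAddHaarMeasure] in
theorem bumpMeasure_absolutelyContinuous (b : ContDiffBump (0 : E)) : bumpMeasure μ b ≪ μ :=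
  withDensity_absolutelyContinuous _ _

omit [μ.IsAddHaarMeasure] in
theorem measurable_ofReal_normed_bump (b : ContDiffBump (0 : E)) :
    Measurable fun t => ENNReal.ofReal (b.normed μ t) :=
  b.continuous_normed.measurable.ennreal_ofReal

theorem ae_bumpMeasure_mem_ball (b : ContDiffBump (0 : E)) :
    ∀ᵐ t ∂(bumpMeasure μ b), t ∈ Metric.ball 0 b.rOut := by
  rw [bumpMeasure, ae_withDensity_iff (measurable_ofReal_normed_bump b)]
  refine Eventually.of_forall fun t ht => ?_
  rw [← b.support_normed_eq (μ := μ)]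
  exact fun h => ht (by rw [h, ENNReal.ofReal_zero])

omit [μ.IsAddHaarMeasure] in
theorem integral_bumpMeasure (b : ContDiffBump (0 : E)) (f : E → ℝ) :
    ∫ t, f t ∂(bumpMeasure μ b) = ∫ t, b.normed μ t * f t ∂μ := by
  rw [bumpMeasure, integral_withDensity_eq_integral_toReal_smul (measurable_ofReal_normed_bump b)
    (Eventually.of_forall fun _ => ENNReal.ofReal_lt_top)]
  simp only [ENNReal.toReal_ofReal (b.nonneg_normed _), smul_eq_mul]

theorem normed_bump_convolution_sub_eq (b : ContDiffBump (0 : E)) {g : E → ℝ}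
    (hg : LocallyIntegrable g μ) (x : E) :
    (b.normed μ ⋆[lsmul ℝ ℝ, μ] g) x - g x = ∫ t, (g (x - t) - g x) ∂(bumpMeasure μ b) := by
  have hint : Integrable (fun t => b.normed μ t * g (x - t)) μ :=
    b.hasCompactSupport_normed.convolutionExists_left (lsmul ℝ ℝ) b.continuous_normed hg x
  rw [integral_bumpMeasure]
  simp only [mul_sub]
  rw [integral_sub hint (b.integrable_normed.mul_const _), integral_mul_const, b.integral_normed,
    one_mul]
  rfl

theorem eLpNorm_normed_bump_convolution_sub_le (b : ContDiffBump (0 : E)) {p : ℝ≥0∞} (hp : 1 ≤ p)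
    (hp' : p ≠ ⊤) {g : E → ℝ} (hg : MemLp g p μ) {C : ℝ≥0∞}
    (hC : ∀ t ∈ Metric.ball 0 b.rOut, eLpNorm (fun x => g (x - t) - g x) p μ ≤ C) :
    eLpNorm (fun x => (b.normed μ ⋆[lsmul ℝ ℝ, μ] g) x - g x) p μ ≤ C := by
  set ν := bumpMeasure μ b
  have hp0 : p ≠ 0 := (one_pos.trans_le hp).ne'
  have hpr : 0 < p.toReal := ENNReal.toReal_pos hp0 hp'
  have hpr1 : 1 ≤ p.toReal := by simpa using ENNReal.toReal_mono hp' hp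
  have hac : ν ≪ μ := bumpMeasure_absolutelyContinuous b
  have hgx : ∀ x, AEStronglyMeasurable (fun t => g (x - t) - g x) ν := fun x =>
    ((hg.1.comp_quasiMeasurePreserving (quasiMeasurePreserving_sub_left μ x)).mono_ac hac).sub
      aestronglyMeasurable_const
  have hgprod : AEStronglyMeasurable (fun z : E × E => g (z.1 - z.2) - g z.1) (μ.prod ν) :=
    (hg.1.comp_quasiMeasurePreserving ((quasiMeasurePreserving_sub_of_right_invariant μ μ).mono_left
      (Measure.AbsolutelyContinuous.rfl.prod hac))).sub hg.1.comp_fst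
  rw [← ENNReal.rpow_le_rpow_iff hpr, eLpNorm_eq_lintegral_rpow_enorm_toReal hp0 hp', one_div,
    ENNReal.rpow_inv_rpow hpr.ne']
  calc ∫⁻ x, ‖(b.normed μ ⋆[lsmul ℝ ℝ, μ] g) x - g x‖ₑ ^ p.toReal ∂μ
      ≤ ∫⁻ x, ∫⁻ t, ‖g (x - t) - g x‖ₑ ^ p.toReal ∂ν ∂μ := by
        refine lintegral_mono fun x => ?_
        rw [normed_bump_convolution_sub_eq b (hg.locallyIntegrable hp) x]
        exact enorm_integral_rpow_le_lintegral hpr1 (hgx x)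
    _ = ∫⁻ t, ∫⁻ x, ‖g (x - t) - g x‖ₑ ^ p.toReal ∂μ ∂ν :=
        lintegral_lintegral_swap (hgprod.enorm.pow_const _)
    _ ≤ ∫⁻ _, C ^ p.toReal ∂ν := by
        refine lintegral_mono_ae ?_
        filter_upwards [ae_bumpMeasure_mem_ball b] with t ht
        have h := hC t ht
        rwa [eLpNorm_eq_lintegral_rpow_enorm_toReal hp0 hp', one_div,
          ENNReal.rpow_inv_le_iff hpr] at h
    _ = C ^ p.toReal := by rw [lintegral_const, measure_univ, mul_one]

variable (E) in
/-- The bump functions with radii `1 / (n + 1)` and `2 / (n + 1)`. -/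
noncomputable def shrinkingBump (n : ℕ) : ContDiffBump (0 : E) where
  rIn := 1 / (n + 1)
  rOut := 2 / (n + 1)
  rIn_pos := by positivity
  rIn_lt_rOut := by gcongr; norm_num

omit [NormedSpace ℝ E] [FiniteDimensional ℝ E] [MeasurableSpace E] [BorelSpace E] in
theorem tendsto_rOut_shrinkingBump : Tendsto (fun n => (shrinkingBump E n).rOut) atTop (𝓝 0) := by
  have h := (tendsto_one_div_add_atTop_nhds_zero_nat (𝕜 := ℝ)).const_mul 2
  simpa only [shrinkingBump, mul_one_div, mul_zero] using h

theorem tendsto_eLpNorm_shrinkingBump_convolution_sub {p : ℝ≥0∞} (hp : 1 ≤ p) (hp' : p ≠ ⊤)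
    {g : E → ℝ} (hg : MemLp g p μ) :
    Tendsto (fun n => eLpNorm (fun x =>
      ((shrinkingBump E n).normed μ ⋆[lsmul ℝ ℝ, μ] g) x - g x) p μ) atTop (𝓝 0) := by
  refine ENNReal.tendsto_nhds_zero.2 fun ε hε => ?_
  obtain ⟨δ, hδ, hball⟩ := Metric.eventually_nhds_iff_ball.1 <|
    ENNReal.tendsto_nhds_zero.1 (tendsto_eLpNorm_translate_sub hp hp' hg) ε hε
  filter_upwards [(tendsto_rOut_shrinkingBump (E := E)).eventually_lt_const hδ] with n hn
  exact eLpNorm_normed_bump_convolution_sub_le _ hp hp' hg fun t ht =>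
    hball t (Metric.ball_subset_ball hn.le ht)

theorem ae_tendsto_shrinkingBump_convolution {g : E → ℝ} (hg : LocallyIntegrable g μ) :
    ∀ᵐ x ∂μ, Tendsto (fun n => ((shrinkingBump E n).normed μ ⋆[lsmul ℝ ℝ, μ] g) x) atTop
      (𝓝 (g x)) := by
  refine ContDiffBump.ae_convolution_tendsto_right_of_locallyIntegrable (K := 2) (μ := μ)
    (tendsto_rOut_shrinkingBump (E := E)) (Eventually.of_forall fun n => ?_) hg
  simp only [shrinkingBump]
  exact (mul_one_div _ _).ge

theorem contDiff_normed_bump_convolution (b : ContDiffBump (0 : E)) {g : E → ℝ}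
    (hg : LocallyIntegrable g μ) :
    ContDiff ℝ (⊤ : ℕ∞) (b.normed μ ⋆[lsmul ℝ ℝ, μ] g) :=
  b.hasCompactSupport_normed.contDiff_convolution_left _ b.contDiff_normed hg

end Mollification

section LimitLemmas

variable {α : Type*} [MeasurableSpace α] {μ : Measure α}

theorem tendsto_eLpNorm_one_bdd_mul {a f : ℕ → α → ℝ} {f₀ : α → ℝ} {M : ℝ}
    (hM : ∀ n x, |a n x| ≤ M)
    (hL : Tendsto (fun n => eLpNorm (fun x => f n x - f₀ x) 1 μ) atTop (𝓝 0)) :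
    Tendsto (fun n => eLpNorm (fun x => a n x * (f n x - f₀ x)) 1 μ) atTop (𝓝 0) := by
  have hbound : Tendsto (fun n => ENNReal.ofReal M * eLpNorm (fun x => f n x - f₀ x) 1 μ) atTop
      (𝓝 0) := by
    simpa using ENNReal.Tendsto.const_mul (a := ENNReal.ofReal M) hL
      (Or.inr ENNReal.ofReal_ne_top)
  refine tendsto_of_tendsto_of_tendsto_of_le_of_le tendsto_const_nhds hbound (fun _ => zero_le)
    fun n => eLpNorm_le_mul_eLpNorm_of_ae_le_mul (Eventually.of_forall fun x => ?_) 1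
  rw [norm_mul]
  exact mul_le_mul_of_nonneg_right (hM n x) (norm_nonneg _)

theorem tendsto_eLpNorm_comp_sub {f : ℕ → α → ℝ} {f₀ : α → ℝ} {F : ℝ → ℝ} {K : ℝ≥0}
    (hF : LipschitzWith K F) {p : ℝ≥0∞}
    (hL : Tendsto (fun n => eLpNorm (fun x => f n x - f₀ x) p μ) atTop (𝓝 0)) :
    Tendsto (fun n => eLpNorm (fun x => F (f n x) - F (f₀ x)) p μ) atTop (𝓝 0) := by
  have hbound : Tendsto (fun n => (K : ℝ≥0∞) * eLpNorm (fun x => f n x - f₀ x) p μ) atTop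
      (𝓝 0) := by
    simpa using ENNReal.Tendsto.const_mul (a := K) hL (Or.inr ENNReal.coe_ne_top)
  exact tendsto_of_tendsto_of_tendsto_of_le_of_le tendsto_const_nhds hbound (fun _ => zero_le)
    fun n => eLpNorm_le_nnreal_smul_eLpNorm_of_ae_le_mul
      (Eventually.of_forall fun x => hF.norm_sub_le _ _) p

theorem tendsto_integral_bdd_mul_L1 {a : ℕ → α → ℝ} {a₀ : α → ℝ} {f : ℕ → α → ℝ} {f₀ : α → ℝ}
    {M : ℝ} (ha : ∀ n, AEStronglyMeasurable (a n) μ) (hM : ∀ n x, |a n x| ≤ M)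
    (hlim : ∀ᵐ x ∂μ, Tendsto (fun n => a n x) atTop (𝓝 (a₀ x)))
    (hf : ∀ n, Integrable (f n) μ) (hf₀ : Integrable f₀ μ)
    (hL : Tendsto (fun n => eLpNorm (fun x => f n x - f₀ x) 1 μ) atTop (𝓝 0)) :
    Tendsto (fun n => ∫ x, a n x * f n x ∂μ) atTop (𝓝 (∫ x, a₀ x * f₀ x ∂μ)) := by
  have hint : ∀ {g : α → ℝ}, Integrable g μ → ∀ n, Integrable (fun x => a n x * g x) μ :=
    fun hg n => hg.bdd_mul (ha n) (Eventually.of_forall (hM n))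
  have hlim₀ : Tendsto (fun n => ∫ x, a n x * f₀ x ∂μ) atTop (𝓝 (∫ x, a₀ x * f₀ x ∂μ)) := by
    refine tendsto_integral_of_dominated_convergence (fun x => M * ‖f₀ x‖)
      (fun n => (ha n).mul hf₀.1) (hf₀.norm.const_mul M)
      (fun n => Eventually.of_forall fun x => ?_) (hlim.mono fun x hx => hx.mul_const _)
    rw [norm_mul]
    exact mul_le_mul_of_nonneg_right (hM n x) (norm_nonneg _)
  have hdiff : Tendsto (fun n => ∫ x, a n x * (f n x - f₀ x) ∂μ) atTop (𝓝 0) := by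
    have h := tendsto_integral_of_L1' (fun _ => (0 : ℝ)) aestronglyMeasurable_const
      (Eventually.of_forall fun n => hint (g := fun x => f n x - f₀ x) ((hf n).sub hf₀) n)
      (by simpa only [Pi.sub_def, sub_zero] using tendsto_eLpNorm_one_bdd_mul hM hL)
    simpa only [integral_zero] using h
  have hsum := hlim₀.add hdiff
  rw [add_zero] at hsum
  refine hsum.congr fun n => ?_
  have hdiff_int : Integrable (fun x => a n x * (f n x - f₀ x)) μ := hint ((hf n).sub hf₀) n
  rw [← integral_add (hint hf₀ n) hdiff_int]
  exact integral_congr_ae (Eventually.of_forall fun x => by ring)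

theorem tendsto_eLpNorm_one_mul {f : ℕ → α → ℝ} {f₀ g : α → ℝ}
    (hf : ∀ n, AEStronglyMeasurable (fun x => f n x - f₀ x) μ) (hg : MemLp g 2 μ)
    (hL : Tendsto (fun n => eLpNorm (fun x => f n x - f₀ x) 2 μ) atTop (𝓝 0)) :
    Tendsto (fun n => eLpNorm (fun x => f n x * g x - f₀ x * g x) 1 μ) atTop (𝓝 0) := by
  have hbound : Tendsto (fun n => eLpNorm (fun x => f n x - f₀ x) 2 μ * eLpNorm g 2 μ) atTop
      (𝓝 0) := by
    simpa using ENNReal.Tendsto.mul_const (b := eLpNorm g 2 μ) hL (Or.inr hg.2.ne)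
  refine tendsto_of_tendsto_of_tendsto_of_le_of_le tendsto_const_nhds hbound (fun _ => zero_le)
    fun n => ?_
  simpa only [smul_eq_mul, Pi.mul_def, sub_mul] using
    eLpNorm_smul_le_mul_eLpNorm (p := 2) (q := 2) (r := 1) hg.1 (hf n)

theorem tendsto_integral_bdd_mul_sum {ι : Type*} [Fintype ι] {a : ℕ → α → ℝ} {a₀ : α → ℝ} {M : ℝ}
    (ha : ∀ n, AEStronglyMeasurable (a n) μ) (hM : ∀ n x, |a n x| ≤ M)
    (hlim : ∀ᵐ x ∂μ, Tendsto (fun n => a n x) atTop (𝓝 (a₀ x)))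
    {f : ℕ → ι → α → ℝ} {f₀ g : ι → α → ℝ} (hf : ∀ n i, MemLp (f n i) 2 μ)
    (hf₀ : ∀ i, MemLp (f₀ i) 2 μ) (hg : ∀ i, MemLp (g i) 2 μ)
    (hL : ∀ i, Tendsto (fun n => eLpNorm (fun x => f n i x - f₀ i x) 2 μ) atTop (𝓝 0)) :
    Tendsto (fun n => ∫ x, a n x * ∑ i, g i x * f n i x ∂μ) atTop
      (𝓝 (∫ x, a₀ x * ∑ i, g i x * f₀ i x ∂μ)) := by
  have ha₀ : AEStronglyMeasurable a₀ μ := aestronglyMeasurable_of_tendsto_ae atTop ha hlim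
  have hM₀ : ∀ᵐ x ∂μ, ‖a₀ x‖ ≤ M := hlim.mono fun x hx =>
    le_of_tendsto hx.norm (Eventually.of_forall fun n => hM n x)
  have hint : ∀ n i, Integrable (fun x => f n i x * g i x) μ := fun n i =>
    (hf n i).integrable_mul (hg i)
  have hint₀ : ∀ i, Integrable (fun x => f₀ i x * g i x) μ := fun i => (hf₀ i).integrable_mul (hg i)
  simp only [Finset.mul_sum, mul_comm (g _ _)]
  rw [integral_finsetSum _ fun i _ => (hint₀ i).bdd_mul ha₀ hM₀]
  refine (tendsto_finsetSum _ fun i _ => tendsto_integral_bdd_mul_L1 ha hM hlim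
    (fun n => hint n i) (hint₀ i) (tendsto_eLpNorm_one_mul
      (fun n => (hf n i).1.sub (hf₀ i).1) (hg i) (hL i))).congr fun n => ?_
  exact (integral_finsetSum _ fun i _ =>
    (hint n i).bdd_mul (ha n) (Eventually.of_forall (hM n))).symm

end LimitLemmas

section WeakApproximation

open scoped Convolution
open ContinuousLinearMap

variable {Ω : Opens Plane}

theorem partialD_convolution {ρ f : Plane → ℝ} (hρ : ContDiff ℝ (⊤ : ℕ∞) ρ)
    (hρc : HasCompactSupport ρ) (hf : LocallyIntegrable f) (i : Fin 2) (x : Plane) :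
    partialD i (ρ ⋆[lsmul ℝ ℝ] f) x = (partialD i ρ ⋆[lsmul ℝ ℝ] f) x := by
  have hder := hρc.hasFDerivAt_convolution_right (lsmul ℝ ℝ : ℝ →L[ℝ] ℝ →L[ℝ] ℝ).flip hf
    (hρ.of_le (by simp)) x
  rw [convolution_flip] at hder
  rw [partialD, hder.fderiv, convolution_precompR_apply _ hf (hρc.fderiv ℝ)
    (hρ.continuous_fderiv (by simp)), ← convolution_flip]
  rfl

theorem setIntegral_mul_eq_integral {s : Set Plane} {k : Plane → ℝ} (hk : Function.support k ⊆ s)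
    (f : Plane → ℝ) : ∫ x in s, f x * k x = ∫ x, f x * k x :=
  setIntegral_eq_integral_of_forall_compl_eq_zero fun x hx => by
    rw [Function.notMem_support.1 fun h => hx (hk h), mul_zero]

theorem integral_indicator_mul_eq {s : Set Plane} {k : Plane → ℝ} (hk : Function.support k ⊆ s)
    (f : Plane → ℝ) : ∫ x, s.indicator f x * k x = ∫ x, f x * k x := by
  congr 1 with x
  by_cases hx : x ∈ s
  · rw [Set.indicator_of_mem hx]
  · rw [Function.notMem_support.1 fun h => hx (hk h), mul_zero, mul_zero]

theorem support_normed_sub_subset (b : ContDiffBump (0 : Plane)) (x : Plane) :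
    Function.support (fun y => b.normed volume (x - y)) ⊆ Metric.closedBall x b.rOut := by
  intro y hy
  have hxy : x - y ∈ Function.support (b.normed volume) := hy
  rw [b.support_normed_eq, mem_ball_zero_iff] at hxy
  rw [mem_closedBall_iff_norm, norm_sub_rev]
  exact hxy.le

theorem tsupport_normed_sub_subset (b : ContDiffBump (0 : Plane)) (x : Plane) :
    tsupport (fun y => b.normed volume (x - y)) ⊆ Metric.closedBall x b.rOut :=
  closure_minimal (support_normed_sub_subset b x) Metric.isClosed_closedBall

/-- The reflected and translated bump `y ↦ ρ (x - y)` as a test function: pairing with it is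
mollification at the point `x`. -/
noncomputable def testBump (b : ContDiffBump (0 : Plane)) (x : Plane)
    (h : Metric.closedBall x b.rOut ⊆ Ω) : 𝓓(Ω, ℝ) :=
  ⟨fun y => b.normed volume (x - y), b.contDiff_normed.comp (contDiff_const.sub contDiff_id),
    HasCompactSupport.of_support_subset_isCompact (isCompact_closedBall _ _)
      (support_normed_sub_subset b x), (tsupport_normed_sub_subset b x).trans h⟩

theorem partialD_testBump (b : ContDiffBump (0 : Plane)) (x : Plane)
    (h : Metric.closedBall x b.rOut ⊆ Ω) (i : Fin 2) (y : Plane) :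
    partialD i (testBump b x h) y = -partialD i (b.normed volume) (x - y) := by
  have hder : HasFDerivAt (testBump b x h) ((fderiv ℝ (b.normed volume) (x - y)).comp
      (-ContinuousLinearMap.id ℝ Plane)) y :=
    ((b.contDiff_normed (n := 1)).differentiable (by simp) (x - y)).hasFDerivAt.comp y
      ((hasFDerivAt_id y).const_sub x)
  simp [partialD, hder.fderiv]

theorem convolution_lsmul_eq_swap (ρ f : Plane → ℝ) (x : Plane) :
    (ρ ⋆[lsmul ℝ ℝ] f) x = ∫ y, f y * ρ (x - y) := by
  simp only [convolution_eq_swap, lsmul_apply, smul_eq_mul, mul_comm]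

theorem HasWeakPartial.partialD_convolution {u g : Plane → ℝ} {i : Fin 2}
    (h : HasWeakPartial Ω i u g) {K : Set Plane} (hK : IsCompact K) (hKΩ : K ⊆ Ω)
    (b : ContDiffBump (0 : Plane)) {x : Plane} (hx : Metric.closedBall x b.rOut ⊆ K) :
    partialD i (b.normed volume ⋆[lsmul ℝ ℝ] K.indicator u) x =
      (b.normed volume ⋆[lsmul ℝ ℝ] K.indicator g) x := by
  have hloc : LocallyIntegrable (K.indicator u) :=
    ((h.1.integrableOn_compact_subset hKΩ hK).integrable_indicator
      hK.measurableSet).locallyIntegrable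
  let φ : 𝓓(Ω, ℝ) := testBump b x (hx.trans hKΩ)
  have hφ : Function.support φ ⊆ K := (support_normed_sub_subset b x).trans hx
  have hDφ : Function.support (partialD i φ) ⊆ K :=
    (support_partialD_subset _ _).trans ((tsupport_normed_sub_subset b x).trans hx)
  calc partialD i (b.normed volume ⋆[lsmul ℝ ℝ] K.indicator u) x
      = ∫ y, K.indicator u y * partialD i (b.normed volume) (x - y) := by
        rw [_root_.partialD_convolution b.contDiff_normed b.hasCompactSupport_normed hloc,
          convolution_lsmul_eq_swap]
    _ = -∫ y, K.indicator u y * partialD i φ y := by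
        simp only [φ, partialD_testBump, mul_neg, integral_neg, neg_neg]
    _ = ∫ y, K.indicator g y * φ y := by
        rw [integral_indicator_mul_eq hDφ, ← setIntegral_mul_eq_integral (hDφ.trans hKΩ), h.2.2 φ,
          neg_neg, integral_indicator_mul_eq hφ, setIntegral_mul_eq_integral (hφ.trans hKΩ)]
    _ = (b.normed volume ⋆[lsmul ℝ ℝ] K.indicator g) x := by
        rw [convolution_lsmul_eq_swap]
        rfl

theorem tendsto_eLpNorm_convolution_indicator_sub {p : ℝ≥0∞} (hp : 1 ≤ p) (hp' : p ≠ ⊤)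
    {f : Plane → ℝ} {K K' : Set Plane} (hK : MeasurableSet K) (hK' : MeasurableSet K')
    (hKK' : K ⊆ K') (hf : MemLp f p (volume.restrict K')) :
    Tendsto (fun n => eLpNorm (fun x =>
      ((shrinkingBump Plane n).normed volume ⋆[lsmul ℝ ℝ] K'.indicator f) x - f x) p
        (volume.restrict K)) atTop (𝓝 0) := by
  refine tendsto_of_tendsto_of_tendsto_of_le_of_le tendsto_const_nhds
    (tendsto_eLpNorm_shrinkingBump_convolution_sub hp hp' ((memLp_indicator_iff_restrict hK').2 hf))
    (fun _ => zero_le) fun n => ?_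
  refine le_trans (eLpNorm_congr_ae ?_).le (eLpNorm_restrict_le _ _ _ K)
  filter_upwards [ae_restrict_mem hK] with x hx
  rw [Set.indicator_of_mem (hKK' hx)]

/-- A single sequence approximates `u` and all of its weak derivatives on the compact set `K`. -/
theorem exists_smooth_approx {u : Plane → ℝ} (hu : LocallyIntegrableOn u Ω) {K : Set Plane}
    (hK : IsCompact K) (hKΩ : K ⊆ Ω) : ∃ v : ℕ → Plane → ℝ,
    (∀ n, ContDiff ℝ (⊤ : ℕ∞) (v n)) ∧
    (∀ᵐ x ∂(volume.restrict K), Tendsto (fun n => v n x) atTop (𝓝 (u x))) ∧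
    Tendsto (fun n => eLpNorm (fun x => v n x - u x) 1 (volume.restrict K)) atTop (𝓝 0) ∧
    ∀ i g, HasWeakPartial Ω i u g → ∀ p : ℝ≥0∞, 1 ≤ p → p ≠ ⊤ →
      (∀ L : Set Plane, IsCompact L → L ⊆ Ω → MemLp g p (volume.restrict L)) →
      Tendsto (fun n => eLpNorm (fun x => partialD i (v n) x - g x) p (volume.restrict K)) atTop
        (𝓝 0) := by
  obtain ⟨δ, hδ, hδΩ⟩ := hK.exists_cthickening_subset_open Ω.isOpen hKΩ
  set K' := Metric.cthickening δ K
  have hK' : IsCompact K' := hK.cthickening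
  have hKK' : K ⊆ K' := Metric.self_subset_cthickening K
  have huK' : IntegrableOn u K' := hu.integrableOn_compact_subset hδΩ hK'
  have huloc : LocallyIntegrable (K'.indicator u) :=
    (huK'.integrable_indicator hK'.measurableSet).locallyIntegrable
  refine ⟨fun n => (shrinkingBump Plane n).normed volume ⋆[lsmul ℝ ℝ] K'.indicator u,
    fun n => contDiff_normed_bump_convolution _ huloc, ?_,
    tendsto_eLpNorm_convolution_indicator_sub le_rfl ENNReal.one_ne_top hK.measurableSet
      hK'.measurableSet hKK' (memLp_one_iff_integrable.2 huK'), fun i g hg p hp hp' hgL => ?_⟩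
  · filter_upwards [ae_restrict_of_ae (ae_tendsto_shrinkingBump_convolution huloc),
      ae_restrict_mem hK.measurableSet] with x hx hxK
    rwa [Set.indicator_of_mem (hKK' hxK)] at hx
  · refine (tendsto_eLpNorm_convolution_indicator_sub hp hp' hK.measurableSet hK'.measurableSet
      hKK' (hgL K' hK' hδΩ)).congr' ?_
    filter_upwards [(tendsto_rOut_shrinkingBump (E := Plane)).eventually_lt_const hδ] with n hn
    refine eLpNorm_congr_ae ?_
    filter_upwards [ae_restrict_mem hK.measurableSet] with x hx
    rw [hg.partialD_convolution hK' hδΩ]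
    exact fun y hy =>
      Metric.mem_cthickening_of_dist_le y x δ K hx ((Metric.mem_closedBall.1 hy).trans hn.le)

end WeakApproximation

section ChainRule

variable {Ω : Opens Plane}

theorem locallyIntegrableOn_of_abs_le {U f : Plane → ℝ} (hU : LocallyIntegrableOn U Ω)
    (hf : AEStronglyMeasurable f (volume.restrict (Ω : Set Plane))) (h : ∀ x, |f x| ≤ U x) :
    LocallyIntegrableOn f Ω := by
  rw [locallyIntegrableOn_iff Ω.isOpen.isLocallyClosed]
  exact fun K hK hKc => (hU.integrableOn_compact_subset hK hKc).mono'
    (hf.mono_measure (Measure.restrict_mono hK le_rfl)) (Eventually.of_forall h)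

theorem HasWeakPartial.neg {u g : Plane → ℝ} {i : Fin 2} (h : HasWeakPartial Ω i u g) :
    HasWeakPartial Ω i (fun x => -u x) (fun x => -g x) := by
  refine ⟨h.1.neg, h.2.1.neg, fun φ => ?_⟩
  simp only [neg_mul, integral_neg, h.2.2 φ]

theorem HasWeakPartial.sub {u v g k : Plane → ℝ} {i : Fin 2} (h : HasWeakPartial Ω i u g)
    (h' : HasWeakPartial Ω i v k) :
    HasWeakPartial Ω i (fun x => u x - v x) (fun x => g x - k x) := by
  refine ⟨h.1.sub h'.1, h.2.1.sub h'.2.1, fun φ => ?_⟩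
  have hpartial := integral_sub_mul_testFunction h.1 h'.1 (testPartialD i φ)
  rw [coe_testPartialD, h.2.2 φ, h'.2.2 φ] at hpartial
  rw [hpartial, integral_sub_mul_testFunction h.2.1 h'.2.1]
  ring

theorem HasWeakPartial.of_dominated_convergence {i : Fin 2} {u g : ℕ → Plane → ℝ}
    {u₀ g₀ U V : Plane → ℝ} (h : ∀ n, HasWeakPartial Ω i (u n) (g n))
    (hU : LocallyIntegrableOn U Ω) (hV : LocallyIntegrableOn V Ω) (hu : ∀ n x, |u n x| ≤ U x)
    (hg : ∀ n x, |g n x| ≤ V x) (hu₀ : ∀ x, Tendsto (fun n => u n x) atTop (𝓝 (u₀ x)))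
    (hg₀ : ∀ x, Tendsto (fun n => g n x) atTop (𝓝 (g₀ x))) : HasWeakPartial Ω i u₀ g₀ := by
  have hum := fun n => (h n).1.aestronglyMeasurable
  have hgm := fun n => (h n).2.1.aestronglyMeasurable
  have hlim : ∀ {f : ℕ → Plane → ℝ} {f₀ F : Plane → ℝ} (φ : 𝓓(Ω, ℝ)),
      (∀ n, AEStronglyMeasurable (f n) (volume.restrict (Ω : Set Plane))) →
      LocallyIntegrableOn F Ω → (∀ n x, |f n x| ≤ F x) →
      (∀ x, Tendsto (fun n => f n x) atTop (𝓝 (f₀ x))) →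
      Tendsto (fun n => ∫ x in Ω, f n x * φ x) atTop (𝓝 (∫ x in Ω, f₀ x * φ x)) := by
    intro f f₀ F φ hfm hF hf hf₀
    refine tendsto_integral_of_dominated_convergence (fun x => ‖F x * φ x‖)
      (fun n => (hfm n).mul φ.continuous.aestronglyMeasurable)
      (integrable_mul_testFunction hF φ).norm (fun n => Eventually.of_forall fun x => ?_)
      (Eventually.of_forall fun x => (hf₀ x).mul_const _)
    rw [norm_mul, norm_mul]
    exact mul_le_mul_of_nonneg_right ((hf n x).trans (le_abs_self _)) (norm_nonneg _)
  refine ⟨locallyIntegrableOn_of_abs_le hU (aestronglyMeasurable_of_tendsto_ae atTop hum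
      (Eventually.of_forall hu₀)) fun x => le_of_tendsto (hu₀ x).abs
        (Eventually.of_forall fun n => hu n x),
    locallyIntegrableOn_of_abs_le hV (aestronglyMeasurable_of_tendsto_ae atTop hgm
      (Eventually.of_forall hg₀)) fun x => le_of_tendsto (hg₀ x).abs
        (Eventually.of_forall fun n => hg n x), fun φ => ?_⟩
  exact tendsto_nhds_unique
    ((hlim (testPartialD i φ) hum hU hu hu₀).congr fun n => (h n).2.2 φ)
    (hlim φ hgm hV hg hg₀).neg

theorem integral_mul_partialD (φ : 𝓓(Ω, ℝ)) {f : Plane → ℝ} (hf : ContDiff ℝ 1 f) (i : Fin 2) :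
    ∫ x, f x * partialD i φ x = -∫ x, partialD i f x * φ x := by
  have hpc : Continuous (partialD i f) :=
    (hf.continuous_fderiv (by simp)).clm_apply continuous_const
  have hint : ∀ {h : Plane → ℝ}, Continuous h → ∀ φ : 𝓓(Ω, ℝ), Integrable fun x => h x * φ x :=
    fun hh φ => (hh.mul φ.continuous).integrable_of_hasCompactSupport φ.hasCompactSupport.mul_left
  exact integral_mul_fderiv_eq_neg_fderiv_mul_of_integrable (hint hpc φ)
    (hint hf.continuous (testPartialD i φ)) (hint hf.continuous φ)
    (fun x _ => hf.differentiable (by simp) x) fun x _ => differentiable_testFunction φ x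

theorem abs_sub_le_mul_abs_sub_of_abs_deriv_le {F : ℝ → ℝ} {M : ℝ} (hF : Differentiable ℝ F)
    (hM : ∀ s, |deriv F s| ≤ M) (a b : ℝ) : |F a - F b| ≤ M * |a - b| :=
  convex_univ.norm_image_sub_le_of_norm_deriv_le (fun x _ => hF x) (fun x _ => hM x) trivial
    trivial

theorem abs_le_mul_abs_of_abs_deriv_le {F : ℝ → ℝ} {M : ℝ} (hF : Differentiable ℝ F)
    (hM : ∀ s, |deriv F s| ≤ M) (hF0 : F 0 = 0) (s : ℝ) : |F s| ≤ M * |s| := by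
  simpa only [hF0, sub_zero] using abs_sub_le_mul_abs_sub_of_abs_deriv_le hF hM s 0

theorem integral_partialD_mul_comp (φ : 𝓓(Ω, ℝ)) {v : Plane → ℝ} {F : ℝ → ℝ}
    (hv : ContDiff ℝ 1 v) (hF : ContDiff ℝ 1 F) (i : Fin 2) :
    ∫ x in tsupport φ, partialD i φ x * F (v x) =
      -∫ x in tsupport φ, (φ x * deriv F (v x)) * partialD i v x := by
  calc ∫ x in tsupport φ, partialD i φ x * F (v x)
      = ∫ x, F (v x) * partialD i φ x := by
        simp only [mul_comm (partialD i φ _)]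
        exact setIntegral_mul_eq_integral (support_partialD_subset _ _) _
    _ = -∫ x, (deriv F (v x) * partialD i v x) * φ x := by
        refine (integral_mul_partialD φ (hF.comp hv) i).trans ?_
        simp only [Function.comp_def, partialD_comp (hF.differentiable (by simp) _)
          (hv.differentiable (by simp) _)]
    _ = -∫ x in tsupport φ, (φ x * deriv F (v x)) * partialD i v x := by
        rw [← setIntegral_mul_eq_integral (subset_tsupport _)]
        simp only [mul_right_comm _ (φ _), mul_comm (φ _)]

theorem HasWeakPartial.integral_comp_mul_partialD {u g : Plane → ℝ} {i : Fin 2}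
    (h : HasWeakPartial Ω i u g) {F : ℝ → ℝ} {M : ℝ} (hF : ContDiff ℝ 1 F)
    (hM : ∀ s, |deriv F s| ≤ M) (hFu : LocallyIntegrableOn (fun x => F (u x)) Ω) (φ : 𝓓(Ω, ℝ)) :
    ∫ x in tsupport φ, partialD i φ x * F (u x) =
      -∫ x in tsupport φ, (φ x * deriv F (u x)) * g x := by
  have hK : IsCompact (tsupport φ) := φ.hasCompactSupport
  have hF' : Continuous (deriv F) := hF.continuous_deriv (by simp)
  have hg := fun L hL hLΩ => h.2.1.integrableOn_compact_subset (t := L) hLΩ hL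
  obtain ⟨v, hv, hva, hvu, hvg⟩ := exists_smooth_approx h.1 hK φ.tsupport_subset
  obtain ⟨A, hA⟩ := φ.continuous.bounded_above_of_compact_support φ.hasCompactSupport
  obtain ⟨B, hB⟩ := (testPartialD i φ).continuous.bounded_above_of_compact_support
    (testPartialD i φ).hasCompactSupport
  have hlip : LipschitzWith M.toNNReal F := LipschitzWith.of_dist_le' fun a b =>
    abs_sub_le_mul_abs_sub_of_abs_deriv_le (hF.differentiable (by simp)) hM a b
  have hcomp : Tendsto (fun n => ∫ x in tsupport φ, partialD i φ x * F (v n x)) atTop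
      (𝓝 (∫ x in tsupport φ, partialD i φ x * F (u x))) :=
    tendsto_integral_bdd_mul_L1
      (fun _ => (testPartialD i φ).continuous.aestronglyMeasurable) (fun _ x => hB x)
      (Eventually.of_forall fun x => tendsto_const_nhds)
      (fun n => (hF.continuous.comp (hv n).continuous).continuousOn.integrableOn_compact hK)
      (hFu.integrableOn_compact_subset φ.tsupport_subset hK) (tendsto_eLpNorm_comp_sub hlip hvu)
  have hcomp' : Tendsto (fun n => ∫ x in tsupport φ, (φ x * deriv F (v n x)) * partialD i (v n) x)
      atTop (𝓝 (∫ x in tsupport φ, (φ x * deriv F (u x)) * g x)) := by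
    refine tendsto_integral_bdd_mul_L1 (M := A * M)
      (fun n => (φ.continuous.mul (hF'.comp (hv n).continuous)).aestronglyMeasurable)
      (fun n x => ?_) (hva.mono fun x hx => ((hF'.tendsto _).comp hx).const_mul _)
      (fun n => (contDiff_partialD (hv n) i).continuous.continuousOn.integrableOn_compact hK)
      (hg _ hK φ.tsupport_subset) (hvg i g h 1 le_rfl ENNReal.one_ne_top fun L hL hLΩ =>
        memLp_one_iff_integrable.2 (hg L hL hLΩ))
    rw [abs_mul]
    exact mul_le_mul (hA x) (hM _) (abs_nonneg _) ((norm_nonneg _).trans (hA x))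
  exact tendsto_nhds_unique (hcomp.congr fun n => integral_partialD_mul_comp φ
    ((hv n).of_le (by simp)) hF i) hcomp'.neg

theorem HasWeakPartial.comp {u g : Plane → ℝ} {i : Fin 2} (h : HasWeakPartial Ω i u g)
    {F : ℝ → ℝ} {M : ℝ} (hF : ContDiff ℝ 1 F) (hM : ∀ s, |deriv F s| ≤ M) (hF0 : F 0 = 0) :
    HasWeakPartial Ω i (fun x => F (u x)) (fun x => deriv F (u x) * g x) := by
  have hum := h.1.aestronglyMeasurable
  have hFu : LocallyIntegrableOn (fun x => F (u x)) Ω :=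
    locallyIntegrableOn_of_abs_le (h.1.norm.smul M) (hF.continuous.comp_aestronglyMeasurable hum)
      fun x => abs_le_mul_abs_of_abs_deriv_le (hF.differentiable (by simp)) hM hF0 _
  refine ⟨hFu, locallyIntegrableOn_of_abs_le (h.2.1.norm.smul M)
    (((hF.continuous_deriv (by simp)).comp_aestronglyMeasurable hum).mul
      h.2.1.aestronglyMeasurable) fun x => ?_, fun φ => ?_⟩
  · rw [abs_mul]
    exact mul_le_mul_of_nonneg_right (hM _) (abs_nonneg _)
  · have hs := support_partialD_subset φ i
    rw [setIntegral_mul_eq_integral (hs.trans φ.tsupport_subset),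
      ← setIntegral_mul_eq_integral hs,
      setIntegral_mul_eq_integral ((subset_tsupport φ).trans φ.tsupport_subset),
      ← setIntegral_mul_eq_integral (subset_tsupport φ)]
    simpa only [mul_comm, mul_assoc] using h.integral_comp_mul_partialD hF hM hFu φ

/-- The limit of uniformly Lipschitz `C¹` functions is allowed to have a discontinuous derivative,
as the positive part does. -/
theorem HasWeakPartial.comp_of_tendsto {u g : Plane → ℝ} {i : Fin 2} (h : HasWeakPartial Ω i u g)
    {F : ℕ → ℝ → ℝ} {F₀ F₀' : ℝ → ℝ} {M : ℝ} (hF : ∀ n, ContDiff ℝ 1 (F n))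
    (hM : ∀ n s, |deriv (F n) s| ≤ M) (hF0 : ∀ n, F n 0 = 0)
    (hlim : ∀ s, Tendsto (fun n => F n s) atTop (𝓝 (F₀ s)))
    (hlim' : ∀ s, Tendsto (fun n => deriv (F n) s) atTop (𝓝 (F₀' s))) :
    HasWeakPartial Ω i (fun x => F₀ (u x)) (fun x => F₀' (u x) * g x) := by
  refine .of_dominated_convergence (fun n => h.comp (hF n) (hM n) (hF0 n)) (h.1.norm.smul M)
    (h.2.1.norm.smul M) (fun n x => abs_le_mul_abs_of_abs_deriv_le
      ((hF n).differentiable (by simp)) (hM n) (hF0 n) _) (fun n x => ?_) (fun x => hlim _)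
    fun x => (hlim' _).mul_const _
  rw [abs_mul]
  exact mul_le_mul_of_nonneg_right (hM n _) (abs_nonneg _)

end ChainRule

section SmoothPositivePart

/-- The smooth approximation of the positive part with derivative `smoothTransition (c * s)`. It
vanishes on the nonpositive reals and tends to the positive part as `c → ∞`. -/
noncomputable def smoothPos (c s : ℝ) : ℝ := ∫ t in (0 : ℝ)..s, Real.smoothTransition (c * t)

theorem hasDerivAt_smoothPos (c s : ℝ) :
    HasDerivAt (smoothPos c) (Real.smoothTransition (c * s)) s := by
  have hc : Continuous fun t => Real.smoothTransition (c * t) :=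
    Real.smoothTransition.continuous.comp (continuous_const.mul continuous_id)
  exact intervalIntegral.integral_hasDerivAt_right (hc.intervalIntegrable _ _)
    (hc.stronglyMeasurableAtFilter _ _) hc.continuousAt

theorem deriv_smoothPos (c : ℝ) :
    deriv (smoothPos c) = fun s => Real.smoothTransition (c * s) :=
  funext fun s => (hasDerivAt_smoothPos c s).deriv

theorem contDiff_smoothPos (c : ℝ) : ContDiff ℝ (⊤ : ℕ∞) (smoothPos c) := by
  rw [contDiff_infty_iff_deriv, deriv_smoothPos]
  exact ⟨fun s => (hasDerivAt_smoothPos c s).differentiableAt,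
    Real.smoothTransition.contDiff.comp (contDiff_const.mul contDiff_id)⟩

@[simp] theorem smoothPos_zero (c : ℝ) : smoothPos c 0 = 0 := by simp [smoothPos]

theorem smoothPos_of_nonpos {c s : ℝ} (hc : 0 ≤ c) (hs : s ≤ 0) : smoothPos c s = 0 := by
  rw [smoothPos]
  rw [intervalIntegral.integral_congr (g := fun _ => (0 : ℝ)), intervalIntegral.integral_zero]
  intro t ht
  rw [Set.uIcc_of_ge hs] at ht
  exact Real.smoothTransition.zero_of_nonpos (mul_nonpos_of_nonneg_of_nonpos hc ht.2)

theorem smoothPos_nonneg {c : ℝ} (hc : 0 ≤ c) (s : ℝ) : 0 ≤ smoothPos c s := by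
  rcases le_total s 0 with hs | hs
  · rw [smoothPos_of_nonpos hc hs]
  · exact intervalIntegral.integral_nonneg hs fun t _ => Real.smoothTransition.nonneg _

theorem abs_deriv_smoothPos_le (c s : ℝ) : |deriv (smoothPos c) s| ≤ 1 := by
  rw [deriv_smoothPos, abs_of_nonneg (Real.smoothTransition.nonneg _)]
  exact Real.smoothTransition.le_one _

theorem abs_smoothPos_le (c s : ℝ) : |smoothPos c s| ≤ |s| := by
  simpa only [one_mul] using abs_le_mul_abs_of_abs_deriv_le
    ((contDiff_smoothPos c).differentiable (by simp)) (abs_deriv_smoothPos_le c)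
    (smoothPos_zero c) s

theorem tendsto_smoothTransition_mul (s : ℝ) :
    Tendsto (fun n : ℕ => Real.smoothTransition ((n : ℝ) * s)) atTop
      (𝓝 (if 0 < s then 1 else 0)) := by
  by_cases hs : 0 < s
  · rw [if_pos hs]
    have hns : Tendsto (fun n : ℕ => (n : ℝ) * s) atTop atTop :=
      tendsto_natCast_atTop_atTop.atTop_mul_const hs
    refine tendsto_const_nhds.congr' ?_
    filter_upwards [hns.eventually_ge_atTop 1] with n hn
    exact (Real.smoothTransition.one_of_one_le hn).symm
  · rw [if_neg hs]
    exact tendsto_const_nhds.congr fun n => (Real.smoothTransition.zero_of_nonpos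
      (mul_nonpos_of_nonneg_of_nonpos (by positivity) (not_lt.1 hs))).symm

theorem tendsto_smoothPos (s : ℝ) :
    Tendsto (fun n : ℕ => smoothPos n s) atTop (𝓝 (max s 0)) := by
  rcases le_total s 0 with hs | hs
  · rw [max_eq_right hs]
    exact tendsto_const_nhds.congr fun n => (smoothPos_of_nonpos (by positivity) hs).symm
  · rw [max_eq_left hs]
    suffices Tendsto (fun n : ℕ => smoothPos n s) atTop (𝓝 (∫ _ in (0 : ℝ)..s, (1 : ℝ))) by
      simpa only [intervalIntegral.integral_const, sub_zero, smul_eq_mul, mul_one] using this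
    refine intervalIntegral.tendsto_integral_filter_of_dominated_convergence (fun _ => (1 : ℝ))
      (Eventually.of_forall fun n => ?_) (Eventually.of_forall fun n => ?_)
      intervalIntegrable_const ?_
    · exact (Real.smoothTransition.continuous.comp
        (continuous_const.mul continuous_id)).aestronglyMeasurable
    · refine Eventually.of_forall fun t _ => ?_
      rw [Real.norm_of_nonneg (Real.smoothTransition.nonneg _)]
      exact Real.smoothTransition.le_one _
    · refine Eventually.of_forall fun t ht => ?_
      rw [Set.uIoc_of_le hs] at ht
      simpa [ht.1] using tendsto_smoothTransition_mul t

theorem HasWeakPartial.posPart {Ω : Opens Plane} {u g : Plane → ℝ} {i : Fin 2}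
    (h : HasWeakPartial Ω i u g) :
    HasWeakPartial Ω i (fun x => max (u x) 0) (fun x => (if 0 < u x then 1 else 0) * g x) := by
  refine h.comp_of_tendsto (M := 1) (F := fun n => smoothPos n) (F₀ := fun s => max s 0)
    (F₀' := fun s => if 0 < s then 1 else 0) (fun n => (contDiff_smoothPos n).of_le (by simp))
    (fun n => abs_deriv_smoothPos_le n) (fun n => smoothPos_zero _) tendsto_smoothPos fun s => ?_
  simpa only [deriv_smoothPos] using tendsto_smoothTransition_mul s

/-- Apply the derivatives of `u⁺` and `(-u)⁺`, both of which vanish on `{u = 0}`, to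
`u = u⁺ - (-u)⁺`. -/
theorem HasWeakPartial.ae_eq_zero_of_eq_zero {Ω : Opens Plane} {u g : Plane → ℝ} {i : Fin 2}
    (h : HasWeakPartial Ω i u g) :
    ∀ᵐ x ∂(volume.restrict (Ω : Set Plane)), u x = 0 → g x = 0 := by
  have hdecomp := h.posPart.sub h.neg.posPart
  simp only [max_zero_sub_max_neg_zero_eq_self] at hdecomp
  filter_upwards [h.ae_unique hdecomp] with x hx hux
  simpa [hux] using hx

end SmoothPositivePart

section H10

variable {Ω : Opens Plane}

/-- The test functions `φ n` approximate `u` in `W^{1,2}(Ω)` and almost everywhere, and `G` is the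
weak gradient of `u`. -/
structure H10Approx (Ω : Opens Plane) (u : Plane → ℝ) (G : Plane → Plane) (φ : ℕ → 𝓓(Ω, ℝ)) :
    Prop where
  memLp : MemLp u 2 (volume.restrict (Ω : Set Plane))
  grad : HasWeakGradient Ω u G
  memLp_grad : ∀ i, MemLp (fun x => G x i) 2 (volume.restrict (Ω : Set Plane))
  tendsto : Tendsto (fun n => eLpNorm (fun x => φ n x - u x) 2 (volume.restrict Ω)) atTop (𝓝 0)
  tendsto_grad : ∀ i, Tendsto (fun n => eLpNorm (fun x => partialD i (φ n) x - G x i) 2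
    (volume.restrict Ω)) atTop (𝓝 0)
  ae_tendsto : ∀ᵐ x ∂(volume.restrict (Ω : Set Plane)), Tendsto (fun n => φ n x) atTop (𝓝 (u x))

theorem MemH10.exists_approx {u : Plane → ℝ} (h : MemH10 Ω u) :
    ∃ (G : Plane → Plane) (φ : ℕ → 𝓓(Ω, ℝ)), H10Approx Ω u G φ := by
  obtain ⟨hu, G, hG, hG2, φ, hφ, hφG⟩ := h
  have hmeas : TendstoInMeasure (volume.restrict (Ω : Set Plane)) (fun n => ⇑(φ n)) atTop u :=
    tendstoInMeasure_of_tendsto_eLpNorm (p := 2) two_ne_zero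
      (fun n => (φ n).continuous.aestronglyMeasurable) hu.1 hφ
  obtain ⟨ns, hns, hae⟩ := hmeas.exists_seq_tendsto_ae
  exact ⟨G, fun n => φ (ns n), hu, hG, hG2, hφ.comp hns.tendsto_atTop,
    fun i => (hφG i).comp hns.tendsto_atTop, hae⟩

theorem partialD_neg (i : Fin 2) (f : Plane → ℝ) (x : Plane) :
    partialD i (fun y => -f y) x = -partialD i f x := by
  simp [partialD, fderiv_fun_neg]

theorem HasWeakGradient.neg {u : Plane → ℝ} {G : Plane → Plane} (h : HasWeakGradient Ω u G) :
    HasWeakGradient Ω (fun x => -u x) (fun x => -G x) := fun i => (h i).neg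

theorem HasWeakLaplacian.neg {u w : Plane → ℝ} (h : HasWeakLaplacian Ω u w) :
    HasWeakLaplacian Ω (fun x => -u x) (fun x => -w x) := by
  refine ⟨h.1.neg, h.2.1.neg, fun φ => ?_⟩
  simp only [neg_mul, integral_neg, h.2.2 φ]

theorem H10Approx.neg {u : Plane → ℝ} {G : Plane → Plane} {φ : ℕ → 𝓓(Ω, ℝ)}
    (h : H10Approx Ω u G φ) : H10Approx Ω (fun x => -u x) (fun x => -G x) (fun n => -φ n) := by
  have hcoe : ∀ n, ⇑(-φ n) = fun x => -φ n x := fun n => rfl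
  refine ⟨h.memLp.neg, h.grad.neg, fun i => (h.memLp_grad i).neg, ?_, fun i => ?_,
    h.ae_tendsto.mono fun x hx => hx.neg⟩
  · simp only [hcoe, neg_sub_neg]
    exact h.tendsto.congr fun n => eLpNorm_sub_comm (φ n) u 2 _
  · refine (h.tendsto_grad i).congr fun n => ?_
    rw [← eLpNorm_neg]
    refine eLpNorm_congr_ae (Eventually.of_forall fun x => ?_)
    simp only [hcoe, partialD_neg, Pi.neg_apply, PiLp.neg_apply, neg_sub, sub_neg_eq_add]
    ring

end H10

section Testing

variable {Ω : Opens Plane} {u w : Plane → ℝ} {G Gw : Plane → Plane}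

theorem abs_smoothTransition_le_one (s : ℝ) : |Real.smoothTransition s| ≤ 1 := by
  rw [abs_of_nonneg (Real.smoothTransition.nonneg s)]
  exact Real.smoothTransition.le_one s

theorem hasCompactSupport_deriv_smoothTransition :
    HasCompactSupport (deriv Real.smoothTransition) := by
  refine HasCompactSupport.of_support_subset_isCompact (isCompact_Icc (a := 0) (b := 1))
    fun s hs => ?_
  by_contra hs'
  refine hs ?_
  rcases not_and_or.1 hs' with hs' | hs'
  · have hzero : Real.smoothTransition =ᶠ[𝓝 s] fun _ => 0 := by
      filter_upwards [gt_mem_nhds (not_le.1 hs')] with t ht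
      exact Real.smoothTransition.zero_of_nonpos ht.le
    rw [hzero.deriv_eq, deriv_const]
  · have hone : Real.smoothTransition =ᶠ[𝓝 s] fun _ => 1 := by
      filter_upwards [lt_mem_nhds (not_le.1 hs')] with t ht
      exact Real.smoothTransition.one_of_one_le ht.le
    rw [hone.deriv_eq, deriv_const]

theorem exists_abs_deriv_smoothTransition_le : ∃ M : ℝ, ∀ s, |deriv Real.smoothTransition s| ≤ M :=
  ((Real.smoothTransition.contDiff (n := 1)).continuous_deriv
    (by simp)).bounded_above_of_compact_support hasCompactSupport_deriv_smoothTransition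

theorem deriv_smoothTransition_nonneg (s : ℝ) : 0 ≤ deriv Real.smoothTransition s :=
  Real.smoothTransition.monotone.deriv_nonneg

theorem HasWeakGradient.integrable_sum_mul_partialD (hG : HasWeakGradient Ω u G) (φ : 𝓓(Ω, ℝ)) :
    Integrable (fun x => ∑ i, G x i * partialD i φ x) (volume.restrict (Ω : Set Plane)) :=
  integrable_finsetSum _ fun i _ => integrable_mul_testFunction (hG i).2.1 (testPartialD i φ)

theorem HasWeakLaplacian.integral_smooth_mul (hw : HasWeakLaplacian Ω u w)
    (hG : HasWeakGradient Ω u G) {g : Plane → ℝ} (hg : ContDiff ℝ (⊤ : ℕ∞) g) (φ : 𝓓(Ω, ℝ)) :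
    (∫ x in Ω, g x * ∑ i, G x i * partialD i φ x) + ∫ x in Ω, φ x * ∑ i, G x i * partialD i g x =
      -∫ x in Ω, g x * (w x * φ x) := by
  have hint : Integrable (fun x => g x * ∑ i, G x i * partialD i φ x)
      (volume.restrict (Ω : Set Plane)) := by
    simp only [Finset.mul_sum, mul_left_comm (g _)]
    simp only [mul_comm (g _)]
    exact integrable_finsetSum _ fun i _ => integrable_mul_testFunction (hG i).2.1
      (testMul (testPartialD i φ) g hg)
  have hint' : Integrable (fun x => φ x * ∑ i, G x i * partialD i g x)
      (volume.restrict (Ω : Set Plane)) := by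
    simp only [Finset.mul_sum, mul_left_comm (φ _)]
    exact integrable_finsetSum _ fun i _ => integrable_mul_testFunction (hG i).2.1
      (testMul φ (partialD i g) (contDiff_partialD hg i))
  rw [← integral_add hint hint']
  calc ∫ x in Ω, g x * (∑ i, G x i * partialD i φ x) + φ x * ∑ i, G x i * partialD i g x
      = ∫ x in Ω, ∑ i, G x i * partialD i (testMul φ g hg) x := by
        refine integral_congr_ae (Eventually.of_forall fun x => ?_)
        simp only [coe_testMul, Finset.mul_sum, ← Finset.sum_add_distrib,
          partialD_mul (differentiable_testFunction φ x) (hg.differentiable (by simp) x)]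
        exact Finset.sum_congr rfl fun i _ => by ring
    _ = -∫ x in Ω, w x * testMul φ g hg x := hw.integral_gradient hG _
    _ = -∫ x in Ω, g x * (w x * φ x) := by
        simp only [coe_testMul, mul_comm (g _), mul_assoc]

theorem setIntegral_tsupport_mul (φ : 𝓓(Ω, ℝ)) (f : Plane → ℝ) :
    ∫ x in tsupport φ, φ x * f x = ∫ x in Ω, φ x * f x := by
  simp only [mul_comm (φ _)]
  rw [setIntegral_mul_eq_integral (subset_tsupport φ),
    setIntegral_mul_eq_integral ((subset_tsupport φ).trans φ.tsupport_subset)]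

theorem tendsto_integral_bdd_mul {α : Type*} [MeasurableSpace α] {μ : Measure α} {a : ℕ → α → ℝ}
    {a₀ f : α → ℝ} {A : ℝ} (ha : ∀ n, AEStronglyMeasurable (a n) μ) (hA : ∀ n x, |a n x| ≤ A)
    (hf : Integrable f μ) (hlim : ∀ᵐ x ∂μ, f x ≠ 0 → Tendsto (fun n => a n x) atTop (𝓝 (a₀ x))) :
    Tendsto (fun n => ∫ x, a n x * f x ∂μ) atTop (𝓝 (∫ x, a₀ x * f x ∂μ)) := by
  refine tendsto_integral_of_dominated_convergence (fun x => A * |f x|)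
    (fun n => (ha n).mul hf.1) (hf.norm.const_mul A)
    (fun n => Eventually.of_forall fun x => ?_) (hlim.mono fun x hx => ?_)
  · rw [norm_mul]
    exact mul_le_mul_of_nonneg_right (hA n x) (norm_nonneg _)
  · rcases eq_or_ne (f x) 0 with hfx | hfx
    · simpa only [hfx, mul_zero] using tendsto_const_nhds
    · exact (hx hfx).mul_const _

theorem HasWeakLaplacian.integral_mul_of_tendsto (hw : HasWeakLaplacian Ω u w)
    (hG : HasWeakGradient Ω u G) {φ : 𝓓(Ω, ℝ)} {g : ℕ → Plane → ℝ} {g₀ : Plane → ℝ} {A L : ℝ}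
    (hg : ∀ n, ContDiff ℝ (⊤ : ℕ∞) (g n)) (hA : ∀ n x, |g n x| ≤ A)
    (hlim : ∀ᵐ x ∂(volume.restrict (tsupport φ)), Tendsto (fun n => g n x) atTop (𝓝 (g₀ x)))
    (hL : Tendsto (fun n => ∫ x in Ω, φ x * ∑ i, G x i * partialD i (g n) x) atTop (𝓝 L)) :
    (∫ x in Ω, g₀ x * ∑ i, G x i * partialD i φ x) + L = -∫ x in Ω, g₀ x * (w x * φ x) := by
  have hlimΩ : ∀ᵐ x ∂(volume.restrict (Ω : Set Plane)),
      x ∈ tsupport φ → Tendsto (fun n => g n x) atTop (𝓝 (g₀ x)) :=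
    ae_restrict_of_ae ((ae_restrict_iff' (isClosed_tsupport φ).measurableSet).1 hlim)
  have hmeas : ∀ n, AEStronglyMeasurable (g n) (volume.restrict (Ω : Set Plane)) := fun n =>
    (hg n).continuous.aestronglyMeasurable
  have hgrad := tendsto_integral_bdd_mul hmeas hA (hG.integrable_sum_mul_partialD φ)
    (hlimΩ.mono fun x hx hne => hx <| by
      obtain ⟨i, -, hi⟩ := Finset.exists_ne_zero_of_sum_ne_zero hne
      exact support_partialD_subset φ i (right_ne_zero_of_mul hi))
  have hlap := tendsto_integral_bdd_mul hmeas hA (integrable_mul_testFunction hw.2.1 φ)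
    (hlimΩ.mono fun x hx hne => hx (subset_tsupport φ (right_ne_zero_of_mul hne)))
  exact tendsto_nhds_unique
    ((hgrad.add hL).congr fun n => hw.integral_smooth_mul hG (hg n) φ) hlap.neg

theorem memLp_restrict_of_continuousOn {f : Plane → ℝ} {K : Set Plane} (hK : IsCompact K)
    (hf : ContinuousOn f K) (p : ℝ≥0∞) : MemLp f p (volume.restrict K) := by
  have hfin : IsFiniteMeasure (volume.restrict K) := isFiniteMeasure_restrict.2 hK.measure_ne_top
  obtain ⟨C, hC⟩ := hK.exists_bound_of_continuousOn hf
  exact MemLp.of_bound (hf.aestronglyMeasurable_of_isCompact hK hK.measurableSet) C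
    ((ae_restrict_iff' hK.measurableSet).2 (Eventually.of_forall hC))

theorem HasWeakLaplacian.integral_comp_mul {v : Plane → ℝ} {Gv : Plane → Plane}
    (hw : HasWeakLaplacian Ω u w) (hG : HasWeakGradient Ω u G)
    (hG2 : ∀ i, MemLp (fun x => G x i) 2 (volume.restrict (Ω : Set Plane)))
    (hv : HasWeakGradient Ω v Gv)
    (hv2 : ∀ i, MemLp (fun x => Gv x i) 2 (volume.restrict (Ω : Set Plane)))
    {k : ℝ → ℝ} {A M : ℝ} (hk : ContDiff ℝ (⊤ : ℕ∞) k) (hA : ∀ s, |k s| ≤ A)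
    (hM : ∀ s, |deriv k s| ≤ M) (φ : 𝓓(Ω, ℝ)) :
    (∫ x in Ω, k (v x) * ∑ i, G x i * partialD i φ x) +
      ∫ x in Ω, φ x * (deriv k (v x) * ∑ i, G x i * Gv x i) =
      -∫ x in Ω, k (v x) * (w x * φ x) := by
  have hK : IsCompact (tsupport φ) := φ.hasCompactSupport
  have hk' : Continuous (deriv k) := hk.continuous_deriv (by simp)
  have hres : ∀ {L : Set Plane}, L ⊆ Ω → ∀ {f : Plane → ℝ},
      MemLp f 2 (volume.restrict (Ω : Set Plane)) → MemLp f 2 (volume.restrict L) :=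
    fun hL _ hf => hf.mono_measure (Measure.restrict_mono hL le_rfl)
  obtain ⟨v', hvs, hva, -, hvd⟩ := exists_smooth_approx (hv 0).1 hK φ.tsupport_subset
  obtain ⟨B, hB⟩ := φ.continuous.bounded_above_of_compact_support φ.hasCompactSupport
  have hcont : ∀ n i, ContinuousOn (partialD i (v' n)) (tsupport φ) := fun n i =>
    (contDiff_partialD (hvs n) i).continuous.continuousOn
  refine hw.integral_mul_of_tendsto hG (fun n => hk.comp (hvs n)) (fun n x => hA (v' n x))
    (hva.mono fun x hx => (hk.continuous.tendsto _).comp hx) ?_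
  simp only [← setIntegral_tsupport_mul, Function.comp_def,
    partialD_comp (hk.differentiable (by simp) _) ((hvs _).differentiable (by simp) _),
    mul_left_comm (G _ _), ← Finset.mul_sum]
  simp only [← mul_assoc]
  refine tendsto_integral_bdd_mul_sum (M := B * M)
    (fun n => (φ.continuous.mul (hk'.comp (hvs n).continuous)).aestronglyMeasurable)
    (fun n x => ?_) (hva.mono fun x hx => ((hk'.tendsto _).comp hx).const_mul _)
    (fun n i => memLp_restrict_of_continuousOn hK (hcont n i) 2)
    (fun i => hres φ.tsupport_subset (hv2 i)) (fun i => hres φ.tsupport_subset (hG2 i))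
    fun i => hvd i _ (hv i) 2 one_le_two ENNReal.ofNat_ne_top fun L _ hL => hres hL (hv2 i)
  rw [Pi.mul_apply, abs_mul]
  exact mul_le_mul (hB x) (hM _) (abs_nonneg _) ((norm_nonneg _).trans (hB x))

/-- Test `Δu = w` with `k(w) φ`: the term with `k'(w) φ ∇u · ∇w` has a sign. -/
theorem HasWeakLaplacian.integral_monotone_comp_mul_le (hw : HasWeakLaplacian Ω u w)
    (hG : HasWeakGradient Ω u G)
    (hG2 : ∀ i, MemLp (fun x => G x i) 2 (volume.restrict (Ω : Set Plane)))
    (hGw : HasWeakGradient Ω w Gw)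
    (hGw2 : ∀ i, MemLp (fun x => Gw x i) 2 (volume.restrict (Ω : Set Plane)))
    (hGGw : ∀ᵐ x ∂(volume.restrict (Ω : Set Plane)), 0 ≤ ∑ i, G x i * Gw x i)
    {k : ℝ → ℝ} {A M : ℝ} (hk : ContDiff ℝ (⊤ : ℕ∞) k) (hA : ∀ s, |k s| ≤ A)
    (hM : ∀ s, |deriv k s| ≤ M) (hmono : Monotone k) {φ : 𝓓(Ω, ℝ)} (hφ : ∀ x, 0 ≤ φ x) :
    ∫ x in Ω, k (w x) * (w x * φ x) ≤ -∫ x in Ω, k (w x) * ∑ i, G x i * partialD i φ x := by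
  have hnonneg : 0 ≤ ∫ x in Ω, φ x * (deriv k (w x) * ∑ i, G x i * Gw x i) :=
    integral_nonneg_of_ae (hGGw.mono fun x hx =>
      mul_nonneg (hφ x) (mul_nonneg hmono.deriv_nonneg hx))
  linarith [hw.integral_comp_mul hG hG2 hGw hGw2 hk hA hM φ]

theorem ae_nonpos_of_tendsto_of_integral_le {α : Type*} [MeasurableSpace α] {μ : Measure α}
    {p : ℕ → α → ℝ} {p₀ : α → ℝ} {r : ℕ → ℝ} {r₀ : ℝ} (hp : ∀ n, Integrable (p n) μ)
    (hp0 : ∀ n x, 0 ≤ p n x) (hle : ∀ n, ∫ x, p n x ∂μ ≤ r n) (hr : Tendsto r atTop (𝓝 r₀))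
    (hr0 : r₀ ≤ 0) (hlim : ∀ᵐ x ∂μ, Tendsto (fun n => p n x) atTop (𝓝 (p₀ x))) :
    ∀ᵐ x ∂μ, p₀ x ≤ 0 := by
  have hmeas : AEMeasurable p₀ μ := aemeasurable_of_tendsto_metrizable_ae atTop
    (fun n => (hp n).1.aemeasurable) hlim
  have hlintegral : ∫⁻ x, ENNReal.ofReal (p₀ x) ∂μ ≤ 0 := by
    calc ∫⁻ x, ENNReal.ofReal (p₀ x) ∂μ
        = ∫⁻ x, liminf (fun n => ENNReal.ofReal (p n x)) atTop ∂μ := by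
          refine lintegral_congr_ae (hlim.mono fun x hx => ?_)
          exact ((ENNReal.continuous_ofReal.tendsto _).comp hx).liminf_eq.symm
      _ ≤ liminf (fun n => ∫⁻ x, ENNReal.ofReal (p n x) ∂μ) atTop :=
          lintegral_liminf_le' fun n => (hp n).1.aemeasurable.ennreal_ofReal
      _ ≤ liminf (fun n => ENNReal.ofReal (r n)) atTop := by
          refine liminf_le_liminf (Eventually.of_forall fun n => ?_)
          rw [← ofReal_integral_eq_lintegral_ofReal (hp n) (Eventually.of_forall (hp0 n))]
          exact ENNReal.ofReal_le_ofReal (hle n)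
      _ = ENNReal.ofReal r₀ := ((ENNReal.continuous_ofReal.tendsto _).comp hr).liminf_eq
      _ ≤ 0 := (ENNReal.ofReal_of_nonpos hr0).le
  filter_upwards [(lintegral_eq_zero_iff' hmeas.ennreal_ofReal).1 (le_antisymm hlintegral zero_le)]
    with x hx
  exact ENNReal.ofReal_eq_zero.1 hx

theorem H10Approx.tendsto_integral_gradient_comp {φ : ℕ → 𝓓(Ω, ℝ)} (h : H10Approx Ω u G φ)
    {a : Plane → ℝ} (ha : AEStronglyMeasurable a (volume.restrict (Ω : Set Plane)))
    {A M : ℝ} (hA : ∀ x, |a x| ≤ A) {T : ℝ → ℝ} (hT : ContDiff ℝ (⊤ : ℕ∞) T) (hT0 : T 0 = 0)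
    (hM : ∀ s, |deriv T s| ≤ M) :
    Tendsto (fun n => ∫ x in Ω, a x * ∑ i, G x i * partialD i (testComp (φ n) T hT hT0) x) atTop
      (𝓝 (∫ x in Ω, a x * deriv T (u x) * ∑ i, G x i * G x i)) := by
  have hT' : Continuous (deriv T) := hT.continuous_deriv (by simp)
  simp only [coe_testComp, partialD_comp (hT.differentiable (by simp) _)
    (differentiable_testFunction _ _), mul_left_comm (G _ _), ← Finset.mul_sum]
  simp only [← mul_assoc]
  refine tendsto_integral_bdd_mul_sum (M := A * M)
    (fun n => ha.mul (hT'.comp (φ n).continuous).aestronglyMeasurable) (fun n x => ?_)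
    (h.ae_tendsto.mono fun x hx => ((hT'.tendsto _).comp hx).const_mul _)
    (fun n i => memLp_testFunction (testPartialD i (φ n)) 2 _) h.memLp_grad h.memLp_grad
    h.tendsto_grad
  rw [Pi.mul_apply, abs_mul]
  exact mul_le_mul (hA x) (hM _) (abs_nonneg _) ((abs_nonneg _).trans (hA x))

/-- The test function is `T(w) T(φ n)`, where `T` is the smooth transition and `φ n → u`; the limit
of the resulting inequality is `∫ T(w) w T(u) ≤ -∫ T(w) T'(u) |∇u|² ≤ 0`. -/
theorem H10Approx.laplacian_nonpos_of_pos {φ : ℕ → 𝓓(Ω, ℝ)} (h : H10Approx Ω u G φ)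
    (hw : HasWeakLaplacian Ω u w) (hGw : HasWeakGradient Ω w Gw)
    (hGw2 : ∀ i, MemLp (fun x => Gw x i) 2 (volume.restrict (Ω : Set Plane)))
    (hGGw : ∀ᵐ x ∂(volume.restrict (Ω : Set Plane)), 0 ≤ ∑ i, G x i * Gw x i) :
    ∀ᵐ x ∂(volume.restrict (Ω : Set Plane)), 0 < u x → w x ≤ 0 := by
  set T := Real.smoothTransition
  obtain ⟨M, hM⟩ := exists_abs_deriv_smoothTransition_le
  have hT : ContDiff ℝ (⊤ : ℕ∞) T := Real.smoothTransition.contDiff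
  have hT0 : ∀ s, 0 ≤ T s := Real.smoothTransition.nonneg
  have hTw : AEStronglyMeasurable (fun x => T (w x)) (volume.restrict (Ω : Set Plane)) :=
    hT.continuous.comp_aestronglyMeasurable hw.2.1.aestronglyMeasurable
  let χ : ℕ → 𝓓(Ω, ℝ) := fun n => testComp (φ n) T hT Real.smoothTransition.zero
  have hlim := h.tendsto_integral_gradient_comp hTw (fun x => abs_smoothTransition_le_one (w x)) hT
    Real.smoothTransition.zero hM
  have hsign : ∀ s t, 0 ≤ T s * (s * T t) := fun s t => by
    rcases le_total s 0 with hs | hs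
    · simp only [T, Real.smoothTransition.zero_of_nonpos hs, zero_mul, le_refl]
    · exact mul_nonneg (hT0 s) (mul_nonneg hs (hT0 t))
  have hnonpos := ae_nonpos_of_tendsto_of_integral_le
    (p₀ := fun x => T (w x) * (w x * T (u x)))
    (fun n => (integrable_mul_testFunction hw.2.1 (χ n)).bdd_mul hTw
      (Eventually.of_forall fun x => abs_smoothTransition_le_one _)) (fun n x => hsign _ _)
    (fun n => hw.integral_monotone_comp_mul_le h.grad h.memLp_grad hGw hGw2 hGGw hT
      abs_smoothTransition_le_one hM Real.smoothTransition.monotone fun x => hT0 _) hlim.neg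
    (neg_nonpos.2 (integral_nonneg fun x => mul_nonneg (mul_nonneg (hT0 _)
      (deriv_smoothTransition_nonneg _)) (Finset.sum_nonneg fun i _ => mul_self_nonneg _)))
    (h.ae_tendsto.mono fun x hx => (((hT.continuous.tendsto _).comp hx).const_mul _).const_mul _)
  filter_upwards [hnonpos] with x hx hux
  by_contra! hwx
  have hTu : 0 < T (u x) := Real.smoothTransition.pos_of_pos hux
  have hTwx : 0 < T (w x) := Real.smoothTransition.pos_of_pos hwx
  exact hx.not_gt (by positivity)

/-- The test functions `T(-n w) η`, where `T` is the smooth transition, approximate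
`1_{w < 0} η`. -/
theorem HasWeakLaplacian.integral_neg_set_gradient_nonneg (hw : HasWeakLaplacian Ω u w)
    (hG : HasWeakGradient Ω u G)
    (hG2 : ∀ i, MemLp (fun x => G x i) 2 (volume.restrict (Ω : Set Plane)))
    (hGw : HasWeakGradient Ω w Gw)
    (hGw2 : ∀ i, MemLp (fun x => Gw x i) 2 (volume.restrict (Ω : Set Plane)))
    (hGGw : ∀ᵐ x ∂(volume.restrict (Ω : Set Plane)), 0 ≤ ∑ i, G x i * Gw x i)
    {η : 𝓓(Ω, ℝ)} (hη : ∀ x, 0 ≤ η x) :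
    0 ≤ ∫ x in Ω, (if 0 < -w x then 1 else 0) * ∑ i, G x i * partialD i η x := by
  obtain ⟨M, hM⟩ := exists_abs_deriv_smoothTransition_le
  let k : ℕ → ℝ → ℝ := fun n s => Real.smoothTransition (n * -s)
  have hk : ∀ n, ContDiff ℝ (⊤ : ℕ∞) (k n) := fun n =>
    Real.smoothTransition.contDiff.comp (contDiff_const.mul contDiff_neg)
  have hk' : ∀ n s, |deriv (fun t => -k n t) s| ≤ n * M := fun n s => by
    have hinner : HasDerivAt (fun t : ℝ => (n : ℝ) * -t) (n * -1) s :=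
      (hasDerivAt_id s).neg.const_mul (n : ℝ)
    have hT : DifferentiableAt ℝ Real.smoothTransition (n * -s) :=
      Real.smoothTransition.contDiff.differentiable (n := 1) (by simp) _
    have hderiv : HasDerivAt (k n) (deriv Real.smoothTransition (n * -s) * (n * -1)) s :=
      HasDerivAt.comp (h₂ := Real.smoothTransition) s hT.hasDerivAt hinner
    rw [hderiv.fun_neg.deriv, abs_neg, abs_mul, mul_neg_one, abs_neg, Nat.abs_cast, mul_comm]
    exact mul_le_mul_of_nonneg_left (hM _) n.cast_nonneg
  have hmono : ∀ n, Monotone fun s => -k n s := fun n s t hst => neg_le_neg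
    (Real.smoothTransition.monotone (mul_le_mul_of_nonneg_left (neg_le_neg hst) n.cast_nonneg))
  have hstep : ∀ n, 0 ≤ ∫ x in Ω, k n (w x) * ∑ i, G x i * partialD i η x := fun n => by
    have hle := hw.integral_monotone_comp_mul_le hG hG2 hGw hGw2 hGGw (hk n).neg
      (fun s => (abs_neg _).trans_le (abs_smoothTransition_le_one _)) (hk' n) (hmono n) hη
    simp only [neg_mul, integral_neg, neg_neg] at hle
    refine le_trans (neg_nonneg.2 (integral_nonpos fun x => ?_)) hle
    rcases le_total (w x) 0 with hwx | hwx
    · exact mul_nonpos_of_nonneg_of_nonpos (Real.smoothTransition.nonneg _)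
        (mul_nonpos_of_nonpos_of_nonneg hwx (hη x))
    · have hkw : k n (w x) = 0 := Real.smoothTransition.zero_of_nonpos
        (mul_nonpos_of_nonneg_of_nonpos n.cast_nonneg (neg_nonpos.2 hwx))
      simp only [hkw, zero_mul, Pi.zero_apply, le_refl]
  exact ge_of_tendsto' (tendsto_integral_bdd_mul
    (fun n => (hk n).continuous.comp_aestronglyMeasurable hw.2.1.aestronglyMeasurable)
    (fun n x => abs_smoothTransition_le_one _) (hG.integrable_sum_mul_partialD η)
    (Eventually.of_forall fun x _ => tendsto_smoothTransition_mul _)) hstep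

theorem HasWeakGradient.integral_posPart_mul_laplacian (hG : HasWeakGradient Ω u G)
    (η : 𝓓(Ω, ℝ)) :
    ∫ x in Ω, max (u x) 0 * ∑ i, partialD i (partialD i η) x =
      -∫ x in Ω, (if 0 < u x then 1 else 0) * ∑ i, G x i * partialD i η x := by
  have hpos : ∀ i, HasWeakPartial Ω i (fun x => max (u x) 0)
      (fun x => (if 0 < u x then 1 else 0) * G x i) := fun i => (hG i).posPart
  simp only [Finset.mul_sum, ← mul_assoc]
  rw [integral_finsetSum, integral_finsetSum, ← Finset.sum_neg_distrib]
  · exact Finset.sum_congr rfl fun i _ => (hpos i).2.2 (testPartialD i η)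
  · exact fun i _ => integrable_mul_testFunction (hpos i).2.1 (testPartialD i η)
  · exact fun i _ => integrable_mul_testFunction (hpos i).1 (testPartialD i (testPartialD i η))

theorem HasWeakGradient.ae_eq_zero_of_eq_zero (hG : HasWeakGradient Ω u G) :
    ∀ᵐ x ∂(volume.restrict (Ω : Set Plane)), u x = 0 → G x = 0 := by
  filter_upwards [ae_all_iff.2 fun i => (hG i).ae_eq_zero_of_eq_zero] with x hx hux
  exact PiLp.ext fun i => hx i hux

/-- `u` is superharmonic on `Ω` in the sense of distributions: its distributional Laplacian is
nonpositive. -/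
def IsWeaklySuperharmonic (Ω : Opens Plane) (u : Plane → ℝ) : Prop :=
  LocallyIntegrableOn u Ω ∧ ∀ η : 𝓓(Ω, ℝ), (∀ x, 0 ≤ η x) →
    ∫ x in Ω, u x * ∑ i, partialD i (partialD i η) x ≤ 0

/-- Almost everywhere `1_{u > 0} ∇u = 1_{w < 0} ∇u`. -/
theorem H10Approx.isWeaklySuperharmonic_posPart {φ : ℕ → 𝓓(Ω, ℝ)} (h : H10Approx Ω u G φ)
    (hw : HasWeakLaplacian Ω u w) (hGw : HasWeakGradient Ω w Gw)
    (hGw2 : ∀ i, MemLp (fun x => Gw x i) 2 (volume.restrict (Ω : Set Plane)))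
    (hGGw : ∀ᵐ x ∂(volume.restrict (Ω : Set Plane)), 0 ≤ ∑ i, G x i * Gw x i)
    (hzero : ∀ᵐ x ∂(volume.restrict (Ω : Set Plane)), Gw x = 0 → G x = 0) :
    IsWeaklySuperharmonic Ω (fun x => max (u x) 0) := by
  refine ⟨(h.grad 0).posPart.1, fun η hη => ?_⟩
  have hneg : ∀ᵐ x ∂(volume.restrict (Ω : Set Plane)), 0 < -u x → -w x ≤ 0 :=
    h.neg.laplacian_nonpos_of_pos hw.neg hGw.neg (fun i => (hGw2 i).neg) <|
      hGGw.mono fun x hx => by simpa only [PiLp.neg_apply, neg_mul_neg] using hx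
  rw [h.grad.integral_posPart_mul_laplacian, neg_nonpos]
  refine (hw.integral_neg_set_gradient_nonneg h.grad h.memLp_grad hGw hGw2 hGGw hη).trans_eq
    (integral_congr_ae ?_)
  filter_upwards [h.laplacian_nonpos_of_pos hw hGw hGw2 hGGw, hneg, h.grad.ae_eq_zero_of_eq_zero,
    hGw.ae_eq_zero_of_eq_zero, hzero] with x hupos huneg hGu hGwx hGx
  rcases lt_trichotomy (u x) 0 with hux | hux | hux
  · simp [hux.not_gt, (neg_nonpos.1 (huneg (neg_pos.2 hux))).not_gt]
  · simp [hGu hux]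
  · rcases (hupos hux).lt_or_eq with hwx | hwx
    · simp [hux, hwx]
    · simp [hGx (hGwx hwx)]

end Testing

section RadialProfile

/-- A smooth decreasing profile, positive on `(-∞, 1)` and zero on `[1, ∞)`. -/
noncomputable def radialProfile (t : ℝ) : ℝ := expNegInvGlue (1 - t)

theorem contDiff_radialProfile : ContDiff ℝ (⊤ : ℕ∞) radialProfile :=
  expNegInvGlue.contDiff.comp (contDiff_const.sub contDiff_id)

theorem contDiff_deriv_radialProfile : ContDiff ℝ (⊤ : ℕ∞) (deriv radialProfile) :=
  (contDiff_infty_iff_deriv.1 contDiff_radialProfile).2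

theorem contDiff_deriv_deriv_radialProfile : ContDiff ℝ (⊤ : ℕ∞) (deriv (deriv radialProfile)) :=
  (contDiff_infty_iff_deriv.1 contDiff_deriv_radialProfile).2

theorem radialProfile_nonneg (t : ℝ) : 0 ≤ radialProfile t := expNegInvGlue.nonneg _

theorem radialProfile_of_one_le {t : ℝ} (ht : 1 ≤ t) : radialProfile t = 0 :=
  expNegInvGlue.zero_of_nonpos (sub_nonpos.2 ht)

theorem deriv_radialProfile (t : ℝ) :
    deriv radialProfile t = -(((1 - t)⁻¹) ^ 2 * expNegInvGlue (1 - t)) := by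
  have hglue := expNegInvGlue.hasDerivAt_polynomial_eval_inv_mul 1 (1 - t)
  simp only [Polynomial.eval_one, one_mul] at hglue
  have hcomp := (hglue.comp t ((hasDerivAt_id t).const_sub 1)).deriv
  refine Eq.trans hcomp ?_
  simp only [Polynomial.derivative_one, sub_zero, mul_one, Polynomial.eval_pow, Polynomial.eval_X,
    mul_neg]

theorem deriv_radialProfile_nonpos (t : ℝ) : deriv radialProfile t ≤ 0 := by
  rw [deriv_radialProfile, neg_nonpos]
  exact mul_nonneg (sq_nonneg _) (expNegInvGlue.nonneg _)

theorem deriv_radialProfile_neg {t : ℝ} (ht : t < 1) : deriv radialProfile t < 0 := by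
  have ht' : 0 < 1 - t := sub_pos.2 ht
  rw [deriv_radialProfile, neg_lt_zero]
  exact mul_pos (by positivity) (expNegInvGlue.pos_of_pos ht')

theorem deriv_radialProfile_of_one_le {t : ℝ} (ht : 1 ≤ t) : deriv radialProfile t = 0 := by
  rw [deriv_radialProfile, expNegInvGlue.zero_of_nonpos (sub_nonpos.2 ht), mul_zero, neg_zero]

theorem exists_abs_deriv_radialProfile_le :
    ∃ C : ℝ, ∀ t, 0 ≤ t → |deriv radialProfile t| ≤ C := by
  obtain ⟨C, hC⟩ := isCompact_Icc.exists_bound_of_continuousOn (s := Set.Icc (0 : ℝ) 1)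
    contDiff_deriv_radialProfile.continuous.continuousOn
  refine ⟨C, fun t ht => ?_⟩
  rcases le_total t 1 with ht1 | ht1
  · exact hC t ⟨ht, ht1⟩
  · rw [deriv_radialProfile_of_one_le ht1, abs_zero]
    exact (norm_nonneg _).trans (hC 0 (Set.left_mem_Icc.2 zero_le_one))

/-- The weight `-s ρ'(s t)`, where `ρ` is the radial profile; at `t = |y - x|²` it is supported in
the disc of radius `s ^ (-1/2)` about `x` and its mass does not depend on `s > 0`. -/
noncomputable def radialWeight (s t : ℝ) : ℝ := -(s * deriv radialProfile (s * t))

/-- The derivative of `radialWeight` in the scale `s`. -/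
noncomputable def radialWeightDeriv (s t : ℝ) : ℝ :=
  -(deriv radialProfile (s * t) + s * t * deriv (deriv radialProfile) (s * t))

theorem hasDerivAt_radialWeight (s t : ℝ) :
    HasDerivAt (fun s => radialWeight s t) (radialWeightDeriv s t) s := by
  have hprofile := (contDiff_deriv_radialProfile.differentiable (by simp) (s * t)).hasDerivAt.comp s
    ((hasDerivAt_id s).mul_const t)
  refine (((hasDerivAt_id s).mul hprofile).neg).congr_deriv ?_
  simp only [radialWeightDeriv, id, Function.comp_apply]
  ring

theorem continuous_radialWeight (s : ℝ) : Continuous (radialWeight s) := by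
  have := contDiff_deriv_radialProfile.continuous
  unfold radialWeight
  fun_prop

theorem continuous_radialWeightDeriv : Continuous (Function.uncurry radialWeightDeriv) := by
  have := contDiff_deriv_radialProfile.continuous
  have := contDiff_deriv_deriv_radialProfile.continuous
  unfold radialWeightDeriv Function.uncurry
  fun_prop

theorem radialWeight_nonneg {s : ℝ} (hs : 0 ≤ s) (t : ℝ) : 0 ≤ radialWeight s t :=
  neg_nonneg.2 (mul_nonpos_of_nonneg_of_nonpos hs (deriv_radialProfile_nonpos _))

theorem radialWeight_pos {s t : ℝ} (hs : 0 < s) (ht : s * t < 1) : 0 < radialWeight s t :=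
  neg_pos.2 (mul_neg_of_pos_of_neg hs (deriv_radialProfile_neg ht))

theorem radialWeight_of_one_le {s t : ℝ} (hst : 1 ≤ s * t) : radialWeight s t = 0 := by
  rw [radialWeight, deriv_radialProfile_of_one_le hst, mul_zero, neg_zero]

theorem partialD_mul_norm_sub_sq (s : ℝ) (x y : Plane) (i : Fin 2) :
    partialD i (fun y => s * ‖y - x‖ ^ 2) y = 2 * s * (y i - x i) := by
  have hnorm : HasFDerivAt (fun y : Plane => ‖y - x‖ ^ 2) (2 • innerSL ℝ (y - x)) y := by
    simpa [Function.comp_def] using!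
      (hasStrictFDerivAt_norm_sq (y - x)).hasFDerivAt.comp y ((hasFDerivAt_id y).sub_const x)
  rw [partialD_const_mul hnorm.differentiableAt, partialD, hnorm.fderiv]
  simp [EuclideanSpace.inner_single_right]
  ring

theorem partialD_mul_coord_sub (c : ℝ) (x y : Plane) (i : Fin 2) :
    partialD i (fun y => c * (y i - x i)) y = c := by
  have hcoord : HasFDerivAt (fun y : Plane => y i - x i)
      (EuclideanSpace.proj i : Plane →L[ℝ] ℝ) y :=
    (EuclideanSpace.proj i : Plane →L[ℝ] ℝ).hasFDerivAt.sub_const _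
  rw [partialD_const_mul hcoord.differentiableAt, partialD, hcoord.fderiv]
  simp

theorem contDiff_mul_norm_sub_sq (s : ℝ) (x : Plane) :
    ContDiff ℝ (⊤ : ℕ∞) fun y : Plane => s * ‖y - x‖ ^ 2 :=
  contDiff_const.mul ((contDiff_norm_sq ℝ).comp (contDiff_id.sub contDiff_const))

/-- In dimension two the Laplacian of a radial bump is a multiple of the scale derivative of the
weight given by its radial derivative. -/
theorem laplacian_radialProfile (s : ℝ) (x y : Plane) :
    ∑ i, partialD i (partialD i fun y => radialProfile (s * ‖y - x‖ ^ 2)) y =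
      -(4 * s) * radialWeightDeriv s (‖y - x‖ ^ 2) := by
  have hN : Differentiable ℝ fun y : Plane => s * ‖y - x‖ ^ 2 :=
    (contDiff_mul_norm_sub_sq s x).differentiable (by simp)
  have hρ' : Differentiable ℝ (deriv radialProfile) :=
    contDiff_deriv_radialProfile.differentiable (by simp)
  have hgrad : ∀ i, (partialD i fun y => radialProfile (s * ‖y - x‖ ^ 2)) =
      fun y => deriv radialProfile (s * ‖y - x‖ ^ 2) * (2 * s * (y i - x i)) := fun i => by
    ext y
    rw [partialD_comp (contDiff_radialProfile.differentiable (by simp) _) (hN y),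
      partialD_mul_norm_sub_sq]
  have hcoord : ∀ i, DifferentiableAt ℝ (fun y : Plane => 2 * s * (y i - x i)) y := fun i =>
    (((EuclideanSpace.proj i : Plane →L[ℝ] ℝ).differentiableAt).sub_const _).const_mul _
  have hhess : ∀ i, partialD i (partialD i fun y => radialProfile (s * ‖y - x‖ ^ 2)) y =
      deriv (deriv radialProfile) (s * ‖y - x‖ ^ 2) * (2 * s * (y i - x i)) *
        (2 * s * (y i - x i)) + deriv radialProfile (s * ‖y - x‖ ^ 2) * (2 * s) := fun i => by
    have hcomp : DifferentiableAt ℝ (fun y => deriv radialProfile (s * ‖y - x‖ ^ 2)) y :=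
      (hρ' _).comp y (hN y)
    rw [hgrad, partialD_mul hcomp (hcoord i), partialD_comp (hρ' _) (hN y),
      partialD_mul_norm_sub_sq, partialD_mul_coord_sub]
  have hnorm : ‖y - x‖ ^ 2 = (y 0 - x 0) ^ 2 + (y 1 - x 1) ^ 2 := by
    simp only [EuclideanSpace.norm_sq_eq, Fin.sum_univ_two, PiLp.sub_apply, Real.norm_eq_abs,
      sq_abs]
  simp only [hhess, Fin.sum_univ_two, radialWeightDeriv]
  rw [hnorm]
  ring

end RadialProfile

section StrongMinimum

variable {Ω : Opens Plane} {u : Plane → ℝ} {x : Plane} {R : ℝ}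

theorem hasDerivAt_setIntegral_mul {X : Type*} [TopologicalSpace X] [T2Space X]
    [MeasurableSpace X] [OpensMeasurableSpace X] {μ : Measure X} {K : Set X} (hK : IsCompact K)
    {v : X → ℝ} (hv : IntegrableOn v K μ) {F F' : ℝ → X → ℝ} (hF : ∀ s, Continuous (F s))
    (hF' : Continuous (Function.uncurry F')) (hFF' : ∀ s y, HasDerivAt (F · y) (F' s y) s)
    (s : ℝ) : HasDerivAt (fun s => ∫ y in K, v y * F s y ∂μ) (∫ y in K, v y * F' s y ∂μ) s := by
  obtain ⟨C, hC⟩ := (isCompact_Icc.prod hK).exists_bound_of_continuousOn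
    (s := Set.Icc (s - 1) (s + 1) ×ˢ K) hF'.continuousOn
  have hF'c : Continuous (F' s) := hF'.comp (Continuous.prodMk_right s)
  refine (hasDerivAt_integral_of_dominated_loc_of_deriv_le (bound := fun y => ‖v y‖ * C)
    (Metric.ball_mem_nhds s one_pos)
    (Eventually.of_forall fun s => hv.aestronglyMeasurable.mul (hF s).aestronglyMeasurable)
    (hv.mul_continuousOn (hF s).continuousOn hK)
    (hv.aestronglyMeasurable.mul hF'c.aestronglyMeasurable) ?_ (hv.norm.mul_const C)
    (Eventually.of_forall fun y s' _ => (hFF' s' y).const_mul (v y))).2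
  filter_upwards [ae_restrict_mem hK.measurableSet] with y hy s' hs'
  rw [Real.ball_eq_Ioo] at hs'
  rw [norm_mul]
  exact mul_le_mul_of_nonneg_left (hC (s', y) ⟨Set.Ioo_subset_Icc_self hs', hy⟩) (norm_nonneg _)

/-- The unnormalised weighted mean of `u` over the disc of radius `s ^ (-1/2)` about `x`, provided
that this radius is at most `R`. -/
noncomputable def radialMean (u : Plane → ℝ) (x : Plane) (R s : ℝ) : ℝ :=
  ∫ y in Metric.closedBall x R, u y * radialWeight s (‖y - x‖ ^ 2)

theorem hasDerivAt_radialMean (hu : IntegrableOn u (Metric.closedBall x R)) (s : ℝ) :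
    HasDerivAt (radialMean u x R)
      (∫ y in Metric.closedBall x R, u y * radialWeightDeriv s (‖y - x‖ ^ 2)) s :=
  hasDerivAt_setIntegral_mul (isCompact_closedBall x R) hu
    (F := fun s y => radialWeight s (‖y - x‖ ^ 2))
    (F' := fun s y => radialWeightDeriv s (‖y - x‖ ^ 2))
    (fun s => (continuous_radialWeight s).comp (by fun_prop))
    (continuous_radialWeightDeriv.comp (f := fun p : ℝ × Plane => (p.1, ‖p.2 - x‖ ^ 2))
      (by fun_prop)) (fun s y => hasDerivAt_radialWeight s _) s

theorem one_le_mul_norm_sub_sq {y : Plane} {s : ℝ} (hR : 0 < R) (hs : 1 / R ^ 2 ≤ s)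
    (hy : y ∉ Metric.closedBall x R) : 1 ≤ s * ‖y - x‖ ^ 2 := by
  rw [mem_closedBall_iff_norm, not_le] at hy
  calc 1 = 1 / R ^ 2 * R ^ 2 := by field_simp
    _ ≤ s * ‖y - x‖ ^ 2 := mul_le_mul hs (pow_le_pow_left₀ hR.le hy.le 2) (by positivity)
        ((by positivity : 0 ≤ 1 / R ^ 2).trans hs)

theorem support_radialProfile_subset {s : ℝ} (hR : 0 < R) (hs : 1 / R ^ 2 ≤ s) :
    (Function.support fun y => radialProfile (s * ‖y - x‖ ^ 2)) ⊆ Metric.closedBall x R :=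
  fun _ hy => by_contra fun hyR => hy (radialProfile_of_one_le (one_le_mul_norm_sub_sq hR hs hyR))

theorem IsWeaklySuperharmonic.integral_mul_radialWeightDeriv_nonneg
    (h : IsWeaklySuperharmonic Ω u) {s : ℝ} (hR : 0 < R) (hball : Metric.closedBall x R ⊆ Ω)
    (hs : 1 / R ^ 2 ≤ s) :
    0 ≤ ∫ y in Metric.closedBall x R, u y * radialWeightDeriv s (‖y - x‖ ^ 2) := by
  have hs0 : 0 < s := lt_of_lt_of_le (by positivity) hs
  have hζ := support_radialProfile_subset (x := x) hR hs
  let η : 𝓓(Ω, ℝ) := ⟨fun y => radialProfile (s * ‖y - x‖ ^ 2),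
    contDiff_radialProfile.comp (contDiff_mul_norm_sub_sq s x),
    HasCompactSupport.of_support_subset_isCompact (isCompact_closedBall x R) hζ,
    (closure_minimal hζ Metric.isClosed_closedBall).trans hball⟩
  have hlap : ∀ y, ∑ i, partialD i (partialD i η) y =
      -(4 * s) * radialWeightDeriv s (‖y - x‖ ^ 2) := laplacian_radialProfile s x
  have hsupp : (Function.support fun y => ∑ i, partialD i (partialD i η) y) ⊆
      Metric.closedBall x R := fun y hy => by
    by_contra hyR
    refine hy (Finset.sum_eq_zero fun i _ => ?_)
    by_contra hne
    exact hyR (closure_minimal hζ Metric.isClosed_closedBall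
      ((closure_minimal (support_partialD_subset η i) (isClosed_tsupport _))
        (support_partialD_subset (testPartialD i η) i hne)))
  have hle : ∫ y in Metric.closedBall x R, u y * ∑ i, partialD i (partialD i η) y ≤ 0 := by
    have hη := h.2 η fun y => radialProfile_nonneg _
    rwa [setIntegral_mul_eq_integral hsupp, ← setIntegral_mul_eq_integral (hsupp.trans hball)]
  simp only [hlap, mul_left_comm (u _)] at hle
  rw [integral_const_mul] at hle
  exact nonneg_of_mul_nonpos_right hle (by linarith)

theorem radialMean_nonneg (hu0 : ∀ y, 0 ≤ u y) (x : Plane) (R : ℝ) {s : ℝ} (hs : 0 ≤ s) :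
    0 ≤ radialMean u x R s :=
  integral_nonneg fun y => mul_nonneg (hu0 y) (radialWeight_nonneg hs _)

theorem IsWeaklySuperharmonic.integrableOn_closedBall (h : IsWeaklySuperharmonic Ω u)
    (hball : Metric.closedBall x R ⊆ Ω) : IntegrableOn u (Metric.closedBall x R) :=
  h.1.integrableOn_compact_subset hball (isCompact_closedBall _ _)

theorem IsWeaklySuperharmonic.monotoneOn_radialMean (h : IsWeaklySuperharmonic Ω u) (hR : 0 < R)
    (hball : Metric.closedBall x R ⊆ Ω) :
    MonotoneOn (radialMean u x R) (Set.Ici (1 / R ^ 2)) := by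
  have hderiv := hasDerivAt_radialMean (h.integrableOn_closedBall hball)
  refine monotoneOn_of_deriv_nonneg (convex_Ici _)
    (fun s _ => (hderiv s).continuousAt.continuousWithinAt)
    (fun s _ => (hderiv s).differentiableAt.differentiableWithinAt) fun s hs => ?_
  rw [(hderiv s).deriv]
  exact h.integral_mul_radialWeightDeriv_nonneg hR hball (interior_subset hs)

theorem radialMean_eq_setIntegral {r : ℝ} (hr : 0 < r) (hrR : r ≤ R) :
    radialMean u x R (1 / r ^ 2) =
      ∫ y in Metric.closedBall x r, u y * radialWeight (1 / r ^ 2) (‖y - x‖ ^ 2) := by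
  refine setIntegral_eq_of_subset_of_forall_sdiff_eq_zero measurableSet_closedBall
    (Metric.closedBall_subset_closedBall hrR) fun y hy => ?_
  rw [radialWeight_of_one_le (one_le_mul_norm_sub_sq hr le_rfl hy.2), mul_zero]

theorem exists_radialMean_le_mul_average (hu : IntegrableOn u (Metric.closedBall x R))
    (hu0 : ∀ y, 0 ≤ u y) : ∃ C : ℝ, ∀ r, 0 < r → r ≤ R →
      radialMean u x R (1 / r ^ 2) ≤ C * ⨍ y in Metric.closedBall x r, u y := by
  obtain ⟨C, hC⟩ := exists_abs_deriv_radialProfile_le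
  refine ⟨C * volume.real (Metric.ball (0 : Plane) 1), fun r hr hrR => ?_⟩
  have hur := hu.mono_set (Metric.closedBall_subset_closedBall (x := x) hrR)
  have hweight : ∀ y, radialWeight (1 / r ^ 2) (‖y - x‖ ^ 2) ≤ 1 / r ^ 2 * C := fun y => by
    rw [radialWeight, ← mul_neg]
    exact mul_le_mul_of_nonneg_left ((neg_le_abs _).trans (hC _ (by positivity))) (by positivity)
  have hvol : 0 < volume.real (Metric.ball (0 : Plane) 1) :=
    ENNReal.toReal_pos (Metric.measure_ball_pos volume _ one_pos).ne' measure_ball_lt_top.ne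
  calc radialMean u x R (1 / r ^ 2)
      = ∫ y in Metric.closedBall x r, u y * radialWeight (1 / r ^ 2) (‖y - x‖ ^ 2) :=
        radialMean_eq_setIntegral hr hrR
    _ ≤ ∫ y in Metric.closedBall x r, u y * (1 / r ^ 2 * C) :=
        integral_mono (hur.mul_continuousOn
          ((continuous_radialWeight _).comp (by fun_prop)).continuousOn (isCompact_closedBall x r))
          (hur.mul_const _) fun y => mul_le_mul_of_nonneg_left (hweight y) (hu0 y)
    _ = C * volume.real (Metric.ball (0 : Plane) 1) * ⨍ y in Metric.closedBall x r, u y := by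
        rw [integral_mul_const, setAverage_eq, Measure.addHaar_real_closedBall _ _ hr.le]
        simp only [finrank_euclideanSpace, Fintype.card_fin, smul_eq_mul]
        field_simp

theorem IsWeaklySuperharmonic.radialMean_nonpos_of_tendsto_average
    (h : IsWeaklySuperharmonic Ω u) (hu0 : ∀ y, 0 ≤ u y) (hball : Metric.closedBall x R ⊆ Ω)
    (hx : Tendsto (fun r => ⨍ y in Metric.closedBall x r, u y) (𝓝[>] 0) (𝓝 0)) {r : ℝ}
    (hr : 0 < r) (hrR : r ≤ R) : radialMean u x R (1 / r ^ 2) ≤ 0 := by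
  obtain ⟨C, hC⟩ := exists_radialMean_le_mul_average (h.integrableOn_closedBall hball) hu0
  have hlim := hx.const_mul C
  rw [mul_zero] at hlim
  refine ge_of_tendsto hlim ?_
  filter_upwards [Ioc_mem_nhdsGT hr] with ρ hρ
  have hscale : ∀ {a b : ℝ}, 0 < a → a ≤ b → 1 / b ^ 2 ≤ 1 / a ^ 2 := fun ha hab =>
    one_div_le_one_div_of_le (by positivity) (pow_le_pow_left₀ ha.le hab 2)
  exact (h.monotoneOn_radialMean (hr.trans_le hrR) hball (hscale hr hrR)
    (hscale hρ.1 (hρ.2.trans hrR)) (hscale hρ.1 hρ.2)).trans (hC ρ hρ.1 (hρ.2.trans hrR))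

theorem ae_eq_zero_of_radialMean_eq_zero (hu : IntegrableOn u (Metric.closedBall x R))
    (hu0 : ∀ y, 0 ≤ u y) {r : ℝ} (hr : 0 < r) (hrR : r ≤ R)
    (hzero : radialMean u x R (1 / r ^ 2) = 0) :
    ∀ᵐ y ∂volume.restrict (Metric.ball x r), u y = 0 := by
  have hint : IntegrableOn (fun y => u y * radialWeight (1 / r ^ 2) (‖y - x‖ ^ 2))
      (Metric.closedBall x R) :=
    hu.mul_continuousOn ((continuous_radialWeight _).comp (by fun_prop)).continuousOn
      (isCompact_closedBall x R)
  have hae := (integral_eq_zero_iff_of_nonneg (fun y => mul_nonneg (hu0 y)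
    (radialWeight_nonneg (by positivity) _)) hint).1 hzero
  filter_upwards [ae_restrict_of_ae_restrict_of_subset
    (Metric.ball_subset_closedBall.trans (Metric.closedBall_subset_closedBall hrR)) hae,
    ae_restrict_mem measurableSet_ball] with y hy hyr
  refine (mul_eq_zero.1 hy).resolve_right (radialWeight_pos (by positivity) ?_).ne'
  rw [mem_ball_iff_norm] at hyr
  rw [one_div, ← div_eq_inv_mul, div_lt_one (by positivity)]
  exact pow_lt_pow_left₀ hyr (norm_nonneg _) two_ne_zero

theorem exists_tendsto_average_of_not_ae_pos {B : Set Plane} (hB : IsOpen B)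
    (hu : IntegrableOn u B) (hu0 : ∀ y, 0 ≤ u y)
    (hpos : ¬ ∀ᵐ y ∂volume.restrict B, 0 < u y) :
    ∃ x ∈ B, Tendsto (fun r => ⨍ y in Metric.closedBall x r, u y) (𝓝[>] 0) (𝓝 0) := by
  rw [ae_restrict_iff' hB.measurableSet, not_eventually] at hpos
  have hleb := (Besicovitch.vitaliFamily (volume : Measure Plane)).ae_tendsto_average_norm_sub
    (hu.integrable_indicator hB.measurableSet).locallyIntegrable
  obtain ⟨x, hx, hlim⟩ := (hpos.and_eventually hleb).exists
  obtain ⟨hxB, hux⟩ := Classical.not_imp.1 hx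
  obtain ⟨ε, hε, hεB⟩ := Metric.isOpen_iff.1 hB x hxB
  refine ⟨x, hxB, (hlim.comp (Besicovitch.tendsto_filterAt volume x)).congr' ?_⟩
  filter_upwards [Ioo_mem_nhdsGT hε] with r hr
  refine setAverage_congr_fun measurableSet_closedBall (Eventually.of_forall fun y hy => ?_)
  rw [Set.indicator_of_mem (hεB (Metric.closedBall_subset_ball hr.2 hy)),
    Set.indicator_of_mem hxB, le_antisymm (not_lt.1 hux) (hu0 x), sub_zero,
    Real.norm_of_nonneg (hu0 y)]

theorem IsWeaklySuperharmonic.ae_eq_zero_or_ae_pos_ball (h : IsWeaklySuperharmonic Ω u)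
    (hu0 : ∀ y, 0 ≤ u y) (hR : 0 < R) (hball : Metric.closedBall x (3 * R) ⊆ Ω) :
    (∀ᵐ y ∂volume.restrict (Metric.ball x R), u y = 0) ∨
      ∀ᵐ y ∂volume.restrict (Metric.ball x R), 0 < u y := by
  refine or_iff_not_imp_right.2 fun hpos => ?_
  have hRΩ : Metric.closedBall x R ⊆ Ω :=
    (Metric.closedBall_subset_closedBall (by linarith)).trans hball
  obtain ⟨z, hz, hlim⟩ := exists_tendsto_average_of_not_ae_pos Metric.isOpen_ball
    ((h.integrableOn_closedBall hRΩ).mono_set Metric.ball_subset_closedBall) hu0 hpos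
  rw [Metric.mem_ball] at hz
  have hzΩ : Metric.closedBall z (2 * R) ⊆ Ω :=
    (Metric.closedBall_subset_closedBall' (by linarith)).trans hball
  have hzero := ae_eq_zero_of_radialMean_eq_zero (h.integrableOn_closedBall hzΩ) hu0
    (by positivity) le_rfl (le_antisymm (h.radialMean_nonpos_of_tendsto_average hu0 hzΩ hlim
      (by positivity) le_rfl) (radialMean_nonneg hu0 z _ (by positivity)))
  refine ae_restrict_of_ae_restrict_of_subset (Metric.ball_subset_ball' ?_) hzero
  rw [dist_comm]
  linarith

theorem ae_restrict_sUnion_of_isOpen {X : Type*} [TopologicalSpace X] [SecondCountableTopology X]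
    [MeasurableSpace X] {μ : Measure X} {P : X → Prop} {S : Set (Set X)}
    (hS : ∀ V ∈ S, IsOpen V) (h : ∀ V ∈ S, ∀ᵐ y ∂μ.restrict V, P y) :
    ∀ᵐ y ∂μ.restrict (⋃₀ S), P y := by
  obtain ⟨T, hT, hTS, hcover⟩ := isOpen_sUnion_countable S hS
  rw [← hcover, Set.sUnion_eq_biUnion, ae_restrict_biUnion_iff _ hT]
  exact fun V hV => h V (hTS hV)

/-- The points with a neighbourhood in which `P` holds almost everywhere, and those with a
neighbourhood in which `Q` does, form disjoint open sets. -/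
theorem ae_or_ae_of_isPreconnected {X : Type*} [TopologicalSpace X]
    [SecondCountableTopology X] [MeasurableSpace X] [OpensMeasurableSpace X] {μ : Measure X}
    [μ.IsOpenPosMeasure] {U : Set X} (hU : IsPreconnected U) {P Q : X → Prop}
    (hPQ : ∀ y, P y → ¬ Q y)
    (h : ∀ x ∈ U, ∃ V, IsOpen V ∧ x ∈ V ∧
      ((∀ᵐ y ∂μ.restrict V, P y) ∨ ∀ᵐ y ∂μ.restrict V, Q y)) :
    (∀ᵐ y ∂μ.restrict U, P y) ∨ ∀ᵐ y ∂μ.restrict U, Q y := by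
  let S : (X → Prop) → Set (Set X) := fun P => {V | IsOpen V ∧ ∀ᵐ y ∂μ.restrict V, P y}
  have hopen : ∀ P, IsOpen (⋃₀ S P) := fun P => isOpen_sUnion fun V hV => hV.1
  have hae : ∀ P, U ⊆ ⋃₀ S P → ∀ᵐ y ∂μ.restrict U, P y := fun P hUS =>
    ae_restrict_of_ae_restrict_of_subset hUS
      (ae_restrict_sUnion_of_isOpen (fun V hV => hV.1) fun V hV => hV.2)
  have hcover : U ⊆ ⋃₀ S P ∪ ⋃₀ S Q := fun x hx => by
    obtain ⟨V, hV, hxV, hP | hQ⟩ := h x hx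
    · exact Or.inl ⟨V, ⟨hV, hP⟩, hxV⟩
    · exact Or.inr ⟨V, ⟨hV, hQ⟩, hxV⟩
  have hdisj : U ∩ (⋃₀ S P ∩ ⋃₀ S Q) = ∅ := by
    rw [Set.eq_empty_iff_forall_notMem]
    rintro x ⟨-, ⟨V, ⟨hV, hP⟩, hxV⟩, W, ⟨hW, hQ⟩, hxW⟩
    have hfalse : ∀ᵐ _ ∂μ.restrict (V ∩ W), False := by
      filter_upwards [ae_restrict_of_ae_restrict_of_subset Set.inter_subset_left hP,
        ae_restrict_of_ae_restrict_of_subset Set.inter_subset_right hQ] with y hPy hQy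
      exact hPQ y hPy hQy
    rw [eventually_false_iff_eq_bot, ae_eq_bot, Measure.restrict_eq_zero] at hfalse
    exact ((hV.inter hW).measure_pos μ ⟨x, hxV, hxW⟩).ne' hfalse
  exact (isPreconnected_iff_subset_of_disjoint.1 hU _ _ (hopen P) (hopen Q) hcover hdisj).imp
    (hae P) (hae Q)

theorem IsWeaklySuperharmonic.ae_eq_zero_or_ae_pos (h : IsWeaklySuperharmonic Ω u)
    (hu0 : ∀ y, 0 ≤ u y) (hΩ : IsPreconnected (Ω : Set Plane)) :
    (∀ᵐ y ∂volume.restrict (Ω : Set Plane), u y = 0) ∨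
      ∀ᵐ y ∂volume.restrict (Ω : Set Plane), 0 < u y := by
  refine ae_or_ae_of_isPreconnected hΩ (fun _ hy => hy.not_gt) fun x hx => ?_
  obtain ⟨ε, hε, hεΩ⟩ := Metric.isOpen_iff.1 Ω.isOpen x hx
  exact ⟨Metric.ball x (ε / 4), Metric.isOpen_ball, Metric.mem_ball_self (by positivity),
    h.ae_eq_zero_or_ae_pos_ball hu0 (by positivity)
      ((Metric.closedBall_subset_ball (by linarith)).trans hεΩ)⟩

end StrongMinimum

section Rellich

variable {Ω : Opens Plane}

/-- The Dirichlet energy `∫ |∇φ|²` over the whole plane. -/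
noncomputable def energy (φ : Plane → ℝ) : ℝ := ∫ x, ∑ i, partialD i φ x ^ 2

theorem energy_nonneg (φ : Plane → ℝ) : 0 ≤ energy φ :=
  integral_nonneg fun _ => Finset.sum_nonneg fun _ _ => sq_nonneg _

theorem continuous_partialD_testFunction (φ : 𝓓(Ω, ℝ)) (i : Fin 2) : Continuous (partialD i φ) :=
  (testPartialD i φ).continuous

theorem integrable_mul_testFunctions (φ χ : 𝓓(Ω, ℝ)) (μ : Measure Plane)
    [IsFiniteMeasureOnCompacts μ] : Integrable (fun x => φ x * χ x) μ :=
  (memLp_testFunction φ 2 μ).integrable_mul (memLp_testFunction χ 2 μ)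

theorem integrable_sq_testFunction (φ : 𝓓(Ω, ℝ)) (μ : Measure Plane)
    [IsFiniteMeasureOnCompacts μ] : Integrable (fun x => φ x ^ 2) μ :=
  (memLp_testFunction φ 2 μ).integrable_sq

theorem integrable_sum_partialD_sq (φ : 𝓓(Ω, ℝ)) (μ : Measure Plane)
    [IsFiniteMeasureOnCompacts μ] : Integrable (fun x => ∑ i, partialD i φ x ^ 2) μ :=
  integrable_finsetSum _ fun i _ => integrable_sq_testFunction (testPartialD i φ) μ

theorem fderiv_apply_sq_le (φ : Plane → ℝ) (x z : Plane) :
    fderiv ℝ φ x z ^ 2 ≤ ‖z‖ ^ 2 * ∑ i, partialD i φ x ^ 2 := by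
  have hz : z = ∑ i, z i • EuclideanSpace.single i (1 : ℝ) := by
    ext j
    fin_cases j <;> simp
  have hsum : fderiv ℝ φ x z = ∑ i, z i * partialD i φ x := by
    conv_lhs => rw [hz]
    simp [partialD]
  rw [hsum, EuclideanSpace.norm_sq_eq]
  simp only [Real.norm_eq_abs, sq_abs]
  exact Finset.sum_mul_sq_le_sq_mul_sq _ _ _

theorem sq_setAverage_le {α : Type*} [MeasurableSpace α] {μ : Measure α} {s : Set α}
    (hs₀ : μ s ≠ 0) (hs : μ s ≠ ⊤) {g : α → ℝ} (hg : IntegrableOn g s μ)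
    (hg2 : IntegrableOn (fun x => g x ^ 2) s μ) :
    (⨍ x in s, g x ∂μ) ^ 2 ≤ ⨍ x in s, g x ^ 2 ∂μ :=
  even_two.convexOn_pow.map_set_average_le (continuous_pow 2).continuousOn isClosed_univ hs₀ hs
    (Eventually.of_forall fun _ => Set.mem_univ _) hg hg2

theorem sq_translate_sub_le (φ : 𝓓(Ω, ℝ)) (x z : Plane) :
    (φ (x + z) - φ x) ^ 2 ≤
      ∫ t in Set.Ioc (0 : ℝ) 1, ‖z‖ ^ 2 * ∑ i, partialD i φ (x + t • z) ^ 2 := by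
  have hφ' : Continuous (fderiv ℝ φ) := φ.contDiff.continuous_fderiv (by simp)
  have hcont : Continuous fun t : ℝ => fderiv ℝ φ (x + t • z) z := by fun_prop
  have hpartial := continuous_partialD_testFunction φ
  have hderiv (t : ℝ) :
      HasDerivAt (fun t : ℝ => φ (x + t • z)) (fderiv ℝ φ (x + t • z) z) t :=
    (differentiable_testFunction φ _).hasFDerivAt.comp_hasDerivAt t
      (by simpa using ((hasDerivAt_id t).smul_const z).const_add x)
  have hftc := intervalIntegral.integral_eq_sub_of_hasDerivAt (a := 0) (b := 1)
    (fun t _ => hderiv t) (hcont.intervalIntegrable _ _)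
  have hjensen := sq_setAverage_le (μ := volume) (s := Set.Ioc (0 : ℝ) 1) (by simp) (by simp)
    hcont.integrableOn_Ioc (hcont.pow 2).integrableOn_Ioc
  simp only [setAverage_eq, Real.volume_real_Ioc, sub_zero, max_eq_left zero_le_one, inv_one,
    one_smul] at hjensen
  simp only [one_smul, zero_smul, add_zero] at hftc
  rw [← hftc, intervalIntegral.integral_of_le zero_le_one]
  exact hjensen.trans <| integral_mono (hcont.pow 2).integrableOn_Ioc
    (Continuous.integrableOn_Ioc (by fun_prop)) fun t => fderiv_apply_sq_le _ _ _

theorem lintegral_sq_translate_sub_le (φ : 𝓓(Ω, ℝ)) (z : Plane) :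
    ∫⁻ x, ENNReal.ofReal ((φ (x + z) - φ x) ^ 2) ≤ ENNReal.ofReal (‖z‖ ^ 2 * energy φ) := by
  have hpartial := continuous_partialD_testFunction φ
  set g : Plane → ℝ := fun x => ‖z‖ ^ 2 * ∑ i, partialD i φ x ^ 2 with hg
  have hgcont : Continuous g := by simp only [hg]; fun_prop
  have hg0 : ∀ x, 0 ≤ g x := fun x =>
    mul_nonneg (sq_nonneg _) (Finset.sum_nonneg fun i _ => sq_nonneg _)
  have hgint : Integrable g := (integrable_sum_partialD_sq φ volume).const_mul _
  calc ∫⁻ x, ENNReal.ofReal ((φ (x + z) - φ x) ^ 2)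
      ≤ ∫⁻ x, ∫⁻ t in Set.Ioc (0 : ℝ) 1, ENNReal.ofReal (g (x + t • z)) := by
        refine lintegral_mono fun x => ?_
        have hline : Continuous fun t : ℝ => g (x + t • z) := by fun_prop
        rw [← ofReal_integral_eq_lintegral_ofReal hline.integrableOn_Ioc
          (Eventually.of_forall fun t => hg0 _)]
        exact ENNReal.ofReal_le_ofReal (sq_translate_sub_le φ x z)
    _ = ∫⁻ t in Set.Ioc (0 : ℝ) 1, ∫⁻ x, ENNReal.ofReal (g (x + t • z)) :=
        lintegral_lintegral_swap <| Measurable.aemeasurable <|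
          (Continuous.measurable (by fun_prop)).ennreal_ofReal
    _ = ∫⁻ t in Set.Ioc (0 : ℝ) 1, ∫⁻ x, ENNReal.ofReal (g x) :=
        lintegral_congr fun t => lintegral_add_right_eq_self (fun x => ENNReal.ofReal (g x)) (t • z)
    _ = ENNReal.ofReal (‖z‖ ^ 2 * energy φ) := by
        rw [← ofReal_integral_eq_lintegral_ofReal hgint (Eventually.of_forall hg0)]
        simp [hg, energy, integral_const_mul]

theorem integrable_sq_translate_sub (φ : 𝓓(Ω, ℝ)) (z : Plane) :
    Integrable fun x => (φ (x + z) - φ x) ^ 2 :=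
  (((memLp_testFunction φ 2 volume).comp_measurePreserving
    (measurePreserving_add_right volume z)).sub (memLp_testFunction φ 2 volume)).integrable_sq

theorem integral_sq_translate_sub_le (φ : 𝓓(Ω, ℝ)) (z : Plane) :
    ∫ x, (φ (x + z) - φ x) ^ 2 ≤ ‖z‖ ^ 2 * energy φ := by
  have h := lintegral_sq_translate_sub_le φ z
  rw [← ofReal_integral_eq_lintegral_ofReal (integrable_sq_translate_sub φ z)
    (Eventually.of_forall fun x => sq_nonneg _)] at h
  exact (ENNReal.ofReal_le_ofReal_iff (mul_nonneg (sq_nonneg _) (energy_nonneg _))).1 h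

theorem exists_poincare_const (hb : Bornology.IsBounded (Ω : Set Plane)) :
    ∃ C : ℝ, 0 < C ∧ ∀ φ : 𝓓(Ω, ℝ), ∫ x, φ x ^ 2 ≤ C * energy φ := by
  obtain ⟨ρ, hρ0, hρ⟩ := hb.exists_pos_norm_lt
  -- Translation by `z` moves `Ω` off itself.
  set z : Plane := EuclideanSpace.single 0 (2 * ρ)
  have hz : ‖z‖ = 2 * ρ := by simp [z, abs_of_pos hρ0]
  refine ⟨(2 * ρ) ^ 2, by positivity, fun φ => ?_⟩
  have hdisj : ∀ x, φ (x + z) * φ x = 0 := by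
    intro x
    by_contra hne
    obtain ⟨hxz, hx⟩ := mul_ne_zero_iff.1 hne
    have hxzρ := hρ _ (φ.tsupport_subset (subset_tsupport _ hxz))
    have hxρ := hρ _ (φ.tsupport_subset (subset_tsupport _ hx))
    have htri : ‖z‖ ≤ ‖x + z‖ + ‖x‖ := by simpa using norm_sub_le (x + z) x
    linarith
  rw [← hz]
  refine (integral_mono (integrable_sq_testFunction φ volume) (integrable_sq_translate_sub φ z)
    fun x => ?_).trans (integral_sq_translate_sub_le φ z)
  have := hdisj x
  dsimp only
  nlinarith [sq_nonneg (φ (x + z))]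

/-- `∫ |φ(x + z) - φ(x)|² dz` over the ball `|z| ≤ ρ`. It controls the deviation of `φ x` from the
mean of `φ` over any ball of radius `ρ / 2` that contains `x`. -/
noncomputable def localOscillation (φ : Plane → ℝ) (ρ : ℝ) (x : Plane) : ℝ :=
  ∫ z in Metric.closedBall (0 : Plane) ρ, (φ (x + z) - φ x) ^ 2

theorem integrable_prod_sq_translate_sub (φ : 𝓓(Ω, ℝ)) (ρ : ℝ) :
    Integrable (Function.uncurry fun x z : Plane => (φ (x + z) - φ x) ^ 2)
      (volume.prod (volume.restrict (Metric.closedBall (0 : Plane) ρ))) := by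
  have hφ := φ.continuous
  have hmeas : AEStronglyMeasurable (Function.uncurry fun x z : Plane => (φ (x + z) - φ x) ^ 2)
      (volume.prod (volume.restrict (Metric.closedBall (0 : Plane) ρ))) :=
    Continuous.aestronglyMeasurable (by fun_prop)
  refine (integrable_prod_iff' hmeas).2
    ⟨Eventually.of_forall fun z => integrable_sq_translate_sub φ z, ?_⟩
  have : IsFiniteMeasure (volume.restrict (Metric.closedBall (0 : Plane) ρ)) :=
    isFiniteMeasure_restrict.2 (isCompact_closedBall _ _).measure_lt_top.ne
  refine .of_bound hmeas.norm.prod_swap.integral_prod_right' (ρ ^ 2 * energy φ) ?_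
  filter_upwards [ae_restrict_mem Metric.isClosed_closedBall.measurableSet] with z hz
  rw [Real.norm_of_nonneg (integral_nonneg fun _ => norm_nonneg _)]
  simp only [Function.uncurry_apply_pair, norm_pow, Real.norm_eq_abs, sq_abs]
  exact (integral_sq_translate_sub_le φ z).trans <| mul_le_mul_of_nonneg_right
    (pow_le_pow_left₀ (norm_nonneg _) (mem_closedBall_zero_iff.1 hz) 2) (energy_nonneg _)

theorem integrable_localOscillation (φ : 𝓓(Ω, ℝ)) (ρ : ℝ) :
    Integrable (localOscillation φ ρ) :=
  (integrable_prod_sq_translate_sub φ ρ).integral_prod_left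

theorem integral_localOscillation_le (φ : 𝓓(Ω, ℝ)) (ρ : ℝ) :
    ∫ x, localOscillation φ ρ x ≤
      volume.real (Metric.closedBall (0 : Plane) ρ) * (ρ ^ 2 * energy φ) := by
  have hint := integrable_prod_sq_translate_sub φ ρ
  have hvol : volume (Metric.closedBall (0 : Plane) ρ) ≠ ⊤ :=
    (isCompact_closedBall _ _).measure_lt_top.ne
  calc ∫ x, localOscillation φ ρ x
      = ∫ z in Metric.closedBall (0 : Plane) ρ, ∫ x, (φ (x + z) - φ x) ^ 2 :=
        integral_integral_swap hint
    _ ≤ ∫ _ in Metric.closedBall (0 : Plane) ρ, ρ ^ 2 * energy φ := by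
        refine setIntegral_mono_on hint.integral_prod_right (integrableOn_const hvol)
          Metric.isClosed_closedBall.measurableSet fun z hz => ?_
        exact (integral_sq_translate_sub_le φ z).trans <| mul_le_mul_of_nonneg_right
          (pow_le_pow_left₀ (norm_nonneg _) (mem_closedBall_zero_iff.1 hz) 2) (energy_nonneg _)
    _ = volume.real (Metric.closedBall (0 : Plane) ρ) * (ρ ^ 2 * energy φ) := by
        rw [setIntegral_const, smul_eq_mul]

theorem volume_real_closedBall (c : Plane) (r : ℝ) :
    volume.real (Metric.closedBall c r) = volume.real (Metric.closedBall (0 : Plane) r) := by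
  rw [measureReal_def, measureReal_def, Measure.addHaar_closedBall_center]

theorem volume_real_closedBall_pos (c : Plane) {r : ℝ} (hr : 0 < r) :
    0 < volume.real (Metric.closedBall c r) :=
  ENNReal.toReal_pos (Metric.measure_closedBall_pos volume c hr).ne'
    (isCompact_closedBall c r).measure_lt_top.ne

theorem sq_setAverage_closedBall_le {g : Plane → ℝ} (hg : Continuous g) {r : ℝ} (hr : 0 < r)
    (c : Plane) :
    (⨍ y in Metric.closedBall c r, g y) ^ 2 ≤ ⨍ y in Metric.closedBall c r, g y ^ 2 :=
  have hc := isCompact_closedBall c r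
  sq_setAverage_le (Metric.measure_closedBall_pos volume c hr).ne' hc.measure_lt_top.ne
    (hg.continuousOn.integrableOn_compact hc) ((hg.pow 2).continuousOn.integrableOn_compact hc)

theorem setAverage_closedBall_sub {f g : Plane → ℝ} (hf : Continuous f) (hg : Continuous g)
    (c : Plane) (r : ℝ) :
    ⨍ y in Metric.closedBall c r, (f y - g y) =
      (⨍ y in Metric.closedBall c r, f y) - ⨍ y in Metric.closedBall c r, g y := by
  simp only [setAverage_eq, smul_eq_mul]
  rw [← mul_sub, ← integral_sub (hf.continuousOn.integrableOn_compact (isCompact_closedBall c r))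
    (hg.continuousOn.integrableOn_compact (isCompact_closedBall c r))]

theorem sq_sub_setAverage_le {φ : Plane → ℝ} (hφ : Continuous φ) {r : ℝ} (hr : 0 < r)
    {x c : Plane} (hx : x ∈ Metric.closedBall c r) :
    (φ x - ⨍ y in Metric.closedBall c r, φ y) ^ 2 ≤
      (volume.real (Metric.closedBall (0 : Plane) r))⁻¹ * localOscillation φ (2 * r) x := by
  have hfin : volume (Metric.closedBall c r) ≠ ⊤ := (isCompact_closedBall c r).measure_lt_top.ne
  have hshift : ∫ y in Metric.closedBall c r, (φ x - φ y) ^ 2 ≤ localOscillation φ (2 * r) x := by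
    rw [← (measurePreserving_add_left volume x).setIntegral_preimage_emb
      (measurableEmbedding_addLeft x) (fun y => (φ x - φ y) ^ 2)]
    simp only [localOscillation, sub_sq_comm (φ x)]
    refine setIntegral_mono_set (ContinuousOn.integrableOn_compact (isCompact_closedBall _ _)
      (by fun_prop)) (Eventually.of_forall fun z => sq_nonneg _) ?_
    refine LE.le.eventuallyLE fun z (hz : x + z ∈ Metric.closedBall c r) => ?_
    rw [Metric.mem_closedBall] at hx hz
    rw [mem_closedBall_zero_iff, ← dist_self_add_left z x]
    linarith [dist_triangle_right (x + z) x c]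
  calc (φ x - ⨍ y in Metric.closedBall c r, φ y) ^ 2
      = (⨍ y in Metric.closedBall c r, (φ x - φ y)) ^ 2 := by
        rw [setAverage_closedBall_sub continuous_const hφ,
          setAverage_const (Metric.measure_closedBall_pos volume c hr).ne' hfin]
    _ ≤ ⨍ y in Metric.closedBall c r, (φ x - φ y) ^ 2 :=
        sq_setAverage_closedBall_le (continuous_const.sub hφ) hr c
    _ ≤ (volume.real (Metric.closedBall (0 : Plane) r))⁻¹ * localOscillation φ (2 * r) x := by
        rw [setAverage_eq, volume_real_closedBall, smul_eq_mul]
        exact mul_le_mul_of_nonneg_left hshift (inv_nonneg.2 measureReal_nonneg)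

theorem integral_sq_le_of_setAverage_le (φ : 𝓓(Ω, ℝ)) (hb : Bornology.IsBounded (Ω : Set Plane))
    {r δ : ℝ} (hr : 0 < r) (h : ∀ x ∈ (Ω : Set Plane), ∃ c, x ∈ Metric.closedBall c r ∧
      |⨍ y in Metric.closedBall c r, φ y| ≤ δ) :
    ∫ x in Ω, φ x ^ 2 ≤ 32 * r ^ 2 * energy φ + 2 * δ ^ 2 * volume.real (Ω : Set Plane) := by
  set m := volume.real (Metric.closedBall (0 : Plane) r) with hm
  have hm0 : 0 < m := volume_real_closedBall_pos 0 hr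
  have hm4 : volume.real (Metric.closedBall (0 : Plane) (2 * r)) = 4 * m := by
    rw [hm, Measure.addHaar_real_closedBall _ _ (by positivity),
      Measure.addHaar_real_closedBall _ _ hr.le]
    simp only [finrank_euclideanSpace, Fintype.card_fin]
    ring
  have hosc := integrable_localOscillation φ (2 * r)
  have hδ : IntegrableOn (fun _ : Plane => 2 * δ ^ 2) Ω := integrableOn_const hb.measure_lt_top.ne
  have hpointwise : ∀ x ∈ (Ω : Set Plane),
      φ x ^ 2 ≤ 2 * m⁻¹ * localOscillation φ (2 * r) x + 2 * δ ^ 2 := by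
    intro x hx
    obtain ⟨c, hc, hmean⟩ := h x hx
    have hdev := sq_sub_setAverage_le φ.continuous hr hc
    have hmean2 := sq_le_sq' (abs_le.1 hmean).1 (abs_le.1 hmean).2
    have hsplit := add_sq_le (a := φ x - ⨍ y in Metric.closedBall c r, φ y)
      (b := ⨍ y in Metric.closedBall c r, φ y)
    rw [sub_add_cancel] at hsplit
    linarith
  calc ∫ x in Ω, φ x ^ 2 ≤ ∫ x in Ω, (2 * m⁻¹ * localOscillation φ (2 * r) x + 2 * δ ^ 2) :=
        setIntegral_mono_on (integrable_sq_testFunction φ _)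
          ((hosc.const_mul _).integrableOn.add hδ) Ω.isOpen.measurableSet hpointwise
    _ = 2 * m⁻¹ * (∫ x in Ω, localOscillation φ (2 * r) x) +
          2 * δ ^ 2 * volume.real (Ω : Set Plane) := by
        rw [integral_add (hosc.const_mul _).integrableOn hδ, integral_const_mul, setIntegral_const,
          smul_eq_mul, mul_comm (volume.real _)]
    _ ≤ 2 * m⁻¹ * (4 * m * ((2 * r) ^ 2 * energy φ)) +
          2 * δ ^ 2 * volume.real (Ω : Set Plane) := by
        gcongr
        exact (setIntegral_le_integral hosc (Eventually.of_forall fun x =>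
          integral_nonneg fun _ => sq_nonneg _)).trans
            (hm4 ▸ integral_localOscillation_le φ (2 * r))
    _ = 32 * r ^ 2 * energy φ + 2 * δ ^ 2 * volume.real (Ω : Set Plane) := by
        field_simp
        ring

theorem totallyBounded_image_of_forall_dist_lt {α β : Type*} [PseudoMetricSpace α] {f : β → α}
    {s : Set β} (h : ∀ ε > 0, ∃ (E : Type) (_ : PseudoMetricSpace E) (a : β → E),
      TotallyBounded (a '' s) ∧
        ∃ δ > 0, ∀ x ∈ s, ∀ y ∈ s, dist (a x) (a y) < δ → dist (f x) (f y) < ε) :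
    TotallyBounded (f '' s) := by
  refine Metric.totallyBounded_iff.2 fun ε hε => ?_
  obtain ⟨E, _, a, ha, δ, hδ, hdist⟩ := h ε hε
  obtain ⟨t, hts, htfin, hcover⟩ := Metric.finite_approx_of_totallyBounded ha δ hδ
  obtain ⟨u, hus, hufin, rfl⟩ := Set.exists_subset_image_finite_and.1 ⟨t, hts, htfin, rfl⟩
  refine ⟨f '' u, hufin.image f, ?_⟩
  rintro _ ⟨x, hx, rfl⟩
  obtain ⟨_, ⟨y, hy, rfl⟩, hxy⟩ := Set.mem_iUnion₂.1 (hcover (Set.mem_image_of_mem a hx))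
  exact Set.mem_iUnion₂.2 ⟨f y, Set.mem_image_of_mem f hy, hdist x hx y (hus hy) hxy⟩

theorem inner_toLp_toLp {α : Type*} [MeasurableSpace α] {μ : Measure α} {f g : α → ℝ}
    (hf : MemLp f 2 μ) (hg : MemLp g 2 μ) :
    inner ℝ (hf.toLp f) (hg.toLp g) = ∫ x, f x * g x ∂μ := by
  rw [L2.inner_def]
  refine integral_congr_ae ?_
  filter_upwards [hf.coeFn_toLp, hg.coeFn_toLp] with x hfx hgx
  simp [hfx, hgx, mul_comm]

theorem norm_toLp_sq {α : Type*} [MeasurableSpace α] {μ : Measure α} {f : α → ℝ}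
    (hf : MemLp f 2 μ) : ‖hf.toLp f‖ ^ 2 = ∫ x, f x ^ 2 ∂μ := by
  rw [← real_inner_self_eq_norm_sq, inner_toLp_toLp]
  simp only [sq]

/-- A test function on `Ω` as an element of `L²(Ω)`. -/
noncomputable def testToLp (φ : 𝓓(Ω, ℝ)) : Lp ℝ 2 (volume.restrict (Ω : Set Plane)) :=
  (memLp_testFunction φ 2 _).toLp φ

theorem norm_testToLp_sq (φ : 𝓓(Ω, ℝ)) : ‖testToLp φ‖ ^ 2 = ∫ x in Ω, φ x ^ 2 :=
  norm_toLp_sq _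

theorem testToLp_sub (φ χ : 𝓓(Ω, ℝ)) : testToLp (φ - χ) = testToLp φ - testToLp χ :=
  (memLp_testFunction φ 2 _).toLp_sub (memLp_testFunction χ 2 _)

theorem dist_testToLp_sq (φ χ : 𝓓(Ω, ℝ)) :
    dist (testToLp φ) (testToLp χ) ^ 2 = ∫ x in Ω, (φ - χ) x ^ 2 := by
  rw [dist_eq_norm, ← testToLp_sub, norm_testToLp_sq]

theorem energy_eq_setIntegral (φ : 𝓓(Ω, ℝ)) :
    energy φ = ∫ x in Ω, ∑ i, partialD i φ x ^ 2 := by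
  refine (setIntegral_eq_integral_of_forall_compl_eq_zero fun x hx => ?_).symm
  refine Finset.sum_eq_zero fun i _ => sq_eq_zero_iff.2 ?_
  exact Function.notMem_support.1 fun h =>
    hx (φ.tsupport_subset (support_partialD_subset φ i h))

theorem setIntegral_sq_eq (φ : 𝓓(Ω, ℝ)) : ∫ x in Ω, φ x ^ 2 = ∫ x, φ x ^ 2 := by
  simp only [sq]
  exact setIntegral_mul_eq_integral ((subset_tsupport φ).trans φ.tsupport_subset) φ

theorem partialD_add_smul (φ χ : 𝓓(Ω, ℝ)) (t : ℝ) (i : Fin 2) (x : Plane) :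
    partialD i ⇑(φ + t • χ) x = partialD i φ x + t * partialD i χ x := by
  have hcoe : (⇑(φ + t • χ) : Plane → ℝ) = fun y => φ y + t * χ y := rfl
  rw [hcoe, partialD_add (differentiable_testFunction φ x)
    ((differentiable_testFunction χ x).const_mul t),
    partialD_const_mul (differentiable_testFunction χ x)]

theorem integral_sq_add_smul (φ χ : 𝓓(Ω, ℝ)) (t : ℝ) :
    ∫ x in Ω, (φ + t • χ) x ^ 2 = (∫ x in Ω, φ x ^ 2) + 2 * t * (∫ x in Ω, φ x * χ x) +
      t ^ 2 * ∫ x in Ω, χ x ^ 2 := by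
  have hφ := integrable_sq_testFunction φ (volume.restrict (Ω : Set Plane))
  have hχ := integrable_sq_testFunction χ (volume.restrict (Ω : Set Plane))
  have hφχ := integrable_mul_testFunctions φ χ (volume.restrict (Ω : Set Plane))
  have hsum : Integrable (fun x => φ x ^ 2 + 2 * t * (φ x * χ x))
      (volume.restrict (Ω : Set Plane)) := hφ.add (hφχ.const_mul _)
  rw [← integral_const_mul, ← integral_const_mul, ← integral_add hφ (hφχ.const_mul _),
    ← integral_add hsum (hχ.const_mul _)]
  refine integral_congr_ae (Eventually.of_forall fun x => ?_)
  change (φ x + t * χ x) ^ 2 = _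
  ring

theorem energy_add_smul (φ χ : 𝓓(Ω, ℝ)) (t : ℝ) :
    energy ⇑(φ + t • χ) = energy φ + 2 * t * (∑ i, ∫ x in Ω, partialD i φ x * partialD i χ x) +
      t ^ 2 * energy χ := by
  have hsq (φ : 𝓓(Ω, ℝ)) : energy φ = ∑ i, ∫ x in Ω, testPartialD i φ x ^ 2 := by
    rw [energy_eq_setIntegral]
    exact integral_finsetSum _ fun i _ => integrable_sq_testFunction (testPartialD i φ) _
  have hadd (i : Fin 2) : testPartialD i (φ + t • χ) = testPartialD i φ + t • testPartialD i χ :=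
    DFunLike.ext _ _ (partialD_add_smul φ χ t i)
  simp only [hsq, hadd, integral_sq_add_smul, coe_testPartialD, Finset.sum_add_distrib,
    ← Finset.mul_sum]

theorem sub_eq_add_neg_one_smul (φ χ : 𝓓(Ω, ℝ)) : φ - χ = φ + (-1 : ℝ) • χ := by
  rw [neg_one_smul, sub_eq_add_neg]

theorem energy_sub_add_energy_add (φ χ : 𝓓(Ω, ℝ)) :
    energy ⇑(φ - χ) + energy ⇑(φ + (1 : ℝ) • χ) = 2 * energy φ + 2 * energy χ := by
  rw [sub_eq_add_neg_one_smul, energy_add_smul, energy_add_smul]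
  ring

theorem energy_sub_le (φ χ : 𝓓(Ω, ℝ)) : energy ⇑(φ - χ) ≤ 2 * energy φ + 2 * energy χ := by
  linarith [energy_sub_add_energy_add φ χ, energy_nonneg ⇑(φ + (1 : ℝ) • χ)]

theorem sq_setAverage_testFunction_le (φ : 𝓓(Ω, ℝ)) {r : ℝ} (hr : 0 < r) (c : Plane) :
    (⨍ y in Metric.closedBall c r, φ y) ^ 2 ≤
      (volume.real (Metric.closedBall (0 : Plane) r))⁻¹ * ∫ x in Ω, φ x ^ 2 := by
  refine (sq_setAverage_closedBall_le φ.continuous hr c).trans ?_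
  rw [setAverage_eq, volume_real_closedBall, smul_eq_mul, setIntegral_sq_eq]
  exact mul_le_mul_of_nonneg_left (setIntegral_le_integral (integrable_sq_testFunction φ _)
    (Eventually.of_forall fun x => sq_nonneg _)) (inv_nonneg.2 measureReal_nonneg)

/-- Rellich's theorem for test functions. Two of them are close in `L²` once their means over
finitely many small balls are close, and these means range over a bounded set. -/
theorem totallyBounded_testFunctions (hb : Bornology.IsBounded (Ω : Set Plane)) (M : ℝ) :
    TotallyBounded (testToLp '' {φ : 𝓓(Ω, ℝ) | ∫ x in Ω, φ x ^ 2 ≤ 1 ∧ energy φ ≤ M}) := by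
  refine totallyBounded_image_of_forall_dist_lt fun ε hε => ?_
  have hε2 : 0 < ε ^ 2 / 2 := by positivity
  obtain ⟨p, hp, hpε⟩ := exists_pos_mul_lt hε2 (128 * M)
  obtain ⟨q, hq, hqε⟩ := exists_pos_mul_lt hε2 (2 * volume.real (Ω : Set Plane))
  have hr : 0 < √p := Real.sqrt_pos.2 hp
  obtain ⟨t, htfin, ht⟩ := Metric.totallyBounded_iff.1
    (hb.isCompact_closure.totallyBounded.subset subset_closure) _ hr
  have : Fintype t := htfin.fintype
  refine ⟨t → ℝ, inferInstance, fun φ c => ⨍ y in Metric.closedBall (c : Plane) (√p), φ y, ?_,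
    √q, Real.sqrt_pos.2 hq, ?_⟩
  · set m := volume.real (Metric.closedBall (0 : Plane) (√p))
    refine (isCompact_closedBall (0 : t → ℝ) √m⁻¹).totallyBounded.subset ?_
    rintro _ ⟨φ, ⟨hφ, -⟩, rfl⟩
    rw [mem_closedBall_zero_iff, pi_norm_le_iff_of_nonneg (Real.sqrt_nonneg _)]
    refine fun c => Real.abs_le_sqrt ((sq_setAverage_testFunction_le φ hr c).trans ?_)
    exact mul_le_of_le_one_right (inv_nonneg.2 measureReal_nonneg) hφ
  · rintro φ ⟨-, hφ⟩ χ ⟨-, hχ⟩ hdist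
    have hsmall := integral_sq_le_of_setAverage_le (φ - χ) hb hr (δ := √q) fun x hx => by
      obtain ⟨c, hc, hxc⟩ := Set.mem_iUnion₂.1 (ht hx)
      refine ⟨c, Metric.ball_subset_closedBall hxc, ?_⟩
      refine le_trans (le_of_eq ?_) ((dist_le_pi_dist _ _ (⟨c, hc⟩ : t)).trans hdist.le)
      rw [Real.dist_eq, ← setAverage_closedBall_sub φ.continuous χ.continuous]
      rfl
    rw [Real.sq_sqrt hp.le, Real.sq_sqrt hq.le, ← dist_testToLp_sq] at hsmall
    have henergy : 32 * p * energy ⇑(φ - χ) ≤ 32 * p * (4 * M) :=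
      mul_le_mul_of_nonneg_left (by linarith [energy_sub_le φ χ]) (by positivity)
    exact lt_of_pow_lt_pow_left₀ 2 hε.le (by linarith)

end Rellich

section Rayleigh

variable {Ω : Opens Plane}

/-- The infimum of the Rayleigh quotient over the test functions on `Ω`, which are normalized in
`L²`; it is attained in `H₀¹(Ω)`, see `isDirichletEigenvalue_rayleighInf`. -/
noncomputable def rayleighInf (Ω : Opens Plane) : ℝ :=
  sInf {q : ℝ | ∃ φ : 𝓓(Ω, ℝ), ∫ x in Ω, φ x ^ 2 = 1 ∧ energy φ = q}

theorem bddBelow_rayleigh (Ω : Opens Plane) :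
    BddBelow {q : ℝ | ∃ φ : 𝓓(Ω, ℝ), ∫ x in Ω, φ x ^ 2 = 1 ∧ energy φ = q} :=
  ⟨0, by rintro q ⟨φ, -, rfl⟩; exact energy_nonneg _⟩

theorem integral_sq_smul (c : ℝ) (φ : 𝓓(Ω, ℝ)) :
    ∫ x in Ω, (c • φ) x ^ 2 = c ^ 2 * ∫ x in Ω, φ x ^ 2 := by
  rw [← integral_const_mul]
  exact integral_congr_ae (Eventually.of_forall fun x => mul_pow c (φ x) 2)

theorem energy_smul (c : ℝ) (φ : 𝓓(Ω, ℝ)) : energy ⇑(c • φ) = c ^ 2 * energy φ := by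
  have hpartial (i : Fin 2) (x : Plane) : partialD i ⇑(c • φ) x = c * partialD i φ x :=
    partialD_const_mul (differentiable_testFunction φ x) c i
  simp only [energy, hpartial, mul_pow, ← Finset.mul_sum, integral_const_mul]

theorem exists_normalized (φ : 𝓓(Ω, ℝ)) (h : 0 < ∫ x in Ω, φ x ^ 2) :
    ∃ χ : 𝓓(Ω, ℝ), ∫ x in Ω, χ x ^ 2 = 1 ∧ energy χ = energy φ / ∫ x in Ω, φ x ^ 2 := by
  refine ⟨(√(∫ x in Ω, φ x ^ 2))⁻¹ • φ, ?_, ?_⟩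
  · rw [integral_sq_smul, inv_pow, Real.sq_sqrt h.le, inv_mul_cancel₀ h.ne']
  · rw [energy_smul, inv_pow, Real.sq_sqrt h.le, inv_mul_eq_div]

theorem rayleighInf_mul_le (φ : 𝓓(Ω, ℝ)) : rayleighInf Ω * ∫ x in Ω, φ x ^ 2 ≤ energy φ := by
  have h0 : 0 ≤ ∫ x in Ω, φ x ^ 2 := integral_nonneg fun x => sq_nonneg _
  rcases h0.eq_or_lt with h | h
  · rw [← h, mul_zero]
    exact energy_nonneg _
  · obtain ⟨χ, hχ, hEχ⟩ := exists_normalized φ h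
    rw [← le_div_iff₀ h]
    exact csInf_le (bddBelow_rayleigh Ω) ⟨χ, hχ, hEχ⟩

theorem inner_testToLp (U : Lp ℝ 2 (volume.restrict (Ω : Set Plane))) (χ : 𝓓(Ω, ℝ)) :
    inner ℝ U (testToLp χ) = ∫ x in Ω, U x * χ x := by
  rw [testToLp, ← inner_toLp_toLp (Lp.memLp U), Lp.toLp_coeFn]

theorem tendsto_integral_mul_testFunction {φ : ℕ → 𝓓(Ω, ℝ)}
    {U : Lp ℝ 2 (volume.restrict (Ω : Set Plane))}
    (hU : Tendsto (fun n => testToLp (φ n)) atTop (𝓝 U)) (χ : 𝓓(Ω, ℝ)) :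
    Tendsto (fun n => ∫ x in Ω, φ n x * χ x) atTop (𝓝 (∫ x in Ω, U x * χ x)) := by
  rw [← inner_testToLp]
  exact (hU.inner tendsto_const_nhds).congr fun n => inner_toLp_toLp _ _

theorem tendsto_eLpNorm_of_tendsto_testToLp {φ : ℕ → 𝓓(Ω, ℝ)}
    {U : Lp ℝ 2 (volume.restrict (Ω : Set Plane))}
    (hU : Tendsto (fun n => testToLp (φ n)) atTop (𝓝 U)) :
    Tendsto (fun n => eLpNorm (fun x => φ n x - U x) 2 (volume.restrict (Ω : Set Plane))) atTop
      (𝓝 0) := by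
  rw [Lp.tendsto_Lp_iff_tendsto_eLpNorm'] at hU
  refine hU.congr fun n => eLpNorm_congr_ae ?_
  filter_upwards [(memLp_testFunction (φ n) 2 (volume.restrict (Ω : Set Plane))).coeFn_toLp]
    with x hx
  simp [testToLp, hx]

theorem hasWeakPartial_of_tendsto_testToLp {φ : ℕ → 𝓓(Ω, ℝ)} {i : Fin 2}
    {U g : Lp ℝ 2 (volume.restrict (Ω : Set Plane))}
    (hU : Tendsto (fun n => testToLp (φ n)) atTop (𝓝 U))
    (hg : Tendsto (fun n => testToLp (testPartialD i (φ n))) atTop (𝓝 g)) :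
    HasWeakPartial Ω i U g := by
  refine ⟨locallyIntegrableOn_of_memLp one_le_two (Lp.memLp U),
    locallyIntegrableOn_of_memLp one_le_two (Lp.memLp g), fun χ => ?_⟩
  refine tendsto_nhds_unique (tendsto_integral_mul_testFunction hU (testPartialD i χ))
    ((tendsto_integral_mul_testFunction hg χ).neg.congr fun n => ?_)
  rw [coe_testPartialD, coe_testPartialD,
    setIntegral_mul_eq_integral ((subset_tsupport χ).trans χ.tsupport_subset),
    setIntegral_mul_eq_integral ((support_partialD_subset χ i).trans χ.tsupport_subset),
    integral_mul_partialD χ ((φ n).contDiff.of_le (by simp))]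

theorem dist_testToLp_partialD_sq_le (φ χ : 𝓓(Ω, ℝ)) (i : Fin 2) :
    dist (testToLp (testPartialD i φ)) (testToLp (testPartialD i χ)) ^ 2 ≤ energy ⇑(φ - χ) := by
  have hsub : testPartialD i φ - testPartialD i χ = testPartialD i (φ - χ) := by
    rw [sub_eq_add_neg_one_smul, sub_eq_add_neg_one_smul φ]
    exact (DFunLike.ext _ _ (partialD_add_smul φ χ (-1) i)).symm
  rw [dist_testToLp_sq, hsub, energy_eq_setIntegral]
  exact integral_mono (integrable_sq_testFunction _ _) (integrable_sum_partialD_sq _ _) fun x =>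
    Finset.single_le_sum (f := fun j => partialD j ⇑(φ - χ) x ^ 2)
      (fun j _ => sq_nonneg _) (Finset.mem_univ i)

/-- A sequence of `L²`-normalized test functions along which the Dirichlet energy tends to the
infimum of the Rayleigh quotient. -/
structure IsMinimizingSeq (φ : ℕ → 𝓓(Ω, ℝ)) : Prop where
  integral_sq : ∀ n, ∫ x in Ω, φ n x ^ 2 = 1
  tendsto_energy : Tendsto (fun n => energy (φ n)) atTop (𝓝 (rayleighInf Ω))

theorem exists_isMinimizingSeq_tendsto (hb : Bornology.IsBounded (Ω : Set Plane))
    {φ₀ : 𝓓(Ω, ℝ)} (hφ₀ : 0 < ∫ x in Ω, φ₀ x ^ 2) :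
    ∃ (φ : ℕ → 𝓓(Ω, ℝ)) (U : Lp ℝ 2 (volume.restrict (Ω : Set Plane))),
      IsMinimizingSeq φ ∧ Tendsto (fun n => testToLp (φ n)) atTop (𝓝 U) := by
  obtain ⟨χ₀, hχ₀, -⟩ := exists_normalized φ₀ hφ₀
  obtain ⟨q, hq_anti, hq, hmem⟩ := exists_seq_tendsto_sInf
    (S := {q : ℝ | ∃ φ : 𝓓(Ω, ℝ), ∫ x in Ω, φ x ^ 2 = 1 ∧ energy φ = q}) ⟨_, χ₀, hχ₀, rfl⟩
    (bddBelow_rayleigh Ω)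
  choose φ hφ hEφ using hmem
  have hcompact :=
    (totallyBounded_testFunctions hb (q 0)).closure.isCompact_of_isClosed isClosed_closure
  obtain ⟨U, -, ns, hns, hU⟩ := hcompact.tendsto_subseq (x := fun n => testToLp (φ n)) fun n =>
    subset_closure ⟨φ n, ⟨(hφ n).le, (hEφ n).trans_le (hq_anti (Nat.zero_le n))⟩, rfl⟩
  refine ⟨φ ∘ ns, U, ⟨fun n => hφ (ns n), ?_⟩, hU⟩
  exact (hq.comp hns.tendsto_atTop).congr fun n => (hEφ (ns n)).symm

-- The parallelogram identity, with `φ n + φ k` as a competitor in the Rayleigh quotient.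
theorem IsMinimizingSeq.energy_sub_le {φ : ℕ → 𝓓(Ω, ℝ)} (h : IsMinimizingSeq φ) (n k : ℕ) :
    energy ⇑(φ n - φ k) ≤ 2 * energy (φ n) + 2 * energy (φ k) - 4 * rayleighInf Ω +
      rayleighInf Ω * dist (testToLp (φ n)) (testToLp (φ k)) ^ 2 := by
  have henergy := energy_sub_add_energy_add (φ n) (φ k)
  have hray := rayleighInf_mul_le (φ n + (1 : ℝ) • φ k)
  have hsub := integral_sq_add_smul (φ n) (φ k) (-1)
  have hadd := integral_sq_add_smul (φ n) (φ k) 1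
  rw [← sub_eq_add_neg_one_smul, h.integral_sq, h.integral_sq] at hsub
  rw [h.integral_sq, h.integral_sq] at hadd
  have hsum : ∫ x in Ω, (φ n + (1 : ℝ) • φ k) x ^ 2 = 4 - ∫ x in Ω, (φ n - φ k) x ^ 2 := by
    linarith
  rw [hsum] at hray
  rw [dist_testToLp_sq]
  linarith

theorem IsMinimizingSeq.cauchySeq_partialD {φ : ℕ → 𝓓(Ω, ℝ)} (h : IsMinimizingSeq φ)
    (hφ : CauchySeq fun n => testToLp (φ n)) (i : Fin 2) :
    CauchySeq fun n => testToLp (testPartialD i (φ n)) := by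
  rw [cauchySeq_iff_tendsto_dist_atTop_0] at hφ ⊢
  have hfst : Tendsto (fun p : ℕ × ℕ => energy (φ p.1)) atTop (𝓝 (rayleighInf Ω)) := by
    rw [← prod_atTop_atTop_eq]
    exact h.tendsto_energy.comp tendsto_fst
  have hsnd : Tendsto (fun p : ℕ × ℕ => energy (φ p.2)) atTop (𝓝 (rayleighInf Ω)) := by
    rw [← prod_atTop_atTop_eq]
    exact h.tendsto_energy.comp tendsto_snd
  have hlim := ((((hfst.const_mul 2).add (hsnd.const_mul 2)).sub_const (4 * rayleighInf Ω)).add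
    ((hφ.pow 2).const_mul (rayleighInf Ω))).sqrt
  rw [show 2 * rayleighInf Ω + 2 * rayleighInf Ω - 4 * rayleighInf Ω + rayleighInf Ω * 0 ^ 2 = 0
    by ring, Real.sqrt_zero] at hlim
  exact squeeze_zero (fun _ => dist_nonneg) (fun p => Real.le_sqrt_of_sq_le
    ((dist_testToLp_partialD_sq_le _ _ i).trans (h.energy_sub_le p.1 p.2))) hlim

theorem eq_zero_of_forall_quadratic_nonneg {a c : ℝ} (h : ∀ t : ℝ, 0 ≤ 2 * t * a + t ^ 2 * c) :
    a = 0 := by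
  have hdiscrim := discrim_le_zero (a := c) (b := 2 * a) (c := 0) fun t => by linarith [h t]
  rw [discrim] at hdiscrim
  nlinarith

/-- The Euler–Lagrange equation of the Rayleigh quotient. -/
theorem IsMinimizingSeq.sum_integral_partialD {φ : ℕ → 𝓓(Ω, ℝ)} (h : IsMinimizingSeq φ)
    {U : Lp ℝ 2 (volume.restrict (Ω : Set Plane))}
    {g : Fin 2 → Lp ℝ 2 (volume.restrict (Ω : Set Plane))}
    (hU : Tendsto (fun n => testToLp (φ n)) atTop (𝓝 U))
    (hg : ∀ i, Tendsto (fun n => testToLp (testPartialD i (φ n))) atTop (𝓝 (g i)))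
    (χ : 𝓓(Ω, ℝ)) :
    ∑ i, ∫ x in Ω, g i x * partialD i χ x = rayleighInf Ω * ∫ x in Ω, U x * χ x := by
  set m := rayleighInf Ω
  suffices hquad : ∀ t : ℝ, 0 ≤ 2 * t * ((∑ i, ∫ x in Ω, g i x * partialD i χ x) -
      m * ∫ x in Ω, U x * χ x) + t ^ 2 * (energy χ - m * ∫ x in Ω, χ x ^ 2) from
    sub_eq_zero.1 (eq_zero_of_forall_quadratic_nonneg hquad)
  intro t
  have hle (n : ℕ) : m * (1 + 2 * t * (∫ x in Ω, φ n x * χ x) + t ^ 2 * ∫ x in Ω, χ x ^ 2) ≤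
      energy (φ n) + 2 * t * (∑ i, ∫ x in Ω, partialD i (φ n) x * partialD i χ x) +
        t ^ 2 * energy χ := by
    simpa only [energy_add_smul, integral_sq_add_smul, h.integral_sq] using
      rayleighInf_mul_le (φ n + t • χ)
  have hlim_mass : Tendsto
      (fun n => m * (1 + 2 * t * (∫ x in Ω, φ n x * χ x) + t ^ 2 * ∫ x in Ω, χ x ^ 2)) atTop
      (𝓝 (m * (1 + 2 * t * (∫ x in Ω, U x * χ x) + t ^ 2 * ∫ x in Ω, χ x ^ 2))) :=
    ((((tendsto_integral_mul_testFunction hU χ).const_mul _).const_add _).add_const _).const_mul _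
  have hlim_energy : Tendsto (fun n => energy (φ n) +
      2 * t * (∑ i, ∫ x in Ω, partialD i (φ n) x * partialD i χ x) + t ^ 2 * energy χ) atTop
      (𝓝 (m + 2 * t * (∑ i, ∫ x in Ω, g i x * partialD i χ x) + t ^ 2 * energy χ)) :=
    (h.tendsto_energy.add ((tendsto_finsetSum _ fun i _ =>
      tendsto_integral_mul_testFunction (hg i) (testPartialD i χ)).const_mul _)).add_const _
  linarith [le_of_tendsto_of_tendsto' hlim_mass hlim_energy hle]

theorem HasWeakGradient.hasWeakLaplacian {u w : Plane → ℝ} {G : Plane → Plane}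
    (hG : HasWeakGradient Ω u G) (hw : LocallyIntegrableOn w Ω)
    (h : ∀ χ : 𝓓(Ω, ℝ), ∑ i, ∫ x in Ω, G x i * partialD i χ x = -∫ x in Ω, w x * χ x) :
    HasWeakLaplacian Ω u w := by
  refine ⟨(hG 0).1, hw, fun χ => ?_⟩
  have hint (i : Fin 2) : Integrable (fun x => u x * partialD i (partialD i χ) x)
      (volume.restrict (Ω : Set Plane)) :=
    integrable_mul_testFunction (hG 0).1 (testPartialD i (testPartialD i χ))
  simp only [Finset.mul_sum]
  rw [integral_finsetSum _ fun i _ => hint i, ← neg_neg (∫ x in Ω, w x * χ x), ← h,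
    ← Finset.sum_neg_distrib]
  exact Finset.sum_congr rfl fun i _ => (hG i).2.2 (testPartialD i χ)

theorem memH10_of_tendsto_testToLp {φ : ℕ → 𝓓(Ω, ℝ)}
    {U : Lp ℝ 2 (volume.restrict (Ω : Set Plane))}
    {g : Fin 2 → Lp ℝ 2 (volume.restrict (Ω : Set Plane))}
    (hU : Tendsto (fun n => testToLp (φ n)) atTop (𝓝 U))
    (hg : ∀ i, Tendsto (fun n => testToLp (testPartialD i (φ n))) atTop (𝓝 (g i))) :
    MemH10 Ω U := by
  refine ⟨Lp.memLp U, fun x => WithLp.toLp 2 fun i => g i x,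
    fun i => hasWeakPartial_of_tendsto_testToLp hU (hg i), fun i => Lp.memLp (g i), φ,
    tendsto_eLpNorm_of_tendsto_testToLp hU, fun i => ?_⟩
  simpa only [coe_testPartialD] using tendsto_eLpNorm_of_tendsto_testToLp (hg i)

theorem IsMinimizingSeq.not_ae_eq_zero {φ : ℕ → 𝓓(Ω, ℝ)} (h : IsMinimizingSeq φ)
    {U : Lp ℝ 2 (volume.restrict (Ω : Set Plane))}
    (hU : Tendsto (fun n => testToLp (φ n)) atTop (𝓝 U)) :
    ¬ ∀ᵐ x ∂(volume.restrict (Ω : Set Plane)), U x = 0 := by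
  intro hzero
  have hU0 : U = 0 := by
    refine Lp.ext ?_
    filter_upwards [hzero, Lp.coeFn_zero ℝ 2 (volume.restrict (Ω : Set Plane))] with x hx h0
    rw [hx, h0, Pi.zero_apply]
  have hnorm : Tendsto (fun _ : ℕ => (1 : ℝ)) atTop (𝓝 (‖U‖ ^ 2)) :=
    (hU.norm.pow 2).congr fun n => by rw [norm_testToLp_sq, h.integral_sq]
  rw [hU0, norm_zero, zero_pow two_ne_zero] at hnorm
  exact one_ne_zero (tendsto_nhds_unique tendsto_const_nhds hnorm)

theorem IsMinimizingSeq.hasWeakLaplacian {φ : ℕ → 𝓓(Ω, ℝ)} (h : IsMinimizingSeq φ)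
    {U : Lp ℝ 2 (volume.restrict (Ω : Set Plane))}
    {g : Fin 2 → Lp ℝ 2 (volume.restrict (Ω : Set Plane))}
    (hU : Tendsto (fun n => testToLp (φ n)) atTop (𝓝 U))
    (hg : ∀ i, Tendsto (fun n => testToLp (testPartialD i (φ n))) atTop (𝓝 (g i))) :
    HasWeakLaplacian Ω U fun x => -rayleighInf Ω * U x := by
  have hG : HasWeakGradient Ω U fun x => WithLp.toLp 2 fun i => g i x := fun i =>
    hasWeakPartial_of_tendsto_testToLp hU (hg i)
  refine hG.hasWeakLaplacian
    (locallyIntegrableOn_of_memLp one_le_two ((Lp.memLp U).const_mul _)) fun χ => ?_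
  simp only [mul_assoc, integral_const_mul, neg_mul, integral_neg, neg_neg]
  exact h.sum_integral_partialD hU hg χ

theorem isDirichletEigenvalue_rayleighInf (hb : Bornology.IsBounded (Ω : Set Plane))
    {φ₀ : 𝓓(Ω, ℝ)} (hφ₀ : 0 < ∫ x in Ω, φ₀ x ^ 2) : IsDirichletEigenvalue Ω (rayleighInf Ω) := by
  obtain ⟨φ, U, hφ, hU⟩ := exists_isMinimizingSeq_tendsto hb hφ₀
  choose g hg using fun i => cauchySeq_tendsto_of_complete (hφ.cauchySeq_partialD hU.cauchySeq i)
  exact ⟨U, memH10_of_tendsto_testToLp hU hg, hφ.not_ae_eq_zero hU, hφ.hasWeakLaplacian hU hg⟩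

end Rayleigh

section Composition

theorem tendsto_eLpNorm_one_sq_sub_sq {α : Type*} [MeasurableSpace α] {μ : Measure α}
    {f : ℕ → α → ℝ} {f₀ : α → ℝ} (hf : ∀ n, AEStronglyMeasurable (f n) μ) (hf₀ : MemLp f₀ 2 μ)
    (hL : Tendsto (fun n => eLpNorm (fun x => f n x - f₀ x) 2 μ) atTop (𝓝 0)) :
    Tendsto (fun n => eLpNorm (fun x => f n x ^ 2 - f₀ x ^ 2) 1 μ) atTop (𝓝 0) := by
  have hbound (n : ℕ) : eLpNorm (fun x => f n x ^ 2 - f₀ x ^ 2) 1 μ ≤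
      eLpNorm (fun x => f n x - f₀ x) 2 μ *
        (eLpNorm (fun x => f n x - f₀ x) 2 μ + eLpNorm (fun x => 2 * f₀ x) 2 μ) := by
    have hsub : AEStronglyMeasurable (fun x => f n x - f₀ x) μ := (hf n).sub hf₀.1
    have htwo : AEStronglyMeasurable (fun x => 2 * f₀ x) μ := hf₀.1.const_mul 2
    have hfactor : (fun x => f n x ^ 2 - f₀ x ^ 2) =
        (fun x => f n x - f₀ x) • ((fun x => f n x - f₀ x) + fun x => 2 * f₀ x) := by
      ext x
      simp only [Pi.smul_apply', Pi.add_apply, smul_eq_mul]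
      ring
    rw [hfactor]
    calc _ ≤ eLpNorm (fun x => f n x - f₀ x) 2 μ *
          eLpNorm ((fun x => f n x - f₀ x) + fun x => 2 * f₀ x) 2 μ :=
        eLpNorm_smul_le_mul_eLpNorm (hsub.add htwo) hsub
      _ ≤ _ := by gcongr; exact eLpNorm_add_le hsub htwo one_le_two
  have htwo_ne_top : eLpNorm (fun x => 2 * f₀ x) 2 μ ≠ ∞ := (hf₀.const_mul 2).2.ne
  have hlim := ENNReal.Tendsto.mul hL (Or.inr (by simpa using htwo_ne_top))
    (hL.add_const (eLpNorm (fun x => 2 * f₀ x) 2 μ)) (Or.inr (by simp))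
  rw [zero_mul] at hlim
  exact tendsto_of_tendsto_of_tendsto_of_le_of_le tendsto_const_nhds hlim (fun _ => zero_le) hbound

variable {Ω : Opens Plane} {u w : Plane → ℝ} {G : Plane → Plane} {φ : ℕ → 𝓓(Ω, ℝ)}
  {h : ℝ → ℝ} {M : ℝ}

theorem H10Approx.memLp_comp (H : H10Approx Ω u G φ) (hh : Differentiable ℝ h) (h0 : h 0 = 0)
    (hM : ∀ s, |deriv h s| ≤ M) :
    MemLp (fun x => h (u x)) 2 (volume.restrict (Ω : Set Plane)) := by
  refine (H.memLp.const_mul M).mono (hh.continuous.comp_aestronglyMeasurable H.memLp.1)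
    (Eventually.of_forall fun x => (abs_le_mul_abs_of_abs_deriv_le hh hM h0 (u x)).trans ?_)
  rw [norm_mul]
  exact mul_le_mul_of_nonneg_right (le_abs_self M) (abs_nonneg _)

theorem H10Approx.tendsto_comp (H : H10Approx Ω u G φ) (hh : Differentiable ℝ h)
    (hM : ∀ s, |deriv h s| ≤ M) :
    Tendsto (fun n => eLpNorm (fun x => h (φ n x) - h (u x)) 2 (volume.restrict (Ω : Set Plane)))
      atTop (𝓝 0) := by
  have hlim := ENNReal.Tendsto.const_mul H.tendsto (Or.inr (ENNReal.ofReal_ne_top (r := M)))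
  rw [mul_zero] at hlim
  exact tendsto_of_tendsto_of_tendsto_of_le_of_le tendsto_const_nhds hlim (fun _ => zero_le)
    fun n => eLpNorm_le_mul_eLpNorm_of_ae_le_mul (Eventually.of_forall fun x =>
      abs_sub_le_mul_abs_sub_of_abs_deriv_le hh hM _ _) 2

theorem H10Approx.tendsto_integral_comp_sq (H : H10Approx Ω u G φ) (hh : ContDiff ℝ (⊤ : ℕ∞) h)
    (h0 : h 0 = 0) (hM : ∀ s, |deriv h s| ≤ M) :
    Tendsto (fun n => ∫ x in Ω, testComp (φ n) h hh h0 x ^ 2) atTop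
      (𝓝 (∫ x in Ω, h (u x) ^ 2)) := by
  have hd : Differentiable ℝ h := hh.differentiable (by simp)
  exact tendsto_integral_of_L1' _ ((H.memLp_comp hd h0 hM).1.pow 2)
    (Eventually.of_forall fun n => integrable_sq_testFunction _ _)
    (tendsto_eLpNorm_one_sq_sub_sq
      (fun n => (testComp (φ n) h hh h0).continuous.aestronglyMeasurable) (H.memLp_comp hd h0 hM)
      (H.tendsto_comp hd hM))

theorem H10Approx.tendsto_energy_comp (H : H10Approx Ω u G φ) (hh : ContDiff ℝ (⊤ : ℕ∞) h)
    (h0 : h 0 = 0) (hM : ∀ s, |deriv h s| ≤ M) :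
    Tendsto (fun n => energy (testComp (φ n) h hh h0)) atTop
      (𝓝 (∑ i, ∫ x in Ω, deriv h (u x) ^ 2 * G x i ^ 2)) := by
  have hcont : Continuous (deriv h) := hh.continuous_deriv (by simp)
  have henergy (n : ℕ) : energy (testComp (φ n) h hh h0) =
      ∑ i, ∫ x in Ω, deriv h (φ n x) ^ 2 * partialD i (φ n) x ^ 2 := by
    have hint (i : Fin 2) : Integrable (fun x => partialD i (testComp (φ n) h hh h0) x ^ 2)
        (volume.restrict (Ω : Set Plane)) :=
      integrable_sq_testFunction (testPartialD i (testComp (φ n) h hh h0)) _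
    rw [energy_eq_setIntegral, integral_finsetSum _ fun i _ => hint i]
    simp only [coe_testComp, partialD_comp (hh.differentiable (by simp) _)
      (differentiable_testFunction _ _), mul_pow]
  simp only [henergy]
  refine tendsto_finsetSum _ fun i _ => tendsto_integral_bdd_mul_L1 (M := M ^ 2)
    (fun n => ((hcont.comp (φ n).continuous).pow 2).aestronglyMeasurable) (fun n x => ?_)
    (H.ae_tendsto.mono fun x hx => ((hcont.tendsto _).comp hx).pow 2)
    (fun n => integrable_sq_testFunction (testPartialD i (φ n)) _) (H.memLp_grad i).integrable_sq
    (tendsto_eLpNorm_one_sq_sub_sq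
      (fun n => (testPartialD i (φ n)).continuous.aestronglyMeasurable) (H.memLp_grad i)
      (H.tendsto_grad i))
  rw [abs_pow]
  exact pow_le_pow_left₀ (abs_nonneg _) (hM _) 2

theorem H10Approx.mul_integral_comp_sq_le (H : H10Approx Ω u G φ) {K : ℝ}
    (hK : ∀ χ : 𝓓(Ω, ℝ), K * ∫ x in Ω, χ x ^ 2 ≤ energy χ) (hh : ContDiff ℝ (⊤ : ℕ∞) h)
    (h0 : h 0 = 0) (hM : ∀ s, |deriv h s| ≤ M) :
    K * ∫ x in Ω, h (u x) ^ 2 ≤ ∑ i, ∫ x in Ω, deriv h (u x) ^ 2 * G x i ^ 2 :=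
  le_of_tendsto_of_tendsto' ((H.tendsto_integral_comp_sq hh h0 hM).const_mul K)
    (H.tendsto_energy_comp hh h0 hM) fun _ => hK _

theorem H10Approx.integral_deriv_comp_mul_sq (H : H10Approx Ω u G φ) (hw : HasWeakLaplacian Ω u w)
    (hw2 : MemLp w 2 (volume.restrict (Ω : Set Plane))) (hh : ContDiff ℝ (⊤ : ℕ∞) h)
    (h0 : h 0 = 0) (hM : ∀ s, |deriv h s| ≤ M) :
    ∫ x in Ω, deriv h (u x) * ∑ i, G x i * G x i = -∫ x in Ω, h (u x) * w x := by
  have hd : Differentiable ℝ h := hh.differentiable (by simp)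
  have hu : MemLp (fun x => h (u x)) 2 (volume.restrict (Ω : Set Plane)) := H.memLp_comp hd h0 hM
  have hφ (n : ℕ) : MemLp (testComp (φ n) h hh h0) 2 (volume.restrict (Ω : Set Plane)) :=
    memLp_testFunction _ _ _
  have hgrad := H.tendsto_integral_gradient_comp (a := 1) aestronglyMeasurable_const (A := 1)
    (by simp) hh h0 hM
  have hlap : Tendsto (fun n => ∫ x in Ω, testComp (φ n) h hh h0 x * w x) atTop
      (𝓝 (∫ x in Ω, h (u x) * w x)) :=
    tendsto_integral_of_L1' _ (hu.1.mul hw2.1)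
      (Eventually.of_forall fun n => (hφ n).integrable_mul hw2)
      (tendsto_eLpNorm_one_mul (fun n => (hφ n).1.sub hu.1) hw2 (H.tendsto_comp hd hM))
  simp only [Pi.one_apply, one_mul, hw.integral_gradient H.grad, mul_comm (w _)] at hgrad
  exact tendsto_nhds_unique hgrad hlap.neg

end Composition

section FirstEigenvalue

variable {Ω : Opens Plane} {u w : Plane → ℝ} {G : Plane → Plane} {φ : ℕ → 𝓓(Ω, ℝ)}

theorem IsDirichletEigenvalue.nonneg {ν : ℝ} (h : IsDirichletEigenvalue Ω ν) : 0 ≤ ν := by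
  obtain ⟨u, hu, hne, hw⟩ := h
  obtain ⟨G, φ, H⟩ := hu.exists_approx
  have hGreen := H.integral_deriv_comp_mul_sq hw (H.memLp.const_mul _) (h := id) (M := 1)
    contDiff_id rfl (by simp)
  have henergy : 0 ≤ ∫ x in Ω, deriv id (u x) * ∑ i, G x i * G x i :=
    integral_nonneg fun x =>
      mul_nonneg (by simp) (Finset.sum_nonneg fun i _ => mul_self_nonneg (G x i))
  have hmass : -∫ x in Ω, id (u x) * (-ν * u x) = ν * ∫ x in Ω, u x ^ 2 := by
    rw [← integral_neg, ← integral_const_mul]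
    congr with x
    simp only [id]
    ring
  rw [hGreen, hmass] at henergy
  refine nonneg_of_mul_nonneg_left henergy <|
    (integral_nonneg fun x => sq_nonneg (u x)).lt_of_ne' fun hzero => hne ?_
  filter_upwards [(integral_eq_zero_iff_of_nonneg (fun x => sq_nonneg (u x))
    H.memLp.integrable_sq).1 hzero] with x hx
  exact pow_eq_zero_iff two_ne_zero |>.1 hx

theorem exists_testFunction_integral_sq_pos (hΩ : (Ω : Set Plane).Nonempty) :
    ∃ φ : 𝓓(Ω, ℝ), 0 < ∫ x in Ω, φ x ^ 2 := by
  obtain ⟨x, hx⟩ := hΩ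
  obtain ⟨f, hfΩ, hfc, hf, -, hfx⟩ := exists_contDiff_tsupport_subset (n := (⊤ : ℕ∞))
    (Ω.isOpen.mem_nhds hx)
  refine ⟨⟨f, hf, hfc, hfΩ⟩, ?_⟩
  rw [setIntegral_sq_eq]
  exact (hf.continuous.pow 2).integral_pos_of_hasCompactSupport_nonneg_nonzero
    (hfc.comp_left (g := fun s : ℝ => s ^ 2) (by simp)) (fun y => sq_nonneg (f y)) (x := x)
    (by simp [hfx])

theorem firstDirichletEigenvalue_mul_le (hΩ : (Ω : Set Plane).Nonempty)
    (hb : Bornology.IsBounded (Ω : Set Plane)) (χ : 𝓓(Ω, ℝ)) :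
    firstDirichletEigenvalue Ω * ∫ x in Ω, χ x ^ 2 ≤ energy χ := by
  obtain ⟨φ₀, hφ₀⟩ := exists_testFunction_integral_sq_pos hΩ
  have hle : firstDirichletEigenvalue Ω ≤ rayleighInf Ω :=
    csInf_le ⟨0, fun ν hν => hν.nonneg⟩ (isDirichletEigenvalue_rayleighInf hb hφ₀)
  exact (mul_le_mul_of_nonneg_right hle (integral_nonneg fun x => sq_nonneg _)).trans
    (rayleighInf_mul_le χ)

theorem H10Approx.memLp_smoothPos (H : H10Approx Ω u G φ) (c : ℝ) :
    MemLp (fun x => smoothPos c (u x)) 2 (volume.restrict (Ω : Set Plane)) :=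
  H.memLp_comp ((contDiff_smoothPos c).differentiable (by simp)) (smoothPos_zero c)
    (abs_deriv_smoothPos_le c)

theorem H10Approx.sum_integral_deriv_smoothPos_sq_le (H : H10Approx Ω u G φ) (c : ℝ) :
    ∑ i, ∫ x in Ω, deriv (smoothPos c) (u x) ^ 2 * G x i ^ 2 ≤
      ∫ x in Ω, deriv (smoothPos c) (u x) * ∑ i, G x i * G x i := by
  have hmeas : AEStronglyMeasurable (fun x => deriv (smoothPos c) (u x))
      (volume.restrict (Ω : Set Plane)) :=
    ((contDiff_smoothPos c).continuous_deriv (by simp)).comp_aestronglyMeasurable H.memLp.1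
  have hint (i : Fin 2) : Integrable (fun x => deriv (smoothPos c) (u x) * G x i ^ 2)
      (volume.restrict (Ω : Set Plane)) :=
    (H.memLp_grad i).integrable_sq.bdd_mul hmeas
      (Eventually.of_forall fun x => abs_deriv_smoothPos_le c (u x))
  have hint_sq (i : Fin 2) : Integrable (fun x => deriv (smoothPos c) (u x) ^ 2 * G x i ^ 2)
      (volume.restrict (Ω : Set Plane)) :=
    (H.memLp_grad i).integrable_sq.bdd_mul (c := 1) (hmeas.pow 2) <|
      Eventually.of_forall fun x => (norm_pow _ 2).trans_le <|
        pow_le_one₀ (norm_nonneg _) (abs_deriv_smoothPos_le c (u x))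
  simp only [← sq, Finset.mul_sum]
  rw [integral_finsetSum _ fun i _ => hint i]
  refine Finset.sum_le_sum fun i _ => integral_mono (hint_sq i) (hint i) fun x =>
    mul_le_mul_of_nonneg_right ?_ (sq_nonneg _)
  rw [deriv_smoothPos]
  exact pow_le_of_le_one (Real.smoothTransition.nonneg _) (Real.smoothTransition.le_one _)
    two_ne_zero

theorem H10Approx.mul_integral_smoothPos_sq_le (H : H10Approx Ω u G φ) {K μ : ℝ}
    (hK : ∀ χ : 𝓓(Ω, ℝ), K * ∫ x in Ω, χ x ^ 2 ≤ energy χ)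
    (hw : HasWeakLaplacian Ω u w) (hw2 : MemLp w 2 (volume.restrict (Ω : Set Plane)))
    (hle : ∀ᵐ x ∂(volume.restrict (Ω : Set Plane)), 0 < u x → -μ * u x ≤ w x) {c : ℝ}
    (hc : 0 ≤ c) :
    K * ∫ x in Ω, smoothPos c (u x) ^ 2 ≤ μ * ∫ x in Ω, u x * smoothPos c (u x) := by
  calc K * ∫ x in Ω, smoothPos c (u x) ^ 2
      ≤ ∑ i, ∫ x in Ω, deriv (smoothPos c) (u x) ^ 2 * G x i ^ 2 :=
        H.mul_integral_comp_sq_le hK (contDiff_smoothPos c) (smoothPos_zero c)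
          (abs_deriv_smoothPos_le c)
    _ ≤ ∫ x in Ω, deriv (smoothPos c) (u x) * ∑ i, G x i * G x i :=
        H.sum_integral_deriv_smoothPos_sq_le c
    _ = ∫ x in Ω, -(smoothPos c (u x) * w x) := by
        rw [integral_neg, H.integral_deriv_comp_mul_sq hw hw2 (contDiff_smoothPos c)
          (smoothPos_zero c) (abs_deriv_smoothPos_le c)]
    _ ≤ ∫ x in Ω, μ * (u x * smoothPos c (u x)) := by
        refine integral_mono_ae ((H.memLp_smoothPos c).integrable_mul hw2).neg
          ((H.memLp.integrable_mul (H.memLp_smoothPos c)).const_mul μ) ?_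
        filter_upwards [hle] with x hx
        rcases le_or_gt (u x) 0 with hux | hux
        · simp only [smoothPos_of_nonpos hc hux, zero_mul, mul_zero, neg_zero, le_refl]
        · linarith [mul_le_mul_of_nonneg_right (hx hux) (smoothPos_nonneg hc (u x))]
    _ = μ * ∫ x in Ω, u x * smoothPos c (u x) := integral_const_mul _ _

/-- Testing `Δu = w` with `u⁺` gives `K ‖u⁺‖² ≤ ‖∇u⁺‖² ≤ μ ‖u⁺‖²`; `smoothPos c ∘ φ n` is the test
function approximating `u⁺`. -/
theorem H10Approx.ae_nonpos_of_lt_eigenvalue (H : H10Approx Ω u G φ) {K μ : ℝ}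
    (hK : ∀ χ : 𝓓(Ω, ℝ), K * ∫ x in Ω, χ x ^ 2 ≤ energy χ) (hμ : μ < K)
    (hw : HasWeakLaplacian Ω u w) (hw2 : MemLp w 2 (volume.restrict (Ω : Set Plane)))
    (hle : ∀ᵐ x ∂(volume.restrict (Ω : Set Plane)), 0 < u x → -μ * u x ≤ w x) :
    ∀ᵐ x ∂(volume.restrict (Ω : Set Plane)), u x ≤ 0 := by
  have hu2 := H.memLp.integrable_sq
  have hlim_sq : Tendsto (fun c : ℕ => ∫ x in Ω, smoothPos c (u x) ^ 2) atTop
      (𝓝 (∫ x in Ω, max (u x) 0 ^ 2)) := by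
    refine tendsto_integral_of_dominated_convergence (fun x => u x ^ 2)
      (fun c => (H.memLp_smoothPos c).1.pow 2) hu2 (fun c => Eventually.of_forall fun x => ?_)
      (Eventually.of_forall fun x => (tendsto_smoothPos (u x)).pow 2)
    rw [norm_pow, ← sq_abs (u x)]
    exact pow_le_pow_left₀ (norm_nonneg _) (abs_smoothPos_le c (u x)) 2
  have hlim_mul : Tendsto (fun c : ℕ => ∫ x in Ω, u x * smoothPos c (u x)) atTop
      (𝓝 (∫ x in Ω, u x * max (u x) 0)) := by
    refine tendsto_integral_of_dominated_convergence (fun x => u x ^ 2)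
      (fun c => H.memLp.1.mul (H.memLp_smoothPos c).1) hu2
      (fun c => Eventually.of_forall fun x => ?_)
      (Eventually.of_forall fun x => (tendsto_smoothPos (u x)).const_mul _)
    rw [norm_mul, ← sq_abs (u x), sq]
    exact mul_le_mul_of_nonneg_left (abs_smoothPos_le c (u x)) (abs_nonneg _)
  have hpos : MemLp (fun x => max (u x) 0) 2 (volume.restrict (Ω : Set Plane)) := H.memLp.pos_part
  have hmul_max (s : ℝ) : s * max s 0 = max s 0 ^ 2 := by
    rcases le_total s 0 with hs | hs
    · rw [max_eq_right hs, mul_zero, zero_pow two_ne_zero]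
    · rw [max_eq_left hs, sq]
  have hle_lim := le_of_tendsto_of_tendsto' (hlim_sq.const_mul K) (hlim_mul.const_mul μ) fun c =>
    H.mul_integral_smoothPos_sq_le hK hw hw2 hle c.cast_nonneg
  simp only [hmul_max] at hle_lim
  have hzero : ∫ x in Ω, max (u x) 0 ^ 2 = 0 := by
    refine le_antisymm ?_ (integral_nonneg fun x => sq_nonneg _)
    by_contra! hlt
    exact hle_lim.not_gt (mul_lt_mul_of_pos_right hμ hlt)
  filter_upwards [(integral_eq_zero_iff_of_nonneg (fun x => sq_nonneg (max (u x) 0))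
    hpos.integrable_sq).1 hzero] with x hx
  exact max_eq_right_iff.1 (pow_eq_zero_iff two_ne_zero |>.1 hx)

/-- A nonzero constant is not in `H₀¹`: a smooth `h` with `h 0 = 0` and `h = 1` on `[c, ∞)` would
contradict the Poincaré inequality. -/
theorem H10Approx.not_ae_ge (H : H10Approx Ω u G φ) (hΩ : (Ω : Set Plane).Nonempty)
    (hb : Bornology.IsBounded (Ω : Set Plane)) {c : ℝ} (hc : 0 < c) :
    ¬ ∀ᵐ x ∂(volume.restrict (Ω : Set Plane)), c ≤ u x := by
  intro hge
  obtain ⟨C, hC0, hC⟩ := exists_poincare_const hb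
  obtain ⟨M, hM⟩ := exists_abs_deriv_smoothTransition_le
  let h : ℝ → ℝ := fun s => Real.smoothTransition (c⁻¹ * s)
  have hh : ContDiff ℝ (⊤ : ℕ∞) h :=
    Real.smoothTransition.contDiff.comp (contDiff_const.mul contDiff_id)
  have hderiv (s : ℝ) : deriv h s = c⁻¹ * deriv Real.smoothTransition (c⁻¹ * s) := by
    rw [deriv_comp_mul_left, smul_eq_mul]
  have hone (s : ℝ) (hs : c ≤ s) : h s = 1 :=
    Real.smoothTransition.one_of_one_le (by rwa [inv_mul_eq_div, le_div_iff₀ hc, one_mul])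
  have hderiv_zero (s : ℝ) (hs : c ≤ s) : deriv h s = 0 := by
    refine IsLocalMax.deriv_eq_zero (Eventually.of_forall fun y => ?_)
    rw [hone s hs]
    exact Real.smoothTransition.le_one _
  have hpoincare := H.mul_integral_comp_sq_le (K := C⁻¹)
    (fun χ => by rw [setIntegral_sq_eq, inv_mul_le_iff₀ hC0]; exact hC χ) hh (by simp [h])
    (M := c⁻¹ * M) fun s => by
      rw [hderiv, abs_mul, abs_of_pos (inv_pos.2 hc)]
      exact mul_le_mul_of_nonneg_left (hM _) (inv_pos.2 hc).le
  have hmass : ∫ x in Ω, h (u x) ^ 2 = volume.real (Ω : Set Plane) := by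
    rw [integral_congr_ae (hge.mono fun x hx => by rw [hone _ hx])]
    simp
  have henergy (i : Fin 2) : ∫ x in Ω, deriv h (u x) ^ 2 * G x i ^ 2 = 0 :=
    integral_eq_zero_of_ae (hge.mono fun x hx => by simp [hderiv_zero _ hx])
  have hvol : 0 < volume.real (Ω : Set Plane) := ENNReal.toReal_pos
    (Ω.isOpen.measure_pos volume hΩ).ne' hb.measure_lt_top.ne
  simp only [hmass, henergy, Finset.sum_const_zero] at hpoincare
  exact hpoincare.not_gt (mul_pos (inv_pos.2 hC0) hvol)

end FirstEigenvalue

section SubConst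

variable {Ω : Opens Plane}

theorem hasWeakPartial_const (i : Fin 2) (b : ℝ) :
    HasWeakPartial Ω i (fun _ => b) (fun _ => 0) := by
  refine ⟨continuous_const.continuousOn.locallyIntegrableOn Ω.isOpen.measurableSet,
    continuous_const.continuousOn.locallyIntegrableOn Ω.isOpen.measurableSet, fun φ => ?_⟩
  rw [setIntegral_mul_eq_integral
    ((support_partialD_subset φ i).trans φ.tsupport_subset) fun _ => b,
    integral_mul_partialD φ contDiff_const i]
  simp [partialD]

theorem HasWeakPartial.sub_const {u g : Plane → ℝ} {i : Fin 2} (h : HasWeakPartial Ω i u g)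
    (b : ℝ) : HasWeakPartial Ω i (fun x => u x - b) g := by
  simpa only [sub_zero] using h.sub (hasWeakPartial_const i b)

theorem hasWeakLaplacian_const (b : ℝ) : HasWeakLaplacian Ω (fun _ => b) (fun _ => 0) := by
  refine ⟨(hasWeakPartial_const 0 b).1, (hasWeakPartial_const 0 b).2.1, fun φ => ?_⟩
  have hint (i : Fin 2) : Integrable (fun x => b * partialD i (partialD i φ) x)
      (volume.restrict (Ω : Set Plane)) :=
    integrable_mul_testFunction (hasWeakPartial_const i b).1 (testPartialD i (testPartialD i φ))
  simp only [Finset.mul_sum]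
  rw [integral_finsetSum _ fun i _ => hint i]
  refine (Finset.sum_congr rfl fun i _ =>
    (hasWeakPartial_const i b).2.2 (testPartialD i φ)).trans ?_
  simp

theorem HasWeakLaplacian.sub_const {u w : Plane → ℝ} (h : HasWeakLaplacian Ω u w) (b : ℝ) :
    HasWeakLaplacian Ω (fun x => u x - b) w := by
  have hb := hasWeakLaplacian_const (Ω := Ω) b
  refine ⟨h.1.sub hb.1, h.2.1, fun φ => ?_⟩
  have hint {v : Plane → ℝ} (hv : LocallyIntegrableOn v Ω) :
      Integrable (fun x => v x * ∑ i, partialD i (partialD i φ) x)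
        (volume.restrict (Ω : Set Plane)) := by
    simp only [Finset.mul_sum]
    exact integrable_finsetSum _ fun i _ =>
      integrable_mul_testFunction hv (testPartialD i (testPartialD i φ))
  simp only [sub_mul]
  rw [integral_sub (hint h.1) (hint hb.1), h.2.2 φ, hb.2.2 φ]
  simp

end SubConst

section AlignedGradients

variable {Ω : Opens Plane} {u w : Plane → ℝ} {G Gw : Plane → Plane} {φ : ℕ → 𝓓(Ω, ℝ)}

theorem H10Approx.ae_nonpos_or_laplacian_ae_nonpos (H : H10Approx Ω u G φ)
    (hΩ : IsPreconnected (Ω : Set Plane)) (hw : HasWeakLaplacian Ω u w)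
    (hGw : HasWeakGradient Ω w Gw)
    (hGw2 : ∀ i, MemLp (fun x => Gw x i) 2 (volume.restrict (Ω : Set Plane)))
    (hGGw : ∀ᵐ x ∂(volume.restrict (Ω : Set Plane)), 0 ≤ ∑ i, G x i * Gw x i)
    (hzero : ∀ᵐ x ∂(volume.restrict (Ω : Set Plane)), Gw x = 0 → G x = 0) :
    (∀ᵐ x ∂(volume.restrict (Ω : Set Plane)), u x ≤ 0) ∨
      ∀ᵐ x ∂(volume.restrict (Ω : Set Plane)), w x ≤ 0 := by
  rcases (H.isWeaklySuperharmonic_posPart hw hGw hGw2 hGGw hzero).ae_eq_zero_or_ae_pos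
    (fun y => le_max_right _ _) hΩ with hpos | hpos
  · exact Or.inl (hpos.mono fun x hx => max_eq_right_iff.1 hx)
  · right
    filter_upwards [hpos, H.laplacian_nonpos_of_pos hw hGw hGw2 hGGw] with x hx hwx
    exact hwx (by simpa only [lt_max_iff, lt_irrefl, or_false] using hx)

theorem HasWeakLaplacian.ae_eq_zero_of_ae_eq_zero (hw : HasWeakLaplacian Ω u w)
    (hu : ∀ᵐ x ∂(volume.restrict (Ω : Set Plane)), u x = 0) :
    ∀ᵐ x ∂(volume.restrict (Ω : Set Plane)), w x = 0 := by
  refine ae_eq_zero_of_integral_mul_testFunction hw.2.1 fun χ => ?_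
  rw [← hw.2.2 χ]
  exact integral_eq_zero_of_ae (hu.mono fun x hx => by simp only [hx, zero_mul, Pi.zero_apply])

theorem H10Approx.laplacian_nonneg_or_nonpos (H : H10Approx Ω u G φ)
    (hΩ : IsPreconnected (Ω : Set Plane)) (hw : HasWeakLaplacian Ω u w)
    (hGw : HasWeakGradient Ω w Gw)
    (hGw2 : ∀ i, MemLp (fun x => Gw x i) 2 (volume.restrict (Ω : Set Plane)))
    (hGGw : ∀ᵐ x ∂(volume.restrict (Ω : Set Plane)), 0 ≤ ∑ i, G x i * Gw x i)
    (hzero : ∀ᵐ x ∂(volume.restrict (Ω : Set Plane)), Gw x = 0 → G x = 0) :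
    (∀ᵐ x ∂(volume.restrict (Ω : Set Plane)), 0 ≤ w x) ∨
      ∀ᵐ x ∂(volume.restrict (Ω : Set Plane)), w x ≤ 0 := by
  rcases H.ae_nonpos_or_laplacian_ae_nonpos hΩ hw hGw hGw2 hGGw hzero with hu_nonpos | hw_nonpos
  · left
    rcases H.neg.ae_nonpos_or_laplacian_ae_nonpos hΩ hw.neg hGw.neg (fun i => (hGw2 i).neg)
      (hGGw.mono fun x hx => by simpa only [PiLp.neg_apply, neg_mul_neg] using hx)
      (hzero.mono fun x hx => by simpa only [neg_eq_zero] using hx) with hu_nonneg | hw_nonneg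
    · have hu_zero : ∀ᵐ x ∂(volume.restrict (Ω : Set Plane)), u x = 0 := by
        filter_upwards [hu_nonpos, hu_nonneg] with x hle hge
        exact le_antisymm hle (neg_nonpos.1 hge)
      exact (hw.ae_eq_zero_of_ae_eq_zero hu_zero).mono fun x hx => hx.ge
    · exact hw_nonneg.mono fun x hx => neg_nonpos.1 hx
  · exact Or.inr hw_nonpos

theorem HasWeakGradient.memLp_of_norm_le {C : ℝ} (hGw : HasWeakGradient Ω w Gw)
    (hG : ∀ i, MemLp (fun x => G x i) 2 (volume.restrict (Ω : Set Plane)))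
    (hle : ∀ᵐ x ∂(volume.restrict (Ω : Set Plane)), ‖Gw x‖ ≤ C * ‖G x‖) (i : Fin 2) :
    MemLp (fun x => Gw x i) 2 (volume.restrict (Ω : Set Plane)) :=
  (MemLp.of_eval_piLp hG).of_le_mul (hGw i).2.1.aestronglyMeasurable <|
    hle.mono fun x hx => (PiLp.norm_apply_le (Gw x) i).trans hx

end AlignedGradients

section SlopeCondition

theorem mul_sub_le_sub_of_le_deriv {f : ℝ → ℝ} {K : ℝ≥0} (hf : LipschitzWith K f)
    {m s t : ℝ} (hst : s ≤ t) (hm : ∀ᵐ r ∂(volume.restrict (Set.Icc s t)), m ≤ deriv f r) :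
    m * (t - s) ≤ f t - f s := by
  have hac : AbsolutelyContinuousOnInterval f s t :=
    (hf.lipschitzOnWith (s := Set.uIcc s t)).absolutelyContinuousOnInterval
  calc m * (t - s) = ∫ _ in s..t, m := by
        rw [intervalIntegral.integral_const, smul_eq_mul, mul_comm]
    _ ≤ ∫ r in s..t, deriv f r := intervalIntegral.integral_mono_ae_restrict hst
        intervalIntegrable_const hac.intervalIntegrable_deriv hm
    _ = f t - f s := hac.integral_deriv_eq_sub

variable {Ω : Opens Plane} {ψ ω : Plane → ℝ} {G : Plane → Plane} {φ : ℕ → 𝓓(Ω, ℝ)} {b : ℝ}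
  {f : ℝ → ℝ} {K : ℝ≥0}

theorem ordConnected_essRangeInterval (Ω : Opens Plane) (ψ : Plane → ℝ) :
    (essRangeInterval Ω ψ).OrdConnected :=
  ⟨fun _ hs _ ht _ hr => ⟨hs.1.trans (EReal.coe_le_coe_iff.2 hr.1),
    (EReal.coe_le_coe_iff.2 hr.2).trans ht.2⟩⟩

theorem ae_mem_essRangeInterval (Ω : Opens Plane) (ψ : Plane → ℝ) :
    ∀ᵐ x ∂(volume.restrict (Ω : Set Plane)), ψ x ∈ essRangeInterval Ω ψ := by
  filter_upwards [ae_essInf_le (μ := volume.restrict (Ω : Set Plane))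
    (f := fun x => (ψ x : EReal)), ae_le_essSup (μ := volume.restrict (Ω : Set Plane))
    (f := fun x => (ψ x : EReal))] with x hinf hsup using ⟨hinf, hsup⟩

theorem H10Approx.mem_essRangeInterval (H : H10Approx Ω (fun x => ψ x - b) G φ)
    (hΩ : (Ω : Set Plane).Nonempty) (hb : Bornology.IsBounded (Ω : Set Plane)) :
    b ∈ essRangeInterval Ω ψ := by
  constructor
  · by_contra! hlt
    obtain ⟨c, hbc, hc⟩ := EReal.lt_iff_exists_real_btwn.1 hlt
    refine H.not_ae_ge hΩ hb (sub_pos.2 (EReal.coe_lt_coe_iff.1 hbc)) ?_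
    filter_upwards [ae_lt_of_lt_essInf hc] with x hx
    exact sub_le_sub_right (EReal.coe_lt_coe_iff.1 hx).le b
  · by_contra! hlt
    obtain ⟨c, hc, hcb⟩ := EReal.lt_iff_exists_real_btwn.1 hlt
    refine H.neg.not_ae_ge hΩ hb (sub_pos.2 (EReal.coe_lt_coe_iff.1 hcb)) ?_
    filter_upwards [ae_lt_of_essSup_lt hc] with x hx
    rw [neg_sub]
    exact sub_le_sub_left (EReal.coe_lt_coe_iff.1 hx).le b

theorem exists_slope_bound_of_lt_essInf_deriv {a : ℝ} (hf : LipschitzWith K f)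
    (ha : (a : EReal) < essInf (fun s => ((deriv f s : ℝ) : EReal))
      (volume.restrict (essRangeInterval Ω ψ))) :
    ∃ m, a < m ∧ ∀ s ∈ essRangeInterval Ω ψ, ∀ t ∈ essRangeInterval Ω ψ, s ≤ t →
      m * (t - s) ≤ f t - f s := by
  obtain ⟨m, ham, hm⟩ := EReal.lt_iff_exists_real_btwn.1 ha
  refine ⟨m, EReal.coe_lt_coe_iff.1 ham, fun s hs t ht hst => mul_sub_le_sub_of_le_deriv hf hst ?_⟩
  refine ae_restrict_of_ae_restrict_of_subset ((ordConnected_essRangeInterval Ω ψ).out hs ht) ?_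
  filter_upwards [ae_lt_of_lt_essInf hm] with r hr using (EReal.coe_lt_coe_iff.1 hr).le

theorem memLp_two_comp_of_lipschitzWith {α : Type*} [MeasurableSpace α] {μ : Measure α}
    [IsFiniteMeasure μ] {v : α → ℝ} (hf : LipschitzWith K f)
    (hv : MemLp (fun x => v x - b) 2 μ) : MemLp (fun x => f (v x)) 2 μ := by
  have hsub : MemLp (fun x => f (v x) - f b) 2 μ := by
    refine hv.of_le_mul (c := K) ?_ (Eventually.of_forall fun x => ?_)
    · have hcont : Continuous fun s => f (s + b) - f b := by
        have := hf.continuous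
        fun_prop
      simpa only [Function.comp_def, sub_add_cancel] using hcont.comp_aestronglyMeasurable hv.1
    · simpa only [dist_eq_norm] using hf.dist_le_mul (v x) b
  simpa only [Pi.add_def, sub_add_cancel] using hsub.add (memLp_const (f b))

theorem H10Approx.laplacian_nonneg_or_nonpos_of_antitone (H : H10Approx Ω (fun x => ψ x - b) G φ)
    (hΩ : (Ω : Set Plane).Nonempty) (hb : Bornology.IsBounded (Ω : Set Plane))
    (hω : HasWeakLaplacian Ω ψ ω) (hf : Antitone f) (hfK : LipschitzWith K f)
    (hωf : ∀ᵐ x ∂(volume.restrict (Ω : Set Plane)), ω x = f (ψ x))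
    (hlt : ((-firstDirichletEigenvalue Ω : ℝ) : EReal) <
      essInf (fun s => ((deriv f s : ℝ) : EReal)) (volume.restrict (essRangeInterval Ω ψ))) :
    (∀ᵐ x ∂(volume.restrict (Ω : Set Plane)), 0 ≤ ω x) ∨
      ∀ᵐ x ∂(volume.restrict (Ω : Set Plane)), ω x ≤ 0 := by
  have : IsFiniteMeasure (volume.restrict (Ω : Set Plane)) := ⟨by simpa using hb.measure_lt_top⟩
  obtain ⟨m, hm, hslope⟩ := exists_slope_bound_of_lt_essInf_deriv hfK hlt
  have hb_mem := H.mem_essRangeInterval hΩ hb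
  have hpoincare := firstDirichletEigenvalue_mul_le hΩ hb
  have hω2 : MemLp ω 2 (volume.restrict (Ω : Set Plane)) :=
    (memLp_congr_ae hωf).2 (memLp_two_comp_of_lipschitzWith hfK H.memLp)
  have hlap := hω.sub_const b
  rcases le_total 0 (f b) with hfb | hfb
  · left
    have hψ_le := H.ae_nonpos_of_lt_eigenvalue hpoincare (neg_lt.1 hm) hlap hω2 <| by
      filter_upwards [hωf, ae_mem_essRangeInterval Ω ψ] with x hx hmem hpos
      linarith [hslope b hb_mem _ hmem (sub_pos.1 hpos).le]
    filter_upwards [hωf, hψ_le] with x hx hle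
    exact hx ▸ hfb.trans (hf (sub_nonpos.1 hle))
  · right
    have hle_ψ := H.neg.ae_nonpos_of_lt_eigenvalue hpoincare (neg_lt.1 hm) hlap.neg hω2.neg <| by
      filter_upwards [hωf, ae_mem_essRangeInterval Ω ψ] with x hx hmem hpos
      linarith [hslope _ hmem b hb_mem (by linarith)]
    filter_upwards [hωf, hle_ψ] with x hx hle
    exact hx ▸ (hf (by linarith)).trans hfb

end SlopeCondition

theorem lemma2p5_general (Ω : Opens Plane) (hΩ : IsConnected (Ω : Set Plane)) (ψ ω : Plane → ℝ)
    (hω : HasWeakLaplacian Ω ψ ω) (hψ : ∃ b : ℝ, MemH10 Ω (fun x => ψ x - b))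
    (h : (∃ Gψ Gω : Plane → Plane, HasWeakGradient Ω ψ Gψ ∧ HasWeakGradient Ω ω Gω ∧
        (∃ C : ℝ, ∀ᵐ x ∂(volume.restrict (Ω : Set Plane)), ‖Gω x‖ ≤ C * ‖Gψ x‖) ∧
        (∀ᵐ x ∂(volume.restrict (Ω : Set Plane)), Gω x = 0 → Gψ x = 0) ∧
        ∀ᵐ x ∂(volume.restrict (Ω : Set Plane)), 0 ≤ inner ℝ (Gψ x) (Gω x)) ∨
      (Bornology.IsBounded (Ω : Set Plane) ∧
        ∃ f : ℝ → ℝ, Antitone f ∧ (∃ K : ℝ≥0, LipschitzWith K f) ∧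
          (∀ᵐ x ∂(volume.restrict (Ω : Set Plane)), ω x = f (ψ x)) ∧
          ((-firstDirichletEigenvalue Ω : ℝ) : EReal) <
            essInf (fun s => ((deriv f s : ℝ) : EReal))
              (volume.restrict (essRangeInterval Ω ψ)))) :
    (∀ᵐ x ∂(volume.restrict (Ω : Set Plane)), 0 ≤ ω x) ∨
      ∀ᵐ x ∂(volume.restrict (Ω : Set Plane)), ω x ≤ 0 := by
  obtain ⟨b, hψb⟩ := hψ
  obtain ⟨G, φ, H⟩ := hψb.exists_approx
  rcases h with ⟨Gψ, Gω, hGψ, hGω, ⟨C, hC⟩, hzero, hinner⟩ | ⟨hb, f, hf, ⟨K, hfK⟩, hωf, hlt⟩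
  · have hG : ∀ᵐ x ∂(volume.restrict (Ω : Set Plane)), G x = Gψ x :=
      H.grad.ae_unique fun i => (hGψ i).sub_const b
    refine H.laplacian_nonneg_or_nonpos hΩ.isPreconnected (hω.sub_const b) hGω
      (hGω.memLp_of_norm_le (C := C) H.memLp_grad ?_) ?_ ?_
    · filter_upwards [hG, hC] with x hGx hCx using hGx ▸ hCx
    · filter_upwards [hG, hinner] with x hGx hx
      simpa only [hGx, PiLp.inner_apply, RCLike.inner_apply, conj_trivial, mul_comm] using hx
    · filter_upwards [hG, hzero] with x hGx hx using hGx ▸ hx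
  · exact H.laplacian_nonneg_or_nonpos_of_antitone hΩ.nonempty hb hω hf hfK hωf hlt

theorem lemma2p5 (Ω : Opens Plane) (hΩ : IsConnected (Ω : Set Plane))
    (hb : Bornology.IsBounded (Ω : Set Plane)) (ψ ω : Plane → ℝ)
    (hflow : IsSteadyFlow Ω ψ ω) (hstable : ArnoldStable Ω ψ ω) :
    (∀ᵐ x ∂(volume.restrict (Ω : Set Plane)), 0 ≤ ω x) ∨
      (∀ᵐ x ∂(volume.restrict (Ω : Set Plane)), ω x ≤ 0) := by
  obtain ⟨-, Gψ, Gω, hGψ, hGω, ⟨C, hC0, hC⟩, hcase⟩ := hstable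
  refine lemma2p5_general Ω hΩ ψ ω hflow.vorticity hflow.boundary
    (hcase.imp (fun hpar => ⟨Gψ, Gω, hGψ, hGω, ⟨C, hC.mono fun x hx => hx.2⟩, ?_, ?_⟩)
      fun h => ⟨hb, h.2⟩)
  · filter_upwards [hC] with x hx hGωx
    simpa [hGωx, inv_mul_le_iff₀ hC0] using hx.1
  · exact hpar.mono fun x hx => hx ▸ by positivity
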